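/- **Setting.** Let $d_x,d_z,I,L\ge 0$ be integers, $\mathcal I=\{1,\dots,I\}$, $\mathcal I_0=\mathcal I\cup\{0\}$, $\mathcal L=\{1,\dots,L\}$, $\mathcal L_0=\mathcal L\cup\{0\}$. A function $g:\mathbb R^d\to\overline{\mathbb R}$ is *proper* if $g>-\infty$ everywhere and $\operatorname{dom}(g)=\{g<+\infty\}\neq\emptyset$; it is *closed* if it is lower semicontinuous and either nowhere or everywhere equal to $-\infty$. Let $f_i:\mathbb R^{d_x}\times\mathbb R^{d_z}\to\overline{\mathbb R}$ ($i\in\mathcal I_0$) be such that $f_i(\cdot,z)$ is proper, closed and convex for every $z$ and $-f_i(x,\cdot)$ is proper, closed and convex for every $x$. Let $c_\ell:\mathbb R^{d_z}\to\overline{\mathbb R}$ ($\ell\in\mathcal L$) be proper, closed and convex, and suppose that $\mathcal Z=\{z: c_\ell(z)\le 0\ \forall \ell\in\mathcal L\}$ is nonempty. Write $g^*(w)=\sup_x\{x^\top w-g(x)\}$ for the conjugate, $f^{*1}(w,z)=\sup_x\{w^\top x-f(x,z)\}$ and $f^{*2}(x,y)=\sup_z\{y^\top z-f(x,z)\}$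 for the partial conjugates. For $g$ proper, closed and convex, $t\,g(x/t)$ with $t\ge 0$ denotes the convex perspective: the usual expression if $t>0$, and $0\,g(x/0)=\sup\{x^\top w: g^*(w)<+\infty\}$ if $t=0$; it is set to $+\infty$ for $t<0$. In $\lambda_i f_i^{*1}(w_i/\lambda_i,\upsilon_i/\lambda_i)$ the perspective is that of $f_i^{*1}$ as a function of both arguments jointly. Consider $$\text{(P-W')}\quad \begin{array}{ll}\inf & (-f_0)^{*2}(x,y_{00})+\sum_{\ell\in\mathcal L}\nu_{0\ell}c_\ell^*(y_{0\ell}/\nu_{0\ell})\\ \text{s.t.} & (-f_i)^{*2}(x,y_{i0})+\sum_{\ell\in\mathcal L}\nu_{i\ell}c_\ell^*(y_{i\ell}/\nu_{i\ell})\le 0\quad \forall i\in\mathcal I,\\ & \sum_{\ell\in\mathcal L_0}y_{i\ell}=0\quad\forall i\in\mathcal I_0,\\ & x\in\mathbb R^{d_x},\ y_{i\ell}\in\mathbb R^{d_z}\ (i\in\mathcal I_0,\ell\in\mathcal L_0),\ \nu_{i\ell}\ge 0\ (i\in\mathcal I_0,\ell\in\mathcal L),\end{array}$$ $$\text{(D-B')}\quad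 \begin{array}{ll}\sup & -f_0^{*1}(w_0,z_0)-\sum_{i\in\mathcal I}\lambda_i f_i^{*1}(w_i/\lambda_i,\upsilon_i/\lambda_i)\\ \text{s.t.} & \sum_{i\in\mathcal I_0}w_i=0,\quad c_\ell(z_0)\le 0\ \ \forall\ell\in\mathcal L,\quad \lambda_i c_\ell(\upsilon_i/\lambda_i)\le 0\ \ \forall i\in\mathcal I,\ \ell\in\mathcal L,\\ & w_i\in\mathbb R^{d_x}\ (i\in\mathcal I_0),\ z_0\in\mathbb R^{d_z},\ \lambda_i\ge 0,\ \upsilon_i\in\mathbb R^{d_z}\ (i\in\mathcal I).\end{array}$$ A point is *feasible* if it satisfies all constraints and its objective value is not $+\infty$ (for the minimization problem) or not $-\infty$ (for the maximization problem); the *feasible region* is the set of all feasible points. A problem is *solvable* if its optimal value is attained by a feasible point or if it has no feasible point. (As usual, $\inf\emptyset=+\infty$ and $\sup\emptyset=-\infty$.) A *Slater point* of one of the problems is a point that satisfies all constraints, lies in the relative interior of the domain of every constraint function and of the domain of the objective function (for (D-B'): of the negative of the objective function), and satisfies strictly every inequality constraint $g\le 0$ whose function $g$ is nonlinear, i.e.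 is not a (finite) affine function on the range of the decision variables, which is cut out by the sign restrictions $\nu\ge 0$ or $\lambda\ge 0$ (these restrictions themselves are linear). **Theorem.** The following statements hold. 1. The infimum of (P-W') is larger than or equal to the supremum of (D-B'). 2. If (P-W') admits a Slater point, then the infimum of (P-W') coincides with the supremum of (D-B'), and (D-B') is solvable. If (D-B') admits a Slater point, then the infimum of (P-W') coincides with the supremum of (D-B'), and (P-W') is solvable. 3. If the feasible region of (P-W') is nonempty and bounded, then the infimum of (P-W') coincides with the supremum of (D-B'), and (P-W') is solvable. If the feasible region of (D-B') is nonempty and bounded, then the infimum of (P-W') coincides with the supremum of (D-B'), and (D-B') is solvable. -/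

import Mathlib

/-! ### Extended real-valued convex functions on coordinate spaces

Vectors of `ℝ^d` are functions `Fin d → ℝ` (or `ι → ℝ`), with the dot product `⬝ᵥ`. Only the
dot product, the topology and boundedness of sets are used. -/

/-- The (effective) domain of an extended real-valued function. -/
def effDomain {V : Type} (f : V → EReal) : Set V := {x | f x < ⊤}

/-- `f` is proper: never `-∞`, and not identically `+∞`. -/
def IsProper {V : Type} (f : V → EReal) : Prop :=
  (∀ x, ⊥ < f x) ∧ ∃ x, f x < ⊤

/-- `f` is closed: lower semicontinuous, and either nowhere `-∞` or everywhere `-∞`. -/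
def IsClosedFun {V : Type} [TopologicalSpace V] (f : V → EReal) : Prop :=
  LowerSemicontinuous f ∧ ((∀ x, ⊥ < f x) ∨ ∀ x, f x = ⊥)

/-- `f` is convex: its epigraph is a convex set. -/
def IsConvexFun {V : Type} [AddCommGroup V] [Module ℝ V] (f : V → EReal) : Prop :=
  Convex ℝ {p : V × ℝ | f p.1 ≤ (p.2 : EReal)}

/-- `f` is proper, closed and convex. -/
structure IsProperClosedConvex {V : Type} [AddCommGroup V] [Module ℝ V] [TopologicalSpace V]
    (f : V → EReal) : Prop where
  proper : IsProper f
  closed : IsClosedFun f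
  convex : IsConvexFun f

/-- The conjugate `f^*(w) = sup_x {x^⊤ w - f(x)}`. -/
noncomputable def convexConj {ι : Type} [Fintype ι] (f : (ι → ℝ) → EReal) : (ι → ℝ) → EReal :=
  fun w => ⨆ x : ι → ℝ, ((x ⬝ᵥ w : ℝ) : EReal) - f x

/-- The support function `δ^*_X(w) = sup_{x ∈ X} x^⊤ w`. -/
noncomputable def supportFun {ι : Type} [Fintype ι] (X : Set (ι → ℝ)) : (ι → ℝ) → EReal :=
  fun w => ⨆ x ∈ X, ((x ⬝ᵥ w : ℝ) : EReal)

/-- The convex perspective, written `t f(x/t)` in the mathematics: `t f(x/t)` if `t > 0`, and the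
support function of the domain of `f^*` if `t = 0`. It is extended by `+∞` to `t < 0`. -/
noncomputable def perspective {ι : Type} [Fintype ι] (f : (ι → ℝ) → EReal)
    (x : ι → ℝ) (t : ℝ) : EReal :=
  if 0 < t then (t : EReal) * f (t⁻¹ • x)
  else if t = 0 then supportFun (effDomain (convexConj f)) x
  else ⊤

/-- The partial conjugate with respect to the first argument,
`f^{*1}(w, z) = sup_x {w^⊤ x - f(x, z)}`. -/
noncomputable def partialConj₁ {m n : ℕ} (f : (Fin m → ℝ) → (Fin n → ℝ) → EReal) :
    (Fin m → ℝ) → (Fin n → ℝ) → EReal :=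
  fun w z => ⨆ x : Fin m → ℝ, ((w ⬝ᵥ x : ℝ) : EReal) - f x z

/-- The partial conjugate with respect to the second argument,
`f^{*2}(x, y) = sup_z {y^⊤ z - f(x, z)}`. -/
noncomputable def partialConj₂ {m n : ℕ} (f : (Fin m → ℝ) → (Fin n → ℝ) → EReal) :
    (Fin m → ℝ) → (Fin n → ℝ) → EReal :=
  fun x y => ⨆ z : Fin n → ℝ, ((y ⬝ᵥ z : ℝ) : EReal) - f x z

/-- A function of two vectors, regarded as a function of the stacked vector. -/
def stacked {m n : ℕ} (g : (Fin m → ℝ) → (Fin n → ℝ) → EReal) :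
    (Fin m ⊕ Fin n → ℝ) → EReal :=
  fun p => g (p ∘ Sum.inl) (p ∘ Sum.inr)

/-! ### Optimization problems -/

/-- A system of constraints: the decision vector ranges over `ground` (free variables and
variables with a sign restriction) and satisfies `ineq i ≤ 0` and `eq j = 0`. -/
structure ConstraintSystem (V ι κ : Type) where
  ground : Set V
  ineq : ι → V → EReal
  eq : κ → V → EReal

namespace ConstraintSystem

variable {V ι κ : Type}

/-- The set of all vectors that satisfy the constraints. -/
def solutions (S : ConstraintSystem V ι κ) : Set V :=
  {p | p ∈ S.ground ∧ (∀ i, S.ineq i p ≤ 0) ∧ ∀ j, S.eq j p = 0}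

/-- The function `g`, defined on the range of the decision vector, is linear (that is, affine). -/
def IsLinear [AddCommGroup V] [Module ℝ V] (S : ConstraintSystem V ι κ) (g : V → EReal) : Prop :=
  ∃ a : V →ᵃ[ℝ] ℝ, ∀ p ∈ S.ground, g p = (a p : EReal)

/-- Slater points of the set described by a system of constraints. -/
structure IsSlaterPoint [AddCommGroup V] [Module ℝ V] [TopologicalSpace V]
    (S : ConstraintSystem V ι κ) (p : V) : Prop where
  mem_ri_ineq : ∀ i, p ∈ intrinsicInterior ℝ (effDomain (S.ineq i))
  mem_ri_eq : ∀ j, p ∈ intrinsicInterior ℝ (effDomain (S.eq j))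
  mem_solutions : p ∈ S.solutions
  strict_of_nonlinear : ∀ i, ¬ S.IsLinear (S.ineq i) → S.ineq i p < 0

/-! Minimization of `f₀` over the constraints. -/

/-- The infimum of `f₀`. -/
noncomputable def minValue (S : ConstraintSystem V ι κ) (f₀ : V → EReal) : EReal :=
  ⨅ p ∈ S.solutions, f₀ p

/-- The feasible region of the minimization problem: all constraints hold and the objective value
is not `+∞`. -/
def minRegion (S : ConstraintSystem V ι κ) (f₀ : V → EReal) : Set V :=
  {p | p ∈ S.solutions ∧ f₀ p ≠ ⊤}

/-- A minimization problem is solvable if it is infeasible, or if its infimum is attained by a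
feasible solution. -/
def MinSolvable (S : ConstraintSystem V ι κ) (f₀ : V → EReal) : Prop :=
  (S.minRegion f₀).Nonempty → ∃ p ∈ S.minRegion f₀, f₀ p = S.minValue f₀

/-- Slater points of the minimization problem. -/
def IsMinSlaterPoint [AddCommGroup V] [Module ℝ V] [TopologicalSpace V]
    (S : ConstraintSystem V ι κ) (f₀ : V → EReal) (p : V) : Prop :=
  S.IsSlaterPoint p ∧ p ∈ intrinsicInterior ℝ (effDomain f₀)

/-! Maximization of `f₀` over the constraints. -/

/-- The supremum of `f₀`. -/
noncomputable def maxValue (S : ConstraintSystem V ι κ) (f₀ : V → EReal) : EReal :=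
  ⨆ p ∈ S.solutions, f₀ p

/-- The feasible region of the maximization problem: all constraints hold and the objective value
is not `-∞`. -/
def maxRegion (S : ConstraintSystem V ι κ) (f₀ : V → EReal) : Set V :=
  {p | p ∈ S.solutions ∧ f₀ p ≠ ⊥}

/-- A maximization problem is solvable if it is infeasible, or if its supremum is attained by a
feasible solution. -/
def MaxSolvable (S : ConstraintSystem V ι κ) (f₀ : V → EReal) : Prop :=
  (S.maxRegion f₀).Nonempty → ∃ p ∈ S.maxRegion f₀, f₀ p = S.maxValue f₀

/-- Slater points of the maximization problem. -/
def IsMaxSlaterPoint [AddCommGroup V] [Module ℝ V] [TopologicalSpace V]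
    (S : ConstraintSystem V ι κ) (f₀ : V → EReal) (p : V) : Prop :=
  S.IsSlaterPoint p ∧ p ∈ intrinsicInterior ℝ (effDomain fun q => -f₀ q)

end ConstraintSystem

/-! ### The robust optimization problem and its two convex reformulations -/

/-- The data of an uncertain convex program with decision dimension `dx` and uncertainty dimension
`dz`: the objective `f 0` and the constraint functions `f i.succ`, `i : Fin I`, satisfying the
regularity condition, and the functions `c ℓ` that describe the nonempty uncertainty set. -/
structure RobustProgram (dx dz I L : ℕ) where
  f : Fin (I + 1) → (Fin dx → ℝ) → (Fin dz → ℝ) → EReal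
  c : Fin L → (Fin dz → ℝ) → EReal
  f_convex : ∀ i z, IsProperClosedConvex fun x => f i x z
  f_concave : ∀ i x, IsProperClosedConvex fun z => -f i x z
  c_convex : ∀ ℓ, IsProperClosedConvex (c ℓ)
  uncertainty_nonempty : {z | ∀ ℓ, c ℓ z ≤ 0}.Nonempty

namespace RobustProgram

/-- Decision vectors `(x, y, ν)` of the reformulated primal worst problem; `y i 0` and
`y i ℓ.succ` are the vectors `y_{i0}` and `y_{iℓ}`, and `ν i ℓ` is `ν_{iℓ}`. -/
abbrev PrimalVar (dx dz I L : ℕ) : Type :=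
  (Fin dx → ℝ) × (Fin (I + 1) → Fin (L + 1) → Fin dz → ℝ) × (Fin (I + 1) → Fin L → ℝ)

/-- Decision vectors `(w, z₀, lam, υ)` of the reformulated dual best problem; `w 0` and `w i.succ`
are the vectors `w_0` and `w_i`. -/
abbrev DualVar (dx dz I : ℕ) : Type :=
  (Fin (I + 1) → Fin dx → ℝ) × (Fin dz → ℝ) × (Fin I → ℝ) × (Fin I → Fin dz → ℝ)

variable {dx dz I L : ℕ}

/-- The function `(-f_i)^{*2}(x, y_{i0}) + ∑_ℓ ν_{iℓ} c_ℓ^*(y_{iℓ}/ν_{iℓ})`. -/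
noncomputable def primalFun (P : RobustProgram dx dz I L) (i : Fin (I + 1)) :
    PrimalVar dx dz I L → EReal :=
  fun (x, y, ν) => partialConj₂ (fun x' z => -P.f i x' z) x (y i 0) +
    ∑ ℓ : Fin L, perspective (convexConj (P.c ℓ)) (y i ℓ.succ) (ν i ℓ)

/-- The objective of the reformulated primal worst problem, to be minimized. -/
noncomputable def primalObj (P : RobustProgram dx dz I L) : PrimalVar dx dz I L → EReal :=
  P.primalFun 0

/-- The constraints of the reformulated primal worst problem. -/
noncomputable def primalConstraints (P : RobustProgram dx dz I L) :
    ConstraintSystem (PrimalVar dx dz I L) (Fin I) (Fin (I + 1) × Fin dz) where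
  ground := {(_, _, ν) | ∀ i ℓ, 0 ≤ ν i ℓ}
  ineq := fun i => P.primalFun i.succ
  eq := fun (i, k) (_, y, _) => ((∑ ℓ, y i ℓ k : ℝ) : EReal)

/-- The objective of the reformulated dual best problem, to be maximized. -/
noncomputable def dualObj (P : RobustProgram dx dz I L) : DualVar dx dz I → EReal :=
  fun (w, z₀, lam, υ) => -partialConj₁ (P.f 0) (w 0) z₀ -
    ∑ i : Fin I, perspective (stacked (partialConj₁ (P.f i.succ)))
      (Sum.elim (w i.succ) (υ i)) (lam i)

/-- The constraints of the reformulated dual best problem: `c_ℓ(z_0) ≤ 0` for all `ℓ`,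
`λ_i c_ℓ(υ_i/λ_i) ≤ 0` for all `i`, `ℓ`, `∑_i w_i = 0`, and `λ ≥ 0`. -/
noncomputable def dualConstraints (P : RobustProgram dx dz I L) :
    ConstraintSystem (DualVar dx dz I) (Fin L ⊕ Fin I × Fin L) (Fin dx) where
  ground := {(_, _, lam, _) | ∀ i, 0 ≤ lam i}
  ineq := Sum.elim (fun ℓ (_, z₀, _, _) => P.c ℓ z₀)
    (fun (i, ℓ) (_, _, lam, υ) => perspective (P.c ℓ) (υ i) (lam i))
  eq := fun k (w, _, _, _) => ((∑ i, w i k : ℝ) : EReal)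

/-- The infimum of the reformulated primal worst problem. -/
noncomputable def primalInf (P : RobustProgram dx dz I L) : EReal :=
  P.primalConstraints.minValue P.primalObj

/-- The supremum of the reformulated dual best problem. -/
noncomputable def dualSup (P : RobustProgram dx dz I L) : EReal :=
  P.dualConstraints.maxValue P.dualObj

/-- The feasible region of the reformulated primal worst problem. -/
def primalRegion (P : RobustProgram dx dz I L) : Set (PrimalVar dx dz I L) :=
  P.primalConstraints.minRegion P.primalObj

/-- The feasible region of the reformulated dual best problem. -/
def dualRegion (P : RobustProgram dx dz I L) : Set (DualVar dx dz I) :=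
  P.dualConstraints.maxRegion P.dualObj

/-- Solvability of the reformulated primal worst problem. -/
def PrimalSolvable (P : RobustProgram dx dz I L) : Prop :=
  P.primalConstraints.MinSolvable P.primalObj

/-- Solvability of the reformulated dual best problem. -/
def DualSolvable (P : RobustProgram dx dz I L) : Prop :=
  P.dualConstraints.MaxSolvable P.dualObj

end RobustProgram

/-! The bridge between the two problems is that the conjugate of `f_i^{*1}`, taken in both arguments
jointly, is `(-f_i)^{*2}` (`convexConj_dualConj`, by Fenchel–Moreau at fixed `z`). Moreover, a
perspective `t g(x/t)` with `t ≥ 0` is the supremum of `x ⬝ᵥ y - t g^*(y)` over `dom g^*`, also at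
`t = 0` (`perspective_eq`). Weak duality is then Fenchel–Young for `f_i` together with the pairing
`perspective_pairing` for `c_ℓ`. The degenerate case of two zero scales rests on recession
directions.

For strong duality each problem is lifted by giving separate copies of shared variables to the
functions that use them and equating the copies by linear constraints. The Lagrangian of the lifted
problem separates into independent blocks, whose infima are conjugates or perspectives. A multiplier
vector certifying a bound `v` is therefore a feasible point of the other problem with objective
value at least as good as `v` (`exists_dual_of_isMultiplier`, `exists_primal_of_isMultiplier`).

Multipliers come from two sources. Under a Slater condition they exist for the optimal value itself,
so the other problem attains it. The elementary proof adds one constraint at a time and uses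
algebraic core points in place of relative interiors (`exists_multipliers_slater`).

If the region is nonempty and bounded, compactness gives attainment in the problem itself. For `v`
strictly better than the optimal value, a slight relaxation of all constraints still excludes
objective level `v`. The relaxed constraints are strict at any feasible point, so multipliers exist
for each such `v` (`exists_isMultiplier_bounded`); this closes the gap. -/

/-! ### Lagrange multipliers for convex programs over a convex set -/

/-- A scalar multiplier exists if the values over points with `g > 0` and `g < 0` are compatible. -/
theorem exists_multiplier_of_cross {E : Type} {C : Set E} {c g : E → ℝ} {v : ℝ}
    (hpos : ∃ p ∈ C, 0 < g p) (hneg : ∃ p ∈ C, g p < 0)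
    (h0 : ∀ p ∈ C, g p = 0 → v ≤ c p)
    (h : ∀ p ∈ C, ∀ q ∈ C, 0 < g p → g q < 0 → (v - c p) * (-g q) ≤ (c q - v) * g p) :
    ∃ η : ℝ, ∀ p ∈ C, v ≤ c p + η * g p := by
  obtain ⟨p₀, hp₀, hgp₀⟩ := hpos
  obtain ⟨q₀, hq₀, hgq₀⟩ := hneg
  -- Points with `g p > 0` demand `η ≥ (v - c p) / g p`, points with `g q < 0` demand `η ≤ (c q - v)
  -- / (-g q)`. The cross inequality orders the two families of quotients, so the supremum of the
  -- lower ones serves.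
  set A : Set ℝ := {r | ∃ p ∈ C, 0 < g p ∧ r = (v - c p) / g p} with hA
  have hub : ∀ q ∈ C, g q < 0 → ∀ r ∈ A, r ≤ (c q - v) / (-g q) := by
    rintro q hq hgq r ⟨p, hp, hgp, rfl⟩
    rw [div_le_div_iff₀ hgp (by linarith)]
    exact h p hp q hq hgp hgq
  have hne : A.Nonempty := ⟨_, p₀, hp₀, hgp₀, rfl⟩
  have hbdd : BddAbove A := ⟨_, hub q₀ hq₀ hgq₀⟩
  refine ⟨sSup A, fun p hp => ?_⟩
  rcases lt_trichotomy (g p) 0 with hlt | heq | hgt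
  · have := csSup_le hne (hub p hp hlt)
    rw [le_div_iff₀ (by linarith)] at this
    linarith
  · simpa [heq] using h0 p hp heq
  · have := le_csSup hbdd (show (v - c p) / g p ∈ A from ⟨p, hp, hgt, rfl⟩)
    rw [div_le_iff₀ hgt] at this
    linarith

section Multipliers

variable {E : Type} [AddCommGroup E] [Module ℝ E]

/-- The algebraic relative interior: every segment of `C` that ends in the point can be prolonged
beyond it. -/
def IsCorePoint (C : Set E) (p : E) : Prop :=
  p ∈ C ∧ ∀ q ∈ C, ∃ ε : ℝ, 0 < ε ∧ p + ε • (p - q) ∈ C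

/-- `a` is affine on `C`. -/
def AffineOn (C : Set E) (a : E → ℝ) : Prop :=
  ConvexOn ℝ C a ∧ ConcaveOn ℝ C a

theorem AffineOn.map_combo {C : Set E} {a : E → ℝ} (ha : AffineOn C a) {p q : E} (hp : p ∈ C)
    (hq : q ∈ C) {s t : ℝ} (hs : 0 ≤ s) (ht : 0 ≤ t) (hst : s + t = 1) :
    a (s • p + t • q) = s * a p + t * a q :=
  le_antisymm (ha.1.2 hp hq hs ht hst) (ha.2.2 hp hq hs ht hst)

theorem AffineOn.subset {C D : Set E} {a : E → ℝ} (ha : AffineOn D a) (h : C ⊆ D)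
    (hC : Convex ℝ C) : AffineOn C a :=
  ⟨ha.1.subset h hC, ha.2.subset h hC⟩

theorem AffineOn.smul {C : Set E} {a : E → ℝ} (ha : AffineOn C a) (r : ℝ) :
    AffineOn C fun p => r * a p := by
  constructor
  · refine ⟨ha.1.1, fun p hp q hq s t hs ht hst => le_of_eq ?_⟩
    simp only [ha.map_combo hp hq hs ht hst, smul_eq_mul]; ring
  · refine ⟨ha.1.1, fun p hp q hq s t hs ht hst => le_of_eq ?_⟩
    simp only [ha.map_combo hp hq hs ht hst, smul_eq_mul]; ring

theorem AffineOn.sum {C : Set E} (hC : Convex ℝ C) {κ : Type} (J : Finset κ) {a : κ → E → ℝ}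
    (ha : ∀ k ∈ J, AffineOn C (a k)) : AffineOn C fun p => ∑ k ∈ J, a k p := by
  constructor
  · refine ⟨hC, fun p hp q hq s t hs ht hst => le_of_eq ?_⟩
    simp only [smul_eq_mul, Finset.mul_sum, ← Finset.sum_add_distrib]
    exact Finset.sum_congr rfl fun k hk => (ha k hk).map_combo hp hq hs ht hst
  · refine ⟨hC, fun p hp q hq s t hs ht hst => le_of_eq ?_⟩
    simp only [smul_eq_mul, Finset.mul_sum, ← Finset.sum_add_distrib]
    exact Finset.sum_congr rfl fun k hk => ((ha k hk).map_combo hp hq hs ht hst).symm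

theorem AffineOn.of_affineMap {C : Set E} (hC : Convex ℝ C) {a : E → ℝ} (b : E →ᵃ[ℝ] ℝ)
    (h : ∀ p ∈ C, a p = b p) : AffineOn C a := by
  have key : ∀ p ∈ C, ∀ q ∈ C, ∀ s t : ℝ, 0 ≤ s → 0 ≤ t → s + t = 1 →
      a (s • p + t • q) = s • a p + t • a q := fun p hp q hq s t hs ht hst => by
    rw [h _ (hC hp hq hs ht hst), h p hp, h q hq, Convex.combo_affine_apply hst]
  exact ⟨⟨hC, fun p hp q hq s t hs ht hst => (key p hp q hq s t hs ht hst).le⟩,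
    ⟨hC, fun p hp q hq s t hs ht hst => (key p hp q hq s t hs ht hst).ge⟩⟩

/-- Prolonging the segment from `q` beyond `p` exhibits `p` as a proper convex combination of `q`
and another point of `C`. Two nonnegative values with a vanishing weighted mean both vanish. -/
theorem IsCorePoint.affineOn_eq_zero {C : Set E} {p : E} (hp : IsCorePoint C p) {a : E → ℝ}
    (ha : AffineOn C a) (h0 : ∀ q ∈ C, 0 ≤ a q) (hap : a p = 0) : ∀ q ∈ C, a q = 0 := by
  intro q hq
  obtain ⟨ε, hε, hr⟩ := hp.2 q hq
  have h1 : (0 : ℝ) < 1 + ε := by linarith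
  have h := ha.map_combo hr hq (s := 1 / (1 + ε)) (t := ε / (1 + ε)) (by positivity)
    (by positivity) (by field_simp)
  have h2 : (1 / (1 + ε)) • (p + ε • (p - q)) + (ε / (1 + ε)) • q = p := by
    match_scalars <;> field_simp <;> ring
  rw [h2, hap] at h
  have h3 := h0 _ hr
  have h4 := h0 _ hq
  have h5 : 0 ≤ 1 / (1 + ε) * a (p + ε • (p - q)) := by positivity
  have h6 : ε / (1 + ε) * a q = 0 := le_antisymm (by linarith) (by positivity)
  rcases mul_eq_zero.1 h6 with h7 | h7
  · exact absurd h7 (by positivity)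
  · exact h7

/-- By convexity a prolongation may be shortened, so finitely many conditions can share one step
length. -/
theorem IsCorePoint.smaller {C : Set E} (hC : Convex ℝ C) {p q : E} (hp : p ∈ C) {ε δ : ℝ}
    (hε : p + ε • (p - q) ∈ C) (hδ : 0 ≤ δ) (hδε : δ ≤ ε) : p + δ • (p - q) ∈ C := by
  rcases eq_or_lt_of_le (hδ.trans hδε) with h | h
  · obtain rfl : δ = 0 := by linarith
    simpa using hp
  · have := hC hp hε (a := 1 - δ / ε) (b := δ / ε) (by
      rw [sub_nonneg, div_le_one h]; exact hδε) (by positivity) (by ring)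
    convert this using 1
    match_scalars <;> field_simp <;> ring

/-- A convex function that is negative at a core point stays nonpositive on a neighbourhood. -/
theorem IsCorePoint.inter_le {C : Set E} {p : E} (hp : IsCorePoint C p) {g : E → ℝ}
    (hg : ConvexOn ℝ C g) (hgp : g p < 0) : IsCorePoint (C ∩ {q | g q ≤ 0}) p := by
  refine ⟨⟨hp.1, hgp.le⟩, fun q hq => ?_⟩
  obtain ⟨ε, hε, hr⟩ := hp.2 q hq.1
  set r := p + ε • (p - q) with hrdef
  set M := |g r| with hM
  have hM0 : 0 ≤ M := abs_nonneg _
  have hden : 0 < M - g p := by linarith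
  -- The root of `(1 - t) * g p + t * M = 0`, where `M` dominates `g r`; convexity then gives a
  -- nonpositive value at the shortened prolongation.
  set t := -g p / (M - g p) with ht
  have ht0 : 0 < t := by apply div_pos <;> linarith
  have ht1 : t ≤ 1 := by rw [ht, div_le_one hden]; linarith
  have hcombo : p + (t * ε) • (p - q) = (1 - t) • p + t • r := by
    rw [hrdef]; match_scalars <;> ring
  refine ⟨t * ε, by positivity, ?_, ?_⟩
  · exact IsCorePoint.smaller hg.1 hp.1 hr (by positivity) (by nlinarith)
  · have h := hg.2 hp.1 hr (show 0 ≤ 1 - t by linarith) ht0.le (by ring)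
    simp only [Set.mem_ofPred_eq, hcombo]
    refine h.trans ?_
    simp only [smul_eq_mul]
    have h1 : t * g r ≤ t * M := mul_le_mul_of_nonneg_left (le_abs_self _) ht0.le
    have h2 : t * (M - g p) = -g p := by rw [ht]; field_simp
    nlinarith

theorem IsCorePoint.inter_eq {C : Set E} {p : E} (hp : IsCorePoint C p) {a : E → ℝ}
    (ha : AffineOn C a) (hap : a p = 0) : IsCorePoint (C ∩ {q | a q = 0}) p := by
  refine ⟨⟨hp.1, hap⟩, fun q hq => ?_⟩
  obtain ⟨ε, hε, hr⟩ := hp.2 q hq.1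
  refine ⟨ε, hε, hr, ?_⟩
  have h1 : (0 : ℝ) < 1 + ε := by linarith
  have h := ha.map_combo hr hq.1 (s := 1 / (1 + ε)) (t := ε / (1 + ε)) (by positivity)
    (by positivity) (by field_simp)
  have h2 : (1 / (1 + ε)) • (p + ε • (p - q)) + (ε / (1 + ε)) • q = p := by
    match_scalars <;> field_simp <;> ring
  have hq0 : a q = 0 := hq.2
  rw [h2, hap, hq0, mul_zero, add_zero] at h
  rcases mul_eq_zero.1 h.symm with h7 | h7
  · exact absurd h7 (by positivity)
  · exact h7

theorem convex_inter_le {C : Set E} {g : E → ℝ} (hg : ConvexOn ℝ C g) :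
    Convex ℝ (C ∩ {q | g q ≤ 0}) := hg.convex_le 0

theorem AffineOn.convex_inter_eq {C : Set E} {a : E → ℝ} (ha : AffineOn C a) :
    Convex ℝ (C ∩ {q | a q = 0}) := by
  intro p hp q hq s t hs ht hst
  refine ⟨ha.1.1 hp.1 hq.1 hs ht hst, ?_⟩
  have h1 : a p = 0 := hp.2
  have h2 : a q = 0 := hq.2
  simp [ha.map_combo hp.1 hq.1 hs ht hst, h1, h2]

/-- For `g q > 0 > g r`, the convex combination of `q` and `r` at which the chord of `g` vanishes
satisfies the constraint. The lower bound there, bounded above by the chord of `c`, is the cross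
inequality. -/
theorem exists_multiplier_le {C : Set E} {c g : E → ℝ} (hc : ConvexOn ℝ C c)
    (hg : ConvexOn ℝ C g) {p : E} (hp : p ∈ C) (hgp : g p < 0) {v : ℝ}
    (hv : ∀ q ∈ C, g q ≤ 0 → v ≤ c q) : ∃ μ : ℝ, 0 ≤ μ ∧ ∀ q ∈ C, v ≤ c q + μ * g q := by
  by_cases hpos : ∃ q ∈ C, 0 < g q
  swap
  · push Not at hpos
    exact ⟨0, le_rfl, fun q hq => by simpa using hv q hq (hpos q hq)⟩
  obtain ⟨η, hη⟩ := exists_multiplier_of_cross hpos ⟨p, hp, hgp⟩ (fun q hq h => hv q hq h.le)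
    (c := c) (v := v) (fun q hq r hr hgq hgr => by
      have hd : 0 < g q - g r := by linarith
      have hs : 0 ≤ -g r / (g q - g r) := div_nonneg (by linarith) hd.le
      have ht : 0 ≤ g q / (g q - g r) := div_nonneg hgq.le hd.le
      have hst : -g r / (g q - g r) + g q / (g q - g r) = 1 := by field_simp; ring
      have h1 := hc.2 hq hr hs ht hst
      have h2 := hg.2 hq hr hs ht hst
      have h3 : -g r / (g q - g r) * g q + g q / (g q - g r) * g r = 0 := by field_simp; ring
      have h4 := hv _ (hg.1 hq hr hs ht hst)
        (h2.trans (by simp only [smul_eq_mul]; exact h3.le))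
      have h5 := h4.trans h1
      simp only [smul_eq_mul] at h5
      have h6 : -g r / (g q - g r) * c q + g q / (g q - g r) * c r =
        (-g r * c q + g q * c r) / (g q - g r) := by field_simp
      rw [h6, le_div_iff₀ hd] at h5
      linarith)
  -- A negative `η` may be raised to zero: where `g ≤ 0` the hypothesis applies directly, and where
  -- `g > 0` the term `η * g` was only a loss.
  refine ⟨max η 0, le_max_right _ _, fun q hq => ?_⟩
  rcases le_total 0 η with h | h
  · rw [max_eq_left h]; exact hη q hq
  · rw [max_eq_right h]
    rcases le_or_gt (g q) 0 with h' | h'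
    · simpa using hv q hq h'
    · have := hη q hq
      nlinarith

/-- If `a` has one sign on `C`, it vanishes identically because it vanishes at a core point, and the
multiplier `0` works. Otherwise both signs occur and the cross inequality follows from the zero of
`a` on a segment. -/
theorem exists_multiplier_eq {C : Set E} {c a : E → ℝ} (hc : ConvexOn ℝ C c)
    (ha : AffineOn C a) {p : E} (hp : IsCorePoint C p) (hap : a p = 0) {v : ℝ}
    (hv : ∀ q ∈ C, a q = 0 → v ≤ c q) : ∃ η : ℝ, ∀ q ∈ C, v ≤ c q + η * a q := by
  by_cases hpos : ∃ q ∈ C, 0 < a q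
  swap
  · push Not at hpos
    have h := hp.affineOn_eq_zero (ha.smul (-1)) (fun q hq => by have := hpos q hq; linarith)
      (by simp [hap])
    exact ⟨0, fun q hq => by simpa using hv q hq (by have := h q hq; linarith)⟩
  by_cases hneg : ∃ q ∈ C, a q < 0
  swap
  · push Not at hneg
    have h := hp.affineOn_eq_zero ha hneg hap
    exact ⟨0, fun q hq => by simpa using hv q hq (h q hq)⟩
  refine exists_multiplier_of_cross hpos hneg hv (fun q hq r hr hgq hgr => ?_)
  have hd : 0 < a q - a r := by linarith
  have hs : 0 ≤ -a r / (a q - a r) := div_nonneg (by linarith) hd.le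
  have ht : 0 ≤ a q / (a q - a r) := div_nonneg hgq.le hd.le
  have hst : -a r / (a q - a r) + a q / (a q - a r) = 1 := by field_simp; ring
  have h1 := hc.2 hq hr hs ht hst
  have h2 := ha.map_combo hq hr hs ht hst
  have h3 : -a r / (a q - a r) * a q + a q / (a q - a r) * a r = 0 := by field_simp; ring
  have h5 := (hv _ (hc.1 hq hr hs ht hst) (h2.trans h3)).trans h1
  simp only [smul_eq_mul] at h5
  have h6 : -a r / (a q - a r) * c q + a q / (a q - a r) * c r =
    (-a r * c q + a q * c r) / (a q - a r) := by field_simp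
  rw [h6, le_div_iff₀ hd] at h5
  linarith

/-- Induction: with constraint `j` absorbed into the set, the others receive multipliers. The
resulting Lagrangian is a convex function, bounded below by `v` where `g j ≤ 0`, and the
one-constraint case over `C` yields the multiplier of `j`. -/
theorem exists_multipliers_strict {κ : Type} (J : Finset κ) :
    ∀ {C : Set E} {c : E → ℝ} {g : κ → E → ℝ}, ConvexOn ℝ C c →
      (∀ j ∈ J, ConvexOn ℝ C (g j)) → ∀ {p : E}, p ∈ C → (∀ j ∈ J, g j p < 0) → ∀ {v : ℝ},
      (∀ q ∈ C, (∀ j ∈ J, g j q ≤ 0) → v ≤ c q) →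
      ∃ μ : κ → ℝ, (∀ j, 0 ≤ μ j) ∧ ∀ q ∈ C, v ≤ c q + ∑ j ∈ J, μ j * g j q := by
  classical
  induction J using Finset.induction_on with
  | empty => exact fun _ _ _ _ _ v hv => ⟨0, by simp, fun q hq => by simpa using hv q hq⟩
  | insert j J hj ih =>
    intro C c g hc hg p hp hgp v hv
    have hgj := hg j (Finset.mem_insert_self _ _)
    have hsub : C ∩ {q | g j q ≤ 0} ⊆ C := Set.inter_subset_left
    obtain ⟨μ, hμ, h⟩ := ih (C := C ∩ {q | g j q ≤ 0}) (hc.subset hsub (convex_inter_le hgj))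
      (fun k hk => (hg k (Finset.mem_insert_of_mem hk)).subset hsub (convex_inter_le hgj))
      ⟨hp, (hgp j (Finset.mem_insert_self _ _)).le⟩
      (fun k hk => hgp k (Finset.mem_insert_of_mem hk)) (v := v) (fun q hq h =>
        hv q hq.1 (fun k hk => by
          rcases Finset.mem_insert.1 hk with rfl | hk
          · exact hq.2
          · exact h k hk))
    have hconv : ConvexOn ℝ C fun q => c q + ∑ k ∈ J, μ k * g k q := by
      refine hc.add ?_
      clear h hv ih hgp hj
      induction J using Finset.induction_on with
      | empty => simpa using convexOn_const 0 hc.1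
      | insert i J hi ih =>
        simp only [Finset.sum_insert hi]
        refine ((hg i (by simp)).smul (hμ i)).add (ih fun k hk => hg k ?_)
        simp only [Finset.mem_insert] at hk ⊢
        tauto
    obtain ⟨m, hm, h'⟩ := exists_multiplier_le hconv hgj hp (hgp j (Finset.mem_insert_self _ _))
      (v := v) (fun q hq hq' => h q ⟨hq, hq'⟩)
    refine ⟨fun k => if k = j then m else μ k, fun k => ?_, fun q hq => ?_⟩
    · dsimp only; split_ifs; exacts [hm, hμ k]
    · rw [Finset.sum_insert hj]
      simp only [if_true]
      have : ∑ k ∈ J, (if k = j then m else μ k) * g k q = ∑ k ∈ J, μ k * g k q :=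
        Finset.sum_congr rfl fun k hk => by rw [if_neg (ne_of_mem_of_not_mem hk hj)]
      rw [this]
      linarith [h' q hq]

/-- The same absorption argument; it can be iterated because a core point of `C` stays one in every
slice `a j = 0` through it. -/
theorem exists_multipliers_eq {κ : Type} (J : Finset κ) :
    ∀ {C : Set E} {c : E → ℝ} {a : κ → E → ℝ}, ConvexOn ℝ C c →
      (∀ j ∈ J, AffineOn C (a j)) → ∀ {p : E}, IsCorePoint C p → (∀ j ∈ J, a j p = 0) →
      ∀ {v : ℝ}, (∀ q ∈ C, (∀ j ∈ J, a j q = 0) → v ≤ c q) →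
      ∃ η : κ → ℝ, ∀ q ∈ C, v ≤ c q + ∑ j ∈ J, η j * a j q := by
  classical
  induction J using Finset.induction_on with
  | empty => exact fun _ _ _ _ _ v hv => ⟨0, fun q hq => by simpa using hv q hq⟩
  | insert j J hj ih =>
    intro C c a hc ha p hp hap v hv
    have haj := ha j (Finset.mem_insert_self _ _)
    have hapj := hap j (Finset.mem_insert_self _ _)
    have hsub : C ∩ {q | a j q = 0} ⊆ C := Set.inter_subset_left
    obtain ⟨μ, h⟩ := ih (C := C ∩ {q | a j q = 0}) (hc.subset hsub haj.convex_inter_eq)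
      (fun k hk => (ha k (Finset.mem_insert_of_mem hk)).subset hsub haj.convex_inter_eq)
      (hp.inter_eq haj hapj)
      (fun k hk => hap k (Finset.mem_insert_of_mem hk)) (v := v) (fun q hq h =>
        hv q hq.1 (fun k hk => by
          rcases Finset.mem_insert.1 hk with rfl | hk
          · exact hq.2
          · exact h k hk))
    have hconv : ConvexOn ℝ C fun q => c q + ∑ k ∈ J, μ k * a k q :=
      hc.add (AffineOn.sum hc.1 J fun k hk => (ha k (Finset.mem_insert_of_mem hk)).smul _).1
    obtain ⟨m, h'⟩ := exists_multiplier_eq hconv haj hp hapj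
      (v := v) (fun q hq hq' => h q ⟨hq, hq'⟩)
    refine ⟨fun k => if k = j then m else μ k, fun q hq => ?_⟩
    rw [Finset.sum_insert hj]
    simp only [if_true]
    have : ∑ k ∈ J, (if k = j then m else μ k) * a k q = ∑ k ∈ J, μ k * a k q :=
      Finset.sum_congr rfl fun k hk => by rw [if_neg (ne_of_mem_of_not_mem hk hj)]
    rw [this]
    linarith [h' q hq]

/-- Moving from a core point part of the way towards any point of `C` preserves the core property.
This allows one affine constraint to be made strict without losing it. -/
theorem IsCorePoint.mix {C : Set E} {p q : E} (hp : IsCorePoint C p) (hC : Convex ℝ C)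
    (hq : q ∈ C) {t : ℝ} (ht : 0 ≤ t) (ht1 : t < 1) : IsCorePoint C ((1 - t) • p + t • q) := by
  refine ⟨hC hp.1 hq (by linarith) ht (by ring), fun r hr => ?_⟩
  obtain ⟨ε, hε, h⟩ := hp.2 r hr
  have h1t : 0 < 1 - t := by linarith
  have hd : (0 : ℝ) < 1 + t * ε := by positivity
  refine ⟨(1 - t) * ε / (1 + t * ε), by positivity, ?_⟩
  have := hC h hq (a := (1 - t) / (1 + t * ε)) (b := t * (1 + ε) / (1 + t * ε))
    (by positivity) (by positivity) (by field_simp; ring)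
  convert this using 1
  match_scalars <;> field_simp <;> ring

/-- Multipliers for affine inequalities under a core point condition. -/
theorem exists_multipliers_affine {κ : Type} (n : ℕ) :
    ∀ (J : Finset κ), J.card = n → ∀ {C : Set E} {c : E → ℝ} {a : κ → E → ℝ}, ConvexOn ℝ C c →
      (∀ j ∈ J, AffineOn C (a j)) → ∀ {p : E}, IsCorePoint C p → (∀ j ∈ J, a j p ≤ 0) →
      ∀ {v : ℝ}, (∀ q ∈ C, (∀ j ∈ J, a j q ≤ 0) → v ≤ c q) →
      ∃ μ : κ → ℝ, (∀ j, 0 ≤ μ j) ∧ ∀ q ∈ C, v ≤ c q + ∑ j ∈ J, μ j * a j q := by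
  classical
  induction n with
  | zero =>
    intro J hJ C c a _ _ p _ _ v hv
    obtain rfl := Finset.card_eq_zero.1 hJ
    exact ⟨0, by simp, fun q hq => by simpa using hv q hq⟩
  | succ n ih =>
    intro J hJ C c a hc ha p hp hap v hv
    have hJe : ∀ j ∈ J, (J.erase j).card = n := fun j hj => by
      rw [Finset.card_erase_of_mem hj, hJ]; rfl
    have hmem : ∀ {j k}, k ∈ J.erase j → k ∈ J := fun h => Finset.mem_of_mem_erase h
    -- Either some feasible point makes some constraint strict, or all constraints vanish on the
    -- whole feasible set.
    by_cases hcase : ∃ q ∈ C, (∀ j ∈ J, a j q ≤ 0) ∧ ∃ j ∈ J, a j q < 0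
    · obtain ⟨q, hq, haq, j, hj, hjq⟩ := hcase
      -- The midpoint is still a core point and strictly satisfies constraint `j`. That constraint
      -- can thus be absorbed into the set, leaving one constraint fewer.
      set r := (1 - (1 / 2 : ℝ)) • p + (1 / 2 : ℝ) • q with hr
      have hrc : IsCorePoint C r := hp.mix hc.1 hq (by norm_num) (by norm_num)
      have har : ∀ k ∈ J, a k r = (1 - 1 / 2) * a k p + 1 / 2 * a k q := fun k hk =>
        (ha k hk).map_combo hp.1 hq (by norm_num) (by norm_num) (by norm_num)
      have hle : ∀ k ∈ J, a k r ≤ 0 := fun k hk => by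
        rw [har k hk]; linarith [hap k hk, haq k hk]
      have hlt : a j r < 0 := by rw [har j hj]; linarith [hap j hj]
      have hsub : C ∩ {q | a j q ≤ 0} ⊆ C := Set.inter_subset_left
      have hcv := convex_inter_le (ha j hj).1
      obtain ⟨μ, hμ, h⟩ := ih (J.erase j) (hJe j hj) (C := C ∩ {q | a j q ≤ 0})
        (hc.subset hsub hcv) (fun k hk => (ha k (hmem hk)).subset hsub hcv)
        (hrc.inter_le (ha j hj).1 hlt) (fun k hk => hle k (hmem hk)) (v := v)
        (fun s hs h => hv s hs.1 fun k hk => by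
          by_cases hkj : k = j
          · exact hkj ▸ hs.2
          · exact h k (Finset.mem_erase.2 ⟨hkj, hk⟩))
      have hconv : ConvexOn ℝ C fun q => c q + ∑ k ∈ J.erase j, μ k * a k q :=
        hc.add (AffineOn.sum hc.1 _ fun k hk => (ha k (hmem hk)).smul _).1
      obtain ⟨m, hm, h'⟩ := exists_multiplier_le hconv (ha j hj).1 hrc.1 hlt
        (v := v) (fun q hq hq' => h q ⟨hq, hq'⟩)
      refine ⟨fun k => if k = j then m else μ k, fun k => ?_, fun q hq => ?_⟩
      · dsimp only; split_ifs; exacts [hm, hμ k]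
      · rw [← Finset.add_sum_erase _ _ hj]
        simp only [if_true]
        have : ∑ k ∈ J.erase j, (if k = j then m else μ k) * a k q =
            ∑ k ∈ J.erase j, μ k * a k q :=
          Finset.sum_congr rfl fun k hk => by rw [if_neg (Finset.ne_of_mem_erase hk)]
        rw [this]
        linarith [h' q hq]
    · push Not at hcase
      have hap0 : ∀ j ∈ J, a j p = 0 := fun j hj =>
        le_antisymm (hap j hj) (hcase p hp.1 hap j hj)
      -- Treating the constraints as equalities gives multipliers, but of uncontrolled sign.
      obtain ⟨η, hη⟩ := exists_multipliers_eq J hc ha hp hap0 (v := v)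
        (fun q hq h => hv q hq fun j hj => (h j hj).le)
      -- a positive combination of the constraints that vanishes on `C`
      have hst : ∀ j ∈ J, ∃ μ : κ → ℝ, (∀ k, 0 ≤ μ k) ∧ 1 ≤ μ j ∧
          ∀ q ∈ C, ∑ k ∈ J, μ k * a k q = 0 := by
        intro j hj
        -- Here `a j` plays the role of the objective: it is nonnegative wherever the other
        -- constraints hold, since a negative value would contradict `hcase`.
        obtain ⟨μ, hμ, h⟩ := ih (J.erase j) (hJe j hj) (ha j hj).1
          (fun k hk => ha k (hmem hk)) hp (fun k hk => hap k (hmem hk)) (v := 0)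
          (fun q hq h => by
            by_contra hlt
            push Not at hlt
            refine absurd (hcase q hq (fun k hk => ?_) j hj) (not_le.2 hlt)
            by_cases hkj : k = j
            · exact hkj ▸ hlt.le
            · exact h k (Finset.mem_erase.2 ⟨hkj, hk⟩))
        have hsum : ∀ q, ∑ k ∈ J, (if k = j then 1 else μ k) * a k q =
            a j q + ∑ k ∈ J.erase j, μ k * a k q := fun q => by
          rw [← Finset.add_sum_erase _ _ hj, if_pos rfl, one_mul]
          congr 1
          exact Finset.sum_congr rfl fun k hk => by rw [if_neg (Finset.ne_of_mem_erase hk)]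
        refine ⟨fun k => if k = j then 1 else μ k, fun k => ?_, by simp, ?_⟩
        · dsimp only; split_ifs; exacts [zero_le_one, hμ k]
        · refine hp.affineOn_eq_zero (AffineOn.sum hc.1 J fun k hk => (ha k hk).smul _)
            (fun q hq => ?_) ?_
          · rw [hsum]; exact h q hq
          · exact Finset.sum_eq_zero fun k hk => by rw [hap0 k hk, mul_zero]
      choose! θ hθ0 hθ1 hθ using hst
      -- Adding `|η j|` times the `j`-th vanishing combination for every `j` leaves the Lagrangian
      -- unchanged on `C` and raises each coefficient `η k` with `k ∈ J` by at least `|η k|`. The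
      -- outer absolute value only matters for indices outside `J`.
      refine ⟨fun k => |η k + ∑ j ∈ J, |η j| * θ j k|, fun k => abs_nonneg _, fun q hq => ?_⟩
      have hnn : ∀ k ∈ J, 0 ≤ η k + ∑ j ∈ J, |η j| * θ j k := fun k hk => by
        have h1 : |η k| * θ k k ≤ ∑ j ∈ J, |η j| * θ j k :=
          Finset.single_le_sum (f := fun j => |η j| * θ j k)
            (fun j hj => mul_nonneg (abs_nonneg _) (hθ0 j hj k)) hk
        have h2 : |η k| * 1 ≤ |η k| * θ k k :=
          mul_le_mul_of_nonneg_left (hθ1 k hk) (abs_nonneg _)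
        linarith [neg_abs_le (η k)]
      have h1 : ∑ k ∈ J, |η k + ∑ j ∈ J, |η j| * θ j k| * a k q =
          ∑ k ∈ J, η k * a k q + ∑ j ∈ J, |η j| * ∑ k ∈ J, θ j k * a k q := by
        rw [Finset.sum_congr rfl fun k hk => by rw [abs_of_nonneg (hnn k hk)]]
        simp only [add_mul, Finset.sum_add_distrib, Finset.sum_mul, Finset.mul_sum]
        rw [Finset.sum_comm]
        simp only [mul_assoc]
      rw [h1, Finset.sum_eq_zero (s := J) (f := fun j => |η j| * _)
        (fun j hj => by rw [hθ j hj q hq, mul_zero]), add_zero]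
      exact hη q hq

/-- Lagrange multipliers under a Slater condition: inequality constraints are strict at a core
point or affine, equality constraints are affine. -/
theorem exists_multipliers_slater {ι κ : Type} [Fintype ι] [Fintype κ] {C : Set E} {c : E → ℝ}
    {g : ι → E → ℝ} {a : κ → E → ℝ} (hc : ConvexOn ℝ C c) (hg : ∀ j, ConvexOn ℝ C (g j))
    (ha : ∀ k, AffineOn C (a k)) {p : E} (hp : IsCorePoint C p)
    (hgp : ∀ j, g j p < 0 ∨ g j p ≤ 0 ∧ AffineOn C (g j)) (hap : ∀ k, a k p = 0) {v : ℝ}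
    (hv : ∀ q ∈ C, (∀ j, g j q ≤ 0) → (∀ k, a k q = 0) → v ≤ c q) :
    ∃ (μ : ι → ℝ) (η : κ → ℝ), (∀ j, 0 ≤ μ j) ∧
      ∀ q ∈ C, v ≤ c q + ∑ j, μ j * g j q + ∑ k, η k * a k q := by
  classical
  set S : Finset ι := Finset.univ.filter fun j => g j p < 0 with hS
  -- the core point survives the strict constraints
  have hcore : ∀ T : Finset ι, T ⊆ S →
      Convex ℝ (C ∩ {q | ∀ j ∈ T, g j q ≤ 0}) ∧ IsCorePoint (C ∩ {q | ∀ j ∈ T, g j q ≤ 0}) p := by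
    intro T
    induction T using Finset.induction_on with
    | empty => intro; simpa using ⟨hc.1, hp⟩
    | insert j T hj ih =>
      intro hT
      obtain ⟨h1, h2⟩ := ih ((Finset.subset_insert _ _).trans hT)
      have hgj : ConvexOn ℝ (C ∩ {q | ∀ j ∈ T, g j q ≤ 0}) (g j) :=
        (hg j).subset Set.inter_subset_left h1
      have heq : C ∩ {q | ∀ k ∈ insert j T, g k q ≤ 0} =
          (C ∩ {q | ∀ j ∈ T, g j q ≤ 0}) ∩ {q | g j q ≤ 0} := by
        ext q
        simp only [Finset.forall_mem_insert, Set.mem_inter_iff, Set.mem_ofPred_eq]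
        tauto
      rw [heq]
      exact ⟨convex_inter_le hgj, h2.inter_le hgj
        (by simpa [hS] using hT (Finset.mem_insert_self j T))⟩
  obtain ⟨hconv, hcp⟩ := hcore S subset_rfl
  set D := C ∩ {q | ∀ j ∈ S, g j q ≤ 0} with hD
  have hDC : D ⊆ C := Set.inter_subset_left
  -- Each equality is split into two affine inequalities. The affine constraints get multipliers
  -- first, over the set `D` that already respects the strict ones; the strict constraints are then
  -- dualized over `C`.
  set b : ι ⊕ κ ⊕ κ → E → ℝ :=
    Sum.elim g (Sum.elim a fun k q => (-1) * a k q) with hb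
  have hnS : ∀ j, j ∉ S → g j p ≤ 0 ∧ AffineOn C (g j) := fun j hj => by
    simp only [hS, Finset.mem_filter, Finset.mem_univ, true_and] at hj
    exact (hgp j).resolve_left hj
  set J : Finset (ι ⊕ κ ⊕ κ) := Finset.disjSum Sᶜ Finset.univ with hJ
  have hbaff : ∀ j ∈ J, AffineOn C (b j) := by
    rintro (j | k | k) hj
    · exact (hnS j (by simpa [hJ] using hj)).2
    · exact ha k
    · exact (ha k).smul _
  obtain ⟨μ, hμ, h⟩ := exists_multipliers_affine _ J rfl (hc.subset hDC hconv)
    (fun j hj => (hbaff j hj).subset hDC hconv) hcp (by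
      rintro (j | k | k) hj
      · exact (hnS j (by simpa [hJ] using hj)).1
      · exact (hap k).le
      · simp [hb, hap k]) (v := v) (fun q hq hbq => hv q hq.1
        (fun j => by
          by_cases hj : j ∈ S
          · exact hq.2 j hj
          · exact hbq (Sum.inl j) (by simpa [hJ] using hj))
        (fun k => le_antisymm (hbq (Sum.inr (Sum.inl k)) (by simp [hJ]))
          (by have := hbq (Sum.inr (Sum.inr k)) (by simp [hJ]); simpa [hb] using this)))
  obtain ⟨μ', hμ', h'⟩ := exists_multipliers_strict S
    (hc.add (AffineOn.sum hc.1 J fun j hj => (hbaff j hj).smul (μ j)).1) (fun j _ => hg j) hp.1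
    (fun j hj => by simpa [hS] using hj) (v := v) (fun q hq hq' => h q ⟨hq, hq'⟩)
  refine ⟨fun j => if j ∈ S then μ' j else μ (Sum.inl j),
    fun k => μ (Sum.inr (Sum.inl k)) - μ (Sum.inr (Sum.inr k)), fun j => ?_, fun q hq => ?_⟩
  · dsimp only; split_ifs; exacts [hμ' j, hμ _]
  · refine (h' q hq).trans (le_of_eq ?_)
    rw [← Finset.sum_add_sum_compl S (fun j => (if j ∈ S then μ' j else μ (Sum.inl j)) * g j q)]
    simp only [Pi.add_apply]
    rw [hJ, Finset.sum_disjSum, Fintype.sum_sum_type]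
    have e1 : ∑ j ∈ S, (if j ∈ S then μ' j else μ (Sum.inl j)) * g j q =
        ∑ j ∈ S, μ' j * g j q := Finset.sum_congr rfl fun j hj => by rw [if_pos hj]
    have e2 : ∑ j ∈ Sᶜ, (if j ∈ S then μ' j else μ (Sum.inl j)) * g j q =
        ∑ j ∈ Sᶜ, μ (Sum.inl j) * g j q :=
      Finset.sum_congr rfl fun j hj => by rw [if_neg (Finset.mem_compl.1 hj)]
    rw [e1, e2]
    simp only [hb, Sum.elim_inl, Sum.elim_inr, sub_mul, Finset.sum_sub_distrib]
    have e3 : ∑ k, μ (Sum.inr (Sum.inr k)) * (-1 * a k q) =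
        -∑ k, μ (Sum.inr (Sum.inr k)) * a k q := by
      rw [← Finset.sum_neg_distrib]; exact Finset.sum_congr rfl fun k _ => by ring
    rw [e3]
    ring

end Multipliers

/-! ### Extended real-valued convex functions -/

theorem EReal.le_of_forall_coe_ge {a b : EReal} (h : ∀ r : ℝ, b ≤ r → a ≤ r) : a ≤ b := by
  induction b with
  | bot =>
    rw [le_bot_iff, EReal.eq_bot_iff_forall_lt]
    intro r
    exact (h (r - 1) bot_le).trans_lt (by exact_mod_cast sub_one_lt r)
  | coe b => exact h b le_rfl
  | top => exact le_top

section ConvexFun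

variable {V : Type}

theorem coe_toReal_of_mem_effDomain {f : V → EReal} (hf : ∀ x, ⊥ < f x) {x : V}
    (hx : x ∈ effDomain f) : ((f x).toReal : EReal) = f x :=
  EReal.coe_toReal (ne_of_lt hx) (hf x).ne'

variable [AddCommGroup V] [Module ℝ V]

theorem IsConvexFun.convexOn_toReal {f : V → EReal} (hf : IsConvexFun f) (hbot : ∀ x, ⊥ < f x)
    {C : Set V} (hC : Convex ℝ C) (hCf : C ⊆ effDomain f) :
    ConvexOn ℝ C fun x => (f x).toReal := by
  refine ⟨hC, fun x hx y hy s t hs ht hst => ?_⟩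
  have h := hf (x := (x, (f x).toReal)) (coe_toReal_of_mem_effDomain hbot (hCf hx)).ge
    (y := (y, (f y).toReal)) (coe_toReal_of_mem_effDomain hbot (hCf hy)).ge hs ht hst
  have h' : f (s • x + t • y) ≤ ((s • (f x).toReal + t • (f y).toReal : ℝ) : EReal) := h
  rwa [← coe_toReal_of_mem_effDomain hbot (hCf (hC hx hy hs ht hst)), EReal.coe_le_coe_iff] at h'

theorem IsConvexFun.convex_le {f : V → EReal} (hf : IsConvexFun f) (r : ℝ) :
    Convex ℝ {x | f x ≤ r} := by
  intro x hx y hy s t hs ht hst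
  have h := hf (x := (x, r)) hx (y := (y, r)) hy hs ht hst
  have h' : f (s • x + t • y) ≤ ((s • r + t • r : ℝ) : EReal) := h
  rwa [← add_smul, hst, one_smul] at h'

theorem IsConvexFun.convex_effDomain {f : V → EReal} (hf : IsConvexFun f) :
    Convex ℝ (effDomain f) := by
  intro x hx y hy s t hs ht hst
  obtain ⟨r, hr, -⟩ := EReal.lt_iff_exists_real_btwn.1 hx
  obtain ⟨r', hr', -⟩ := EReal.lt_iff_exists_real_btwn.1 hy
  have h := hf (x := (x, r)) hr.le (y := (y, r')) hr'.le hs ht hst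
  exact lt_of_le_of_lt h (EReal.coe_lt_top _)

theorem IsConvexFun.comp_linearMap {W : Type} [AddCommGroup W] [Module ℝ W] {f : V → EReal}
    (hf : IsConvexFun f) (A : W →ₗ[ℝ] V) : IsConvexFun fun x => f (A x) := by
  intro x hx y hy s t hs ht hst
  have h := hf (x := (A x.1, x.2)) hx (y := (A y.1, y.2)) hy hs ht hst
  simpa [Prod.smul_mk] using h

theorem IsConvexFun.add {f g : V → EReal} (hf : IsConvexFun f) (hg : IsConvexFun g)
    (hfb : ∀ x, ⊥ < f x) (hgb : ∀ x, ⊥ < g x) : IsConvexFun fun x => f x + g x := by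
  intro x hx y hy s t hs ht hst
  have key : ∀ p : V × ℝ, f p.1 + g p.1 ≤ (p.2 : EReal) →
      ∃ a b : ℝ, f p.1 = a ∧ g p.1 = b ∧ a + b ≤ p.2 := fun p hp => by
    have h1 : f p.1 < ⊤ := by
      by_contra h
      rw [not_lt_top_iff.1 h, EReal.top_add_of_ne_bot (hgb _).ne'] at hp
      exact absurd hp (not_le.2 (EReal.coe_lt_top _))
    have h2 : g p.1 < ⊤ := by
      by_contra h
      rw [not_lt_top_iff.1 h, EReal.add_top_of_ne_bot (hfb _).ne'] at hp
      exact absurd hp (not_le.2 (EReal.coe_lt_top _))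
    refine ⟨_, _, (coe_toReal_of_mem_effDomain hfb h1).symm,
      (coe_toReal_of_mem_effDomain hgb h2).symm, ?_⟩
    rw [← coe_toReal_of_mem_effDomain hfb h1, ← coe_toReal_of_mem_effDomain hgb h2] at hp
    exact_mod_cast hp
  obtain ⟨a, b, ha, hb, hab⟩ := key x hx
  obtain ⟨a', b', ha', hb', hab'⟩ := key y hy
  have h1 := hf (x := (x.1, a)) ha.le (y := (y.1, a')) ha'.le hs ht hst
  have h2 := hg (x := (x.1, b)) hb.le (y := (y.1, b')) hb'.le hs ht hst
  have h1' : f (s • x.1 + t • y.1) ≤ ((s * a + t * a' : ℝ) : EReal) := h1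
  have h2' : g (s • x.1 + t • y.1) ≤ ((s * b + t * b' : ℝ) : EReal) := h2
  change f (s • x.1 + t • y.1) + g (s • x.1 + t • y.1) ≤ ((s * x.2 + t * y.2 : ℝ) : EReal)
  refine (add_le_add h1' h2').trans ?_
  norm_cast
  nlinarith

theorem EReal.bot_lt_sum {ι : Type} (J : Finset ι) {f : ι → EReal} (h : ∀ j ∈ J, ⊥ < f j) :
    ⊥ < ∑ j ∈ J, f j := by
  classical
  induction J using Finset.induction_on with
  | empty => simp
  | insert j J hj ih =>
    rw [Finset.sum_insert hj]
    exact EReal.bot_lt_add_iff.2 ⟨h j (by simp), ih fun k hk => h k (by simp [hk])⟩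

theorem IsConvexFun.zero : IsConvexFun fun _ : V => (0 : EReal) := by
  have : {p : V × ℝ | (0 : EReal) ≤ (p.2 : EReal)} = {p | (0 : ℝ) ≤ (LinearMap.snd ℝ V ℝ) p} := by
    ext p; simp
  rw [IsConvexFun, this]
  exact convex_halfSpace_ge (LinearMap.isLinear _) 0

theorem IsConvexFun.sum {ι : Type} (J : Finset ι) {f : ι → V → EReal}
    (hf : ∀ j, IsConvexFun (f j)) (hb : ∀ j x, ⊥ < f j x) :
    IsConvexFun fun x => ∑ j ∈ J, f j x := by
  classical
  induction J using Finset.induction_on with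
  | empty => simpa using IsConvexFun.zero
  | insert j J hj ih =>
    simp only [Finset.sum_insert hj]
    exact (hf j).add ih (hb j) fun x => EReal.bot_lt_sum J fun k _ => hb k x

theorem IsConvexFun.iSup {ι : Type} {f : ι → V → EReal} (hf : ∀ j, IsConvexFun (f j)) :
    IsConvexFun fun x => ⨆ j, f j x := by
  have : {p : V × ℝ | (⨆ j, f j p.1) ≤ (p.2 : EReal)} =
      ⋂ j, {p : V × ℝ | f j p.1 ≤ (p.2 : EReal)} := by
    ext p; simp
  rw [IsConvexFun, this]
  exact convex_iInter hf

theorem IsConvexFun.linear (A : V →ₗ[ℝ] ℝ) (r : EReal) : IsConvexFun fun x => (A x : EReal) - r := by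
  induction r with
  | bot =>
    have : {p : V × ℝ | (A p.1 : EReal) - ⊥ ≤ (p.2 : EReal)} = ∅ := by ext p; simp
    rw [IsConvexFun, this]; exact convex_empty
  | coe r =>
    have : {p : V × ℝ | (A p.1 : EReal) - r ≤ (p.2 : EReal)} =
        {p | (A ∘ₗ LinearMap.fst ℝ V ℝ - LinearMap.snd ℝ V ℝ) p ≤ r} := by
      ext p
      simp only [Set.mem_ofPred_eq, LinearMap.sub_apply, LinearMap.comp_apply, LinearMap.fst_apply,
        LinearMap.snd_apply]
      norm_cast
      constructor <;> intro h <;> linarith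
    rw [IsConvexFun, this]; exact convex_halfSpace_le (LinearMap.isLinear _) r
  | top =>
    have : {p : V × ℝ | (A p.1 : EReal) - ⊤ ≤ (p.2 : EReal)} = Set.univ := by ext p; simp
    rw [IsConvexFun, this]; exact convex_univ

end ConvexFun

/-! ### Lower semicontinuity of extended real-valued functions -/

section Semicontinuity

variable {V : Type} [TopologicalSpace V]

theorem LowerSemicontinuous.ereal_add {f g : V → EReal} (hf : LowerSemicontinuous f)
    (hg : LowerSemicontinuous g) (hfb : ∀ x, ⊥ < f x) (hgb : ∀ x, ⊥ < g x) :
    LowerSemicontinuous fun x => f x + g x :=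
  hf.add' hg fun x => EReal.continuousAt_add (Or.inr (hgb x).ne') (Or.inl (hfb x).ne')

theorem LowerSemicontinuous.ereal_sum {ι : Type} (J : Finset ι) {f : ι → V → EReal}
    (hf : ∀ j, LowerSemicontinuous (f j)) (hb : ∀ j x, ⊥ < f j x) :
    LowerSemicontinuous fun x => ∑ j ∈ J, f j x := by
  classical
  induction J using Finset.induction_on with
  | empty => simpa using continuous_const.lowerSemicontinuous
  | insert j J hj ih =>
    simp only [Finset.sum_insert hj]
    exact (hf j).ereal_add ih (hb j) fun x => EReal.bot_lt_sum J fun k _ => hb k x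

theorem lowerSemicontinuous_coe_sub {A : V → ℝ} (hA : Continuous A) (r : EReal) :
    LowerSemicontinuous fun x => (A x : EReal) - r := by
  refine Continuous.lowerSemicontinuous (continuous_iff_continuousAt.2 fun x => ?_)
  have h : ContinuousAt (fun p : EReal × EReal => p.1 + p.2) ((A x : EReal), -r) :=
    EReal.continuousAt_add (Or.inl (EReal.coe_ne_top _)) (Or.inl (EReal.coe_ne_bot _))
  exact h.comp (f := fun x => ((A x : EReal), -r))
    (((continuous_coe_real_ereal.comp hA).prodMk continuous_const).continuousAt)

theorem LowerSemicontinuous.isClosed_le {f : V → EReal} (hf : LowerSemicontinuous f) (r : EReal) :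
    IsClosed {x | f x ≤ r} := hf.isClosed_preimage r

end Semicontinuity

/-! ### Conjugation -/

section Conjugate

variable {ι : Type} [Fintype ι]

theorem IsProperClosedConvex.lsc {V : Type} [AddCommGroup V] [Module ℝ V] [TopologicalSpace V]
    {f : V → EReal} (hf : IsProperClosedConvex f) : LowerSemicontinuous f := hf.closed.1

theorem IsProperClosedConvex.bot_lt {V : Type} [AddCommGroup V] [Module ℝ V] [TopologicalSpace V]
    {f : V → EReal} (hf : IsProperClosedConvex f) (x : V) : ⊥ < f x := hf.proper.1 x

theorem IsProperClosedConvex.mk' {V : Type} [AddCommGroup V] [Module ℝ V] [TopologicalSpace V]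
    {f : V → EReal} (h1 : ∀ x, ⊥ < f x) (h2 : ∃ x, f x < ⊤) (h3 : LowerSemicontinuous f)
    (h4 : IsConvexFun f) : IsProperClosedConvex f :=
  ⟨⟨h1, h2⟩, ⟨h3, Or.inl h1⟩, h4⟩

/-- A nonvertical hyperplane that supports the epigraph from below, or a vertical one. -/
theorem IsProperClosedConvex.separate {f : (ι → ℝ) → EReal} (hf : IsProperClosedConvex f)
    {x₀ : ι → ℝ} {r : ℝ} (hr : (r : EReal) < f x₀) :
    ∃ (w : ι → ℝ) (κ u : ℝ), 0 ≤ κ ∧ w ⬝ᵥ x₀ + κ * r < u ∧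
      ∀ x (t : ℝ), f x ≤ t → u < w ⬝ᵥ x + κ * t := by
  classical
  have hcl : IsClosed {p : (ι → ℝ) × ℝ | f p.1 ≤ (p.2 : EReal)} := by
    have h := hf.lsc.isClosed_epigraph
    exact h.preimage (continuous_fst.prodMk (continuous_coe_real_ereal.comp continuous_snd))
  obtain ⟨φ, u, h1, h2⟩ := geometric_hahn_banach_point_closed (x := (x₀, r)) hf.convex hcl
    (not_le.2 hr)
  have hφ : ∀ x t, φ (x, t) = (fun i => φ (Pi.single i 1, 0)) ⬝ᵥ x + φ (0, 1) * t := by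
    intro x t
    have e : ((x, t) : (ι → ℝ) × ℝ) = ∑ i, x i • ((Pi.single i 1, 0) : (ι → ℝ) × ℝ) +
        t • ((0, 1) : (ι → ℝ) × ℝ) := by
      ext i
      · simp [Finset.sum_apply, Prod.fst_sum, Pi.single_apply]
      · simp [Prod.snd_sum]
    rw [e, map_add, map_sum]
    simp only [map_smul, smul_eq_mul, dotProduct]
    congr 1
    · exact Finset.sum_congr rfl fun i _ => mul_comm _ _
    · ring
  refine ⟨fun i => φ (Pi.single i 1, 0), φ (0, 1), u, ?_, by rwa [← hφ], fun x t h => ?_⟩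
  · obtain ⟨x₁, hx₁⟩ := hf.proper.2
    -- With a negative coefficient, climbing in the epigraph above a point of the domain would push
    -- the functional below `u`.
    by_contra hneg
    push Not at hneg
    set κ := φ (0, 1)
    obtain ⟨t₁, ht₁⟩ : ∃ t : ℝ, f x₁ ≤ t :=
      ⟨(f x₁).toReal, (coe_toReal_of_mem_effDomain hf.bot_lt hx₁).ge⟩
    set a := (fun i => φ (Pi.single i 1, 0)) ⬝ᵥ x₁ with ha
    have h3 := h2 (x₁, max t₁ ((u - a) / κ)) (ht₁.trans (by exact_mod_cast le_max_left _ _))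
    rw [hφ] at h3
    have h4 : κ * max t₁ ((u - a) / κ) ≤ κ * ((u - a) / κ) :=
      mul_le_mul_of_nonpos_left (le_max_right _ _) hneg.le
    rw [mul_div_cancel₀ _ hneg.ne] at h4
    linarith
  · rw [← hφ]; exact h2 (x, t) h

/-- A nonvertical separating hyperplane, rescaled, is an affine minorant. A vertical one is added
with a large factor to some existing minorant: it lowers the minorant on the domain and lifts it at
`x₀`. -/
theorem IsProperClosedConvex.exists_minorant_at {f : (ι → ℝ) → EReal}
    (hf : IsProperClosedConvex f) {x₀ : ι → ℝ} {r : ℝ} (hr : (r : EReal) < f x₀) :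
    ∃ (w : ι → ℝ) (b : ℝ), r ≤ w ⬝ᵥ x₀ + b ∧ ∀ x (t : ℝ), f x ≤ t → w ⬝ᵥ x + b ≤ t := by
  have normalize : ∀ {x₀ : ι → ℝ} {r : ℝ} (w : ι → ℝ) (κ u : ℝ), 0 < κ →
      w ⬝ᵥ x₀ + κ * r < u → (∀ x (t : ℝ), f x ≤ t → u < w ⬝ᵥ x + κ * t) →
      ∃ (w : ι → ℝ) (b : ℝ), r ≤ w ⬝ᵥ x₀ + b ∧ ∀ x (t : ℝ), f x ≤ t → w ⬝ᵥ x + b ≤ t := by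
    intro x₀ r w κ u hκ h1 h2
    refine ⟨-(κ⁻¹ • w), κ⁻¹ * u, ?_, fun x t h => ?_⟩
    · rw [neg_dotProduct, smul_dotProduct, smul_eq_mul, ← sub_nonneg]
      have : -(κ⁻¹ * w ⬝ᵥ x₀) + κ⁻¹ * u - r = κ⁻¹ * (u - (w ⬝ᵥ x₀ + κ * r)) := by
        field_simp; ring
      rw [this]
      exact mul_nonneg (by positivity) (by linarith)
    · rw [neg_dotProduct, smul_dotProduct, smul_eq_mul, ← sub_nonneg]
      have : t - (-(κ⁻¹ * w ⬝ᵥ x) + κ⁻¹ * u) = κ⁻¹ * (w ⬝ᵥ x + κ * t - u) := by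
        field_simp; ring
      rw [this]
      exact mul_nonneg (by positivity) (by linarith [h2 x t h])
  obtain ⟨w, κ, u, hκ, h1, h2⟩ := hf.separate hr
  rcases hκ.lt_or_eq with hκ | rfl
  · exact normalize w κ u hκ h1 h2
  obtain ⟨x₁, hx₁⟩ := hf.proper.2
  obtain ⟨r₁, -, hr₁⟩ := EReal.lt_iff_exists_real_btwn.1 (hf.bot_lt x₁)
  obtain ⟨w₁, κ₁, u₁, hκ₁, h3, h4⟩ := hf.separate hr₁
  -- Over a point of the domain the hyperplane separates `(x₁, r₁)` from `(x₁, f x₁)`, so it cannot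
  -- be vertical.
  have hpos : 0 < κ₁ := by
    have e := coe_toReal_of_mem_effDomain hf.bot_lt hx₁
    have h5 := h4 x₁ _ e.ge
    rw [← e, EReal.coe_lt_coe_iff] at hr₁
    rcases hκ₁.lt_or_eq with h | rfl
    · exact h
    · linarith
  obtain ⟨w', b', -, hmin⟩ := normalize w₁ κ₁ u₁ hpos h3 h4
  simp only [zero_mul, add_zero] at h1 h2
  -- tilt the minorant by a large multiple of the vertical hyperplane
  set N := |r - (w' ⬝ᵥ x₀ + b')| / (u - w ⬝ᵥ x₀) with hN
  have hd : 0 < u - w ⬝ᵥ x₀ := by linarith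
  have hN0 : 0 ≤ N := by positivity
  refine ⟨w' - N • w, b' + N * u, ?_, fun x t h => ?_⟩
  · rw [sub_dotProduct, smul_dotProduct, smul_eq_mul]
    have h6 : N * (u - w ⬝ᵥ x₀) = |r - (w' ⬝ᵥ x₀ + b')| := by rw [hN]; field_simp
    linarith [le_abs_self (r - (w' ⬝ᵥ x₀ + b'))]
  · rw [sub_dotProduct, smul_dotProduct, smul_eq_mul]
    have h6 := hmin x t h
    have h7 : N * u ≤ N * w ⬝ᵥ x := mul_le_mul_of_nonneg_left (h2 x t h).le hN0
    linarith

theorem convexConj_le_iff {f : (ι → ℝ) → EReal} (hb : ∀ x, ⊥ < f x) {w : ι → ℝ} {r : ℝ} :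
    convexConj f w ≤ r ↔ ∀ x (t : ℝ), f x ≤ t → x ⬝ᵥ w - r ≤ t := by
  rw [convexConj, iSup_le_iff]
  refine forall_congr' fun x => ?_
  have hbx := hb x
  generalize f x = a at hbx
  induction a with
  | bot => exact absurd hbx (lt_irrefl _)
  | coe a =>
    norm_cast
    exact ⟨fun h t ht => by linarith, fun h => by linarith [h a le_rfl]⟩
  | top => simp

theorem convexConj_bot_lt {f : (ι → ℝ) → EReal} (h : ∃ x, f x < ⊤) (w : ι → ℝ) :
    ⊥ < convexConj f w := by
  obtain ⟨x, hx⟩ := h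
  refine lt_of_lt_of_le ?_ (le_iSup _ x)
  induction h : f x with
  | bot => simp
  | coe a => rw [← EReal.coe_sub]; exact EReal.bot_lt_coe _
  | top => rw [h] at hx; exact absurd hx (lt_irrefl _)

theorem convexConj_lsc (f : (ι → ℝ) → EReal) : LowerSemicontinuous (convexConj f) :=
  lowerSemicontinuous_iSup fun x => lowerSemicontinuous_coe_sub
    (by unfold dotProduct; fun_prop) (f x)

theorem convexConj_convex (f : (ι → ℝ) → EReal) : IsConvexFun (convexConj f) :=
  IsConvexFun.iSup fun x => IsConvexFun.linear (dotProductBilin ℝ ℝ x) (f x)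

theorem IsProperClosedConvex.conj {f : (ι → ℝ) → EReal} (hf : IsProperClosedConvex f) :
    IsProperClosedConvex (convexConj f) := by
  refine .mk' (convexConj_bot_lt hf.proper.2) ?_ (convexConj_lsc f) (convexConj_convex f)
  obtain ⟨x₁, hx₁⟩ := hf.proper.2
  obtain ⟨r₁, -, hr₁⟩ := EReal.lt_iff_exists_real_btwn.1 (hf.bot_lt x₁)
  obtain ⟨w, b, -, h⟩ := hf.exists_minorant_at hr₁
  refine ⟨w, lt_of_le_of_lt ((convexConj_le_iff hf.bot_lt (r := -b)).2 fun x t ht => ?_)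
    (EReal.coe_lt_top _)⟩
  have := h x t ht
  rw [dotProduct_comm]
  linarith

/-- The Fenchel–Moreau theorem. -/
theorem IsProperClosedConvex.biconj {f : (ι → ℝ) → EReal} (hf : IsProperClosedConvex f) :
    convexConj (convexConj f) = f := by
  funext x
  have hb := (hf.conj).bot_lt
  refine le_antisymm (EReal.le_of_forall_coe_ge fun r hr => ?_) (le_of_forall_lt fun a ha => ?_)
  · rw [convexConj_le_iff hb]
    intro w t hw
    have := (convexConj_le_iff hf.bot_lt).1 hw x r hr
    rw [dotProduct_comm]
    linarith
  · obtain ⟨r, har, hr⟩ := EReal.lt_iff_exists_real_btwn.1 ha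
    refine har.trans_le ?_
    obtain ⟨w, b, hrb, h⟩ := hf.exists_minorant_at hr
    have hw : convexConj f w ≤ ((-b : ℝ) : EReal) :=
      (convexConj_le_iff hf.bot_lt).2 fun x t ht => by
        have := h x t ht
        rw [dotProduct_comm]
        linarith
    refine le_trans ?_ (le_iSup _ w)
    refine le_trans ?_ (EReal.sub_le_sub le_rfl hw)
    norm_cast
    linarith

theorem convexConj_eq_iSup {f : (ι → ℝ) → EReal} (hb : ∀ x, ⊥ < f x) (w : ι → ℝ) :
    convexConj f w = ⨆ x : effDomain f, ((w ⬝ᵥ x - (f x).toReal : ℝ) : EReal) := by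
  refine le_antisymm (iSup_le fun x => ?_) (iSup_le fun x => le_trans ?_ (le_iSup _ (x : ι → ℝ)))
  · by_cases hx : x ∈ effDomain f
    · refine le_trans (le_of_eq ?_) (le_iSup _ (⟨x, hx⟩ : effDomain f))
      rw [EReal.coe_sub, coe_toReal_of_mem_effDomain hb hx, dotProduct_comm]
    · rw [show f x = ⊤ from not_lt_top_iff.1 hx, EReal.sub_top]
      exact bot_le
  · rw [EReal.coe_sub, coe_toReal_of_mem_effDomain hb x.2, dotProduct_comm]

theorem EReal.coe_mul_le_iff {t : ℝ} (ht : 0 < t) {a : EReal} {r : ℝ} :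
    (t : EReal) * a ≤ r ↔ a ≤ ((t⁻¹ * r : ℝ) : EReal) := by
  induction a with
  | bot => simp [EReal.coe_mul_bot_of_pos ht]
  | coe a =>
    norm_cast
    rw [inv_mul_eq_div, le_div_iff₀ ht, mul_comm]
  | top => simp [EReal.coe_mul_top_of_pos ht, -EReal.coe_mul]

/-- The convex perspective as a supremum of linear functions. -/
theorem IsProperClosedConvex.perspective_eq {g : (ι → ℝ) → EReal} (hg : IsProperClosedConvex g)
    (x : ι → ℝ) {t : ℝ} (ht : 0 ≤ t) : perspective g x t =
      ⨆ y : effDomain (convexConj g), ((x ⬝ᵥ y - t * (convexConj g y).toReal : ℝ) : EReal) := by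
  rcases ht.lt_or_eq with ht | rfl
  · have key : ∀ r : ℝ, perspective g x t ≤ r ↔ (⨆ y : effDomain (convexConj g),
        ((x ⬝ᵥ y - t * (convexConj g y).toReal : ℝ) : EReal)) ≤ r := fun r => by
      rw [perspective, if_pos ht, EReal.coe_mul_le_iff ht]
      -- Writing `g` as its own biconjugate turns `t * g (t⁻¹ • x)` into a supremum in which the
      -- factor `t` can be distributed.
      nth_rw 1 [← hg.biconj]
      rw [convexConj_eq_iSup hg.conj.bot_lt, iSup_le_iff, iSup_le_iff]
      refine forall_congr' fun y => ?_
      rw [EReal.coe_le_coe_iff, EReal.coe_le_coe_iff, smul_dotProduct, smul_eq_mul,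
        inv_mul_eq_div, inv_mul_eq_div, sub_le_iff_le_add, div_le_iff₀ ht, add_mul,
        div_mul_cancel₀ _ ht.ne', sub_le_iff_le_add, mul_comm t]
    exact le_antisymm (EReal.le_of_forall_coe_ge fun r => (key r).2)
      (EReal.le_of_forall_coe_ge fun r => (key r).1)
  · rw [perspective, if_neg (lt_irrefl _), if_pos rfl, supportFun, iSup_subtype']
    refine iSup_congr fun y => ?_
    rw [dotProduct_comm, zero_mul, sub_zero]

theorem IsProperClosedConvex.perspective_conj_eq {c : (ι → ℝ) → EReal}
    (hc : IsProperClosedConvex c) (y : ι → ℝ) {t : ℝ} (ht : 0 ≤ t) :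
    perspective (convexConj c) y t =
      ⨆ z : effDomain c, ((y ⬝ᵥ z - t * (c z).toReal : ℝ) : EReal) := by
  rw [hc.conj.perspective_eq y ht, hc.biconj]

theorem IsProperClosedConvex.perspective_bot_lt {g : (ι → ℝ) → EReal}
    (hg : IsProperClosedConvex g) (x : ι → ℝ) (t : ℝ) : ⊥ < perspective g x t := by
  rcases le_or_gt 0 t with ht | ht
  · rw [hg.perspective_eq x ht]
    obtain ⟨y, hy⟩ := hg.conj.proper.2
    exact (EReal.bot_lt_coe _).trans_le
      (le_iSup (fun y : effDomain (convexConj g) =>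
        ((x ⬝ᵥ y - t * (convexConj g y).toReal : ℝ) : EReal)) ⟨y, hy⟩)
  · rw [perspective, if_neg (not_lt.2 ht.le), if_neg ht.ne]
    exact bot_lt_top

theorem perspective_of_neg (g : (ι → ℝ) → EReal) (x : ι → ℝ) {t : ℝ} (ht : t < 0) :
    perspective g x t = ⊤ := by
  rw [perspective, if_neg (not_lt.2 ht.le), if_neg ht.ne]

theorem nonneg_of_perspective_lt_top {g : (ι → ℝ) → EReal} {x : ι → ℝ} {t : ℝ}
    (h : perspective g x t < ⊤) : 0 ≤ t := by
  by_contra ht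
  rw [perspective_of_neg g x (not_le.1 ht)] at h
  exact lt_irrefl _ h

/-- The perspective as a supremum over all `t`. -/
theorem IsProperClosedConvex.perspective_le_iff {g : (ι → ℝ) → EReal}
    (hg : IsProperClosedConvex g) {x : ι → ℝ} {t : ℝ} {r : ℝ} :
    perspective g x t ≤ r ↔
      0 ≤ t ∧ ∀ y : effDomain (convexConj g), x ⬝ᵥ y - t * (convexConj g y).toReal ≤ r := by
  rcases le_or_gt 0 t with ht | ht
  · rw [hg.perspective_eq x ht, iSup_le_iff]
    simp only [EReal.coe_le_coe_iff, ht, true_and]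
  · rw [perspective_of_neg g x ht]
    simp [ht]

/-- By `perspective_le_iff` the epigraph is the intersection of the half-space `t ≥ 0` with one
half-space for each point of the domain of the conjugate. The same description gives closedness of
the sublevel sets. -/
theorem IsProperClosedConvex.perspective_convex {g : (ι → ℝ) → EReal}
    (hg : IsProperClosedConvex g) :
    IsConvexFun fun p : (ι → ℝ) × ℝ => perspective g p.1 p.2 := by
  intro p hp q hq s t hs ht hst
  simp only [Set.mem_ofPred_eq, hg.perspective_le_iff] at hp hq ⊢
  refine ⟨?_, fun y => ?_⟩
  · have h1 := hp.1
    have h2 := hq.1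
    simp only [Prod.fst_add, Prod.snd_add, Prod.smul_fst, Prod.smul_snd, smul_eq_mul]
    positivity
  · have h1 := mul_le_mul_of_nonneg_left (hp.2 y) hs
    have h2 := mul_le_mul_of_nonneg_left (hq.2 y) ht
    simp only [Prod.fst_add, Prod.snd_add, Prod.smul_fst, Prod.smul_snd, smul_eq_mul,
      add_dotProduct, smul_dotProduct]
    linarith

theorem IsProperClosedConvex.perspective_lsc {g : (ι → ℝ) → EReal}
    (hg : IsProperClosedConvex g) :
    LowerSemicontinuous fun p : (ι → ℝ) × ℝ => perspective g p.1 p.2 := by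
  rw [lowerSemicontinuous_iff_isClosed_preimage]
  have hcoe : ∀ r : ℝ, IsClosed {p : (ι → ℝ) × ℝ | perspective g p.1 p.2 ≤ r} := fun r => by
    simp only [hg.perspective_le_iff, Set.ofPred_and, Set.ofPred_forall]
    refine (isClosed_le continuous_const continuous_snd).inter (isClosed_iInter fun y => ?_)
    refine isClosed_le ?_ continuous_const
    unfold dotProduct
    fun_prop
  intro a
  induction a with
  | bot =>
    convert isClosed_empty
    ext p
    simp only [Set.mem_preimage, Set.mem_Iic, le_bot_iff, Set.mem_empty_iff_false, iff_false]
    exact (hg.perspective_bot_lt _ _).ne'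
  | coe r => exact hcoe r
  | top => simp

/-- Along the ray through `(q, 1)` the perspective is linear, including the vertex `t = 0`. Such
points suffice as test points for multipliers, so general recession directions never need to be
evaluated there. -/
theorem IsProperClosedConvex.perspective_smul {g : (ι → ℝ) → EReal} (hg : IsProperClosedConvex g)
    {q : ι → ℝ} (hq : q ∈ effDomain g) {t : ℝ} (ht : 0 ≤ t) :
    perspective g (t • q) t = ((t * (g q).toReal : ℝ) : EReal) := by
  rcases ht.lt_or_eq with ht | rfl
  · rw [perspective, if_pos ht, smul_smul, inv_mul_cancel₀ ht.ne', one_smul, EReal.coe_mul,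
      coe_toReal_of_mem_effDomain hg.bot_lt hq]
  · rw [hg.perspective_eq _ le_rfl, zero_smul]
    obtain ⟨y, hy⟩ := hg.conj.proper.2
    have : Nonempty (effDomain (convexConj g)) := ⟨⟨y, hy⟩⟩
    simp

theorem perspective_one (g : (ι → ℝ) → EReal) (x : ι → ℝ) : perspective g x 1 = g x := by
  simp [perspective]

end Conjugate

/-! ### Convex programs with extended real-valued functions -/

section Program

variable {E : Type} {ι κ : Type} [Fintype ι] [Fintype κ]

/-- The common domain of the objective and the constraint functions. -/
def programDomain (F₀ : E → EReal) (F : ι → E → EReal) : Set E :=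
  {X | F₀ X < ⊤ ∧ ∀ j, F j X < ⊤}

variable [AddCommGroup E] [Module ℝ E]

/-- `(μ, η)` are Lagrange multipliers that certify the lower bound `v`. -/
structure IsMultiplier (F₀ : E → EReal) (F : ι → E → EReal) (a : κ → E →ₗ[ℝ] ℝ) (v : ℝ)
    (μ : ι → ℝ) (η : κ → ℝ) : Prop where
  nonneg : ∀ j, 0 ≤ μ j
  le : ∀ X ∈ programDomain F₀ F,
    v ≤ (F₀ X).toReal + ∑ j, μ j * (F j X).toReal + ∑ k, η k * a k X

omit [Fintype ι] in
theorem convex_programDomain {F₀ : E → EReal} {F : ι → E → EReal} (h₀ : IsConvexFun F₀)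
    (h : ∀ j, IsConvexFun (F j)) : Convex ℝ (programDomain F₀ F) := by
  have : programDomain F₀ F = effDomain F₀ ∩ ⋂ j, effDomain (F j) := by
    ext; simp [programDomain, effDomain]
  rw [this]
  exact h₀.convex_effDomain.inter (convex_iInter fun j => (h j).convex_effDomain)

/-- On the common domain all functions are real-valued and the real multiplier theorem applies.
Affineness is only needed there, which suits constraints that are affine merely on the
sign-restricted range. -/
theorem exists_isMultiplier_slater {F₀ : E → EReal} {F : ι → E → EReal} {a : κ → E →ₗ[ℝ] ℝ}
    (h₀ : IsConvexFun F₀) (h : ∀ j, IsConvexFun (F j)) (b₀ : ∀ X, ⊥ < F₀ X)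
    (b : ∀ j X, ⊥ < F j X) {p : E} (hp : IsCorePoint (programDomain F₀ F) p)
    (hFp : ∀ j, F j p < 0 ∨ F j p ≤ 0 ∧ ∃ g : E →ᵃ[ℝ] ℝ, ∀ X ∈ programDomain F₀ F, F j X = g X)
    (hap : ∀ k, a k p = 0) {v : ℝ}
    (hv : ∀ X, (∀ j, F j X ≤ 0) → (∀ k, a k X = 0) → v ≤ F₀ X) :
    ∃ μ η, IsMultiplier F₀ F a v μ η := by
  have hC := convex_programDomain h₀ h
  have hco : ∀ j, ∀ X ∈ programDomain F₀ F, (((F j X).toReal : ℝ) : EReal) = F j X :=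
    fun j X hX => coe_toReal_of_mem_effDomain (b j) (hX.2 j)
  obtain ⟨μ, η, hμ, hle⟩ := exists_multipliers_slater (C := programDomain F₀ F)
    (c := fun X => (F₀ X).toReal) (g := fun j X => (F j X).toReal) (a := fun k X => a k X)
    (h₀.convexOn_toReal b₀ hC fun X hX => hX.1)
    (fun j => (h j).convexOn_toReal (b j) hC fun X hX => hX.2 j)
    (fun k => AffineOn.of_affineMap hC (a k).toAffineMap fun _ _ => rfl) hp
    (fun j => (hFp j).imp
      (fun hj => by rw [← hco j p hp.1] at hj; exact_mod_cast hj)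
      (fun hj => ⟨by have := hj.1; rw [← hco j p hp.1] at this; exact_mod_cast this, by
        obtain ⟨g, hg⟩ := hj.2
        exact AffineOn.of_affineMap hC g fun X hX => by rw [hg X hX, EReal.toReal_coe]⟩))
    hap (v := v) (fun X hX hF ha => by
      have := hv X (fun j => by rw [← hco j X hX]; exact_mod_cast hF j) ha
      rw [← coe_toReal_of_mem_effDomain b₀ hX.1] at this
      exact_mod_cast this)
  exact ⟨μ, η, hμ, hle⟩

end Program

/-! ### Convex programs with a bounded feasible region -/

section Compact

variable {E : Type} {ι κ : Type} [Fintype ι] [Fintype κ]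
  [NormedAddCommGroup E] [NormedSpace ℝ E] [FiniteDimensional ℝ E]

/-- The feasible region of a convex program. -/
def programRegion (F₀ : E → EReal) (F : ι → E → EReal) (a : κ → E →ₗ[ℝ] ℝ) : Set E :=
  {X | F₀ X < ⊤ ∧ (∀ j, F j X ≤ 0) ∧ ∀ k, a k X = 0}

/-- The relaxed feasible region with objective at most `M`. -/
def relaxedRegion (F₀ : E → EReal) (F : ι → E → EReal) (a : κ → E →ₗ[ℝ] ℝ) (M ε : ℝ) : Set E :=
  {X | F₀ X ≤ M ∧ (∀ j, F j X ≤ ε) ∧ ∀ k, |a k X| ≤ ε}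

variable {F₀ : E → EReal} {F : ι → E → EReal} {a : κ → E →ₗ[ℝ] ℝ}

omit [Fintype ι] [Fintype κ] in
theorem isClosed_relaxedRegion (l₀ : LowerSemicontinuous F₀) (l : ∀ j, LowerSemicontinuous (F j))
    (M ε : ℝ) : IsClosed (relaxedRegion F₀ F a M ε) := by
  simp only [relaxedRegion, Set.ofPred_and, Set.ofPred_forall]
  refine (l₀.isClosed_le _).inter ((isClosed_iInter fun j => (l j).isClosed_le _).inter
    (isClosed_iInter fun k => isClosed_le ?_ continuous_const))
  exact (a k).continuous_of_finiteDimensional.abs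

omit [Fintype ι] [Fintype κ] [FiniteDimensional ℝ E] in
theorem convex_relaxedRegion (h₀ : IsConvexFun F₀) (h : ∀ j, IsConvexFun (F j)) (M ε : ℝ) :
    Convex ℝ (relaxedRegion F₀ F a M ε) := by
  simp only [relaxedRegion, Set.ofPred_and, Set.ofPred_forall, abs_le]
  exact (h₀.convex_le _).inter ((convex_iInter fun j => (h j).convex_le _).inter
    (convex_iInter fun k => (convex_halfSpace_ge (a k).isLinear _).inter
      (convex_halfSpace_le (a k).isLinear _)))

omit [Fintype ι] [Fintype κ] [FiniteDimensional ℝ E] in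
theorem relaxedRegion_mono {M M' ε ε' : ℝ} (hM : M ≤ M') (hε : ε ≤ ε') :
    relaxedRegion F₀ F a M ε ⊆ relaxedRegion F₀ F a M' ε' := fun X hX =>
  ⟨hX.1.trans (by exact_mod_cast hM), fun j => (hX.2.1 j).trans (by exact_mod_cast hε),
    fun k => (hX.2.2 k).trans hε⟩

omit [Fintype ι] [Fintype κ] [FiniteDimensional ℝ E] in
theorem mem_programRegion_of_forall_relaxed {M : ℝ} {X : E}
    (hX : ∀ n : ℕ, X ∈ relaxedRegion F₀ F a M (1 / ((n : ℝ) + 1))) :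
    F₀ X ≤ M ∧ X ∈ programRegion F₀ F a := by
  have hlim : Filter.Tendsto (fun n : ℕ => 1 / ((n : ℝ) + 1)) Filter.atTop (nhds 0) :=
    tendsto_one_div_add_atTop_nhds_zero_nat
  refine ⟨(hX 0).1, (hX 0).1.trans_lt (EReal.coe_lt_top _), fun j => ?_, fun k => ?_⟩
  · exact ge_of_tendsto' ((continuous_coe_real_ereal.tendsto 0).comp hlim) fun n => (hX n).2.1 j
  · exact abs_nonpos_iff.1 (ge_of_tendsto' hlim fun n => (hX n).2.2 k)

omit [Fintype ι] [Fintype κ] in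
/-- If the feasible region misses a compact set, so does a relaxed region. -/
theorem exists_relaxed_inter_eq_empty (l₀ : LowerSemicontinuous F₀)
    (l : ∀ j, LowerSemicontinuous (F j)) (M : ℝ) {K : Set E} (hK : IsCompact K)
    (hKe : ∀ X ∈ K, F₀ X ≤ M → X ∉ programRegion F₀ F a) :
    ∃ n : ℕ, ∀ X ∈ K, X ∉ relaxedRegion F₀ F a M (1 / ((n : ℝ) + 1)) := by
  by_contra hcon
  push Not at hcon
  have hmono : ∀ n : ℕ, relaxedRegion F₀ F a M (1 / (((n + 1 : ℕ) : ℝ) + 1)) ⊆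
      relaxedRegion F₀ F a M (1 / ((n : ℝ) + 1)) := fun n =>
    relaxedRegion_mono le_rfl (by
      apply one_div_le_one_div_of_le (by positivity); push_cast; linarith)
  -- Cantor's intersection theorem: if every relaxation met `K`, a common point would be feasible
  -- for the original program.
  obtain ⟨X, hX⟩ := IsCompact.nonempty_iInter_of_sequence_nonempty_isCompact_isClosed
    (fun n : ℕ => K ∩ relaxedRegion F₀ F a M (1 / ((n : ℝ) + 1)))
    (fun n => Set.inter_subset_inter_right _ (hmono n))
    (fun n => by obtain ⟨X, h1, h2⟩ := hcon n; exact ⟨X, h1, h2⟩)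
    (hK.inter_right (isClosed_relaxedRegion l₀ l _ _))
    (fun n => hK.isClosed.inter (isClosed_relaxedRegion l₀ l _ _))
  rw [Set.mem_iInter] at hX
  obtain ⟨h1, h2⟩ := mem_programRegion_of_forall_relaxed fun n => (hX n).2
  exact hKe X (hX 0).1 h1 h2

omit [Fintype ι] [Fintype κ] in
-- The region itself need not be closed, because the domain of `F₀` may be open. The sublevel set of
-- a feasible point is closed and bounded, hence compact.
theorem exists_min_of_bounded (l₀ : LowerSemicontinuous F₀)
    (l : ∀ j, LowerSemicontinuous (F j)) (hne : (programRegion F₀ F a).Nonempty)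
    (hbd : Bornology.IsBounded (programRegion F₀ F a)) :
    ∃ X ∈ programRegion F₀ F a, ∀ Y ∈ programRegion F₀ F a, F₀ X ≤ F₀ Y := by
  obtain ⟨X₁, hX₁⟩ := hne
  set S := {X | F₀ X ≤ F₀ X₁ ∧ (∀ j, F j X ≤ 0) ∧ ∀ k, a k X = 0} with hS
  have hSR : S ⊆ programRegion F₀ F a := fun X hX => ⟨hX.1.trans_lt hX₁.1, hX.2⟩
  have hScl : IsClosed S := by
    simp only [hS, Set.ofPred_and, Set.ofPred_forall]
    exact (l₀.isClosed_le _).inter ((isClosed_iInter fun j => (l j).isClosed_le _).inter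
      (isClosed_iInter fun k =>
        isClosed_eq (a k).continuous_of_finiteDimensional continuous_const))
  have : ProperSpace E := FiniteDimensional.proper ℝ E
  have hSc : IsCompact S := Metric.isCompact_of_isClosed_isBounded hScl (hbd.subset hSR)
  obtain ⟨X, hX, hmin⟩ := (l₀.lowerSemicontinuousOn S).exists_isMinOn
    ⟨X₁, show X₁ ∈ S from ⟨le_rfl, hX₁.2⟩⟩ hSc
  refine ⟨X, hSR hX, fun Y hY => ?_⟩
  rcases le_total (F₀ Y) (F₀ X₁) with h | h
  · exact isMinOn_iff.1 hmin Y ⟨h, hY.2⟩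
  · exact hX.1.trans h

omit [Fintype ι] [Fintype κ] in
/-- If the feasible region is bounded and the objective exceeds `v` on it, then a relaxed problem
has no point of objective at most `v`. -/
theorem exists_relaxed_eq_empty (h₀ : IsConvexFun F₀) (h : ∀ j, IsConvexFun (F j))
    (l₀ : LowerSemicontinuous F₀) (l : ∀ j, LowerSemicontinuous (F j)) (b₀ : ∀ X, ⊥ < F₀ X)
    (hne : (programRegion F₀ F a).Nonempty) (hbd : Bornology.IsBounded (programRegion F₀ F a))
    {v : ℝ} (hv : ∀ X ∈ programRegion F₀ F a, v < F₀ X) :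
    ∃ ε : ℝ, 0 < ε ∧ relaxedRegion F₀ F a v ε = ∅ := by
  have : ProperSpace E := FiniteDimensional.proper ℝ E
  obtain ⟨X₁, hX₁⟩ := hne
  set M := (F₀ X₁).toReal with hM
  have hMe : (M : EReal) = F₀ X₁ := coe_toReal_of_mem_effDomain b₀ hX₁.1
  have hvM : v ≤ M := by
    have := hv X₁ hX₁
    rw [← hMe] at this
    exact_mod_cast this.le
  obtain ⟨ρ, hρ⟩ := hbd.exists_norm_le
  -- A sphere strictly outside the region is missed by a relaxation at level `M`, the value at a
  -- feasible point. Inside the closed ball, a relaxation at level `v` is empty. Convexity then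
  -- excludes points beyond the sphere.
  obtain ⟨n, hn⟩ := exists_relaxed_inter_eq_empty (F₀ := F₀) (F := F) (a := a) l₀ l M
    (isCompact_sphere (0 : E) (ρ + 1)) (fun X hX _ hR => by
      have := hρ X hR
      rw [mem_sphere_zero_iff_norm] at hX
      linarith)
  obtain ⟨m, hm⟩ := exists_relaxed_inter_eq_empty (F₀ := F₀) (F := F) (a := a) l₀ l v
    (isCompact_closedBall (0 : E) (ρ + 1)) (fun X _ hX hR => absurd (hv X hR) (not_lt.2 hX))
  refine ⟨min (1 / ((n : ℝ) + 1)) (1 / ((m : ℝ) + 1)), by positivity, ?_⟩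
  rw [Set.eq_empty_iff_forall_notMem]
  intro X hX
  refine hm X ?_ (relaxedRegion_mono le_rfl (min_le_right _ _) hX)
  have hXn : X ∈ relaxedRegion F₀ F a M (1 / ((n : ℝ) + 1)) :=
    relaxedRegion_mono hvM (min_le_left _ _) hX
  have hX₁n : X₁ ∈ relaxedRegion F₀ F a M (1 / ((n : ℝ) + 1)) := by
    have hpos : (0 : ℝ) ≤ 1 / ((n : ℝ) + 1) := by positivity
    exact ⟨hMe.ge, fun j => (hX₁.2.1 j).trans (by exact_mod_cast hpos),
      fun k => by rw [hX₁.2.2 k, abs_zero]; exact hpos⟩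
  rw [mem_closedBall_zero_iff]
  by_contra hlt
  push Not at hlt
  -- the segment from `X₁` to `X` crosses the sphere
  have hcont : ContinuousOn (fun s : ℝ => ‖(1 - s) • X₁ + s • X‖) (Set.Icc 0 1) := by fun_prop
  have hivt := intermediate_value_Icc (zero_le_one' ℝ) hcont
  obtain ⟨s, hs, hsn⟩ := hivt (show ρ + 1 ∈ Set.Icc _ _ by
    simp only [sub_zero, one_smul, zero_smul, add_zero, sub_self, zero_add]
    exact ⟨by linarith [hρ X₁ hX₁], hlt.le⟩)
  refine hn _ (by rw [mem_sphere_zero_iff_norm]; exact hsn)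
    (convex_relaxedRegion h₀ h _ _ hX₁n hXn (by linarith [hs.2]) hs.1 (by ring))

/-- After relaxation by `ε`, any feasible point satisfies every constraint strictly, with each
equality replaced by two inequalities. No interiority is needed, and the multipliers of the relaxed
problem serve the original one because the discarded terms `-ε * μ` are nonpositive. -/
theorem exists_isMultiplier_bounded (h₀ : IsConvexFun F₀) (h : ∀ j, IsConvexFun (F j))
    (l₀ : LowerSemicontinuous F₀) (l : ∀ j, LowerSemicontinuous (F j)) (b₀ : ∀ X, ⊥ < F₀ X)
    (b : ∀ j X, ⊥ < F j X) (hne : (programRegion F₀ F a).Nonempty)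
    (hbd : Bornology.IsBounded (programRegion F₀ F a))
    {v : ℝ} (hv : ∀ X ∈ programRegion F₀ F a, v < F₀ X) :
    ∃ μ η, IsMultiplier F₀ F a v μ η := by
  obtain ⟨ε, hε, hemp⟩ := exists_relaxed_eq_empty h₀ h l₀ l b₀ hne hbd hv
  obtain ⟨X₁, hX₁⟩ := hne
  have hC := convex_programDomain h₀ h
  have hco : ∀ j, ∀ X ∈ programDomain F₀ F, (((F j X).toReal : ℝ) : EReal) = F j X :=
    fun j X hX => coe_toReal_of_mem_effDomain (b j) (hX.2 j)
  have hX₁C : X₁ ∈ programDomain F₀ F :=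
    ⟨hX₁.1, fun j => (hX₁.2.1 j).trans_lt EReal.zero_lt_top⟩
  set g : ι ⊕ κ ⊕ κ → E → ℝ := Sum.elim (fun j X => (F j X).toReal + (-ε))
    (Sum.elim (fun k X => a k X + (-ε)) fun k X => (-a k) X + (-ε)) with hg
  obtain ⟨μ, hμ, hle⟩ := exists_multipliers_strict (Finset.univ : Finset (ι ⊕ κ ⊕ κ))
    (C := programDomain F₀ F) (c := fun X => (F₀ X).toReal) (g := g)
    (h₀.convexOn_toReal b₀ hC fun X hX => hX.1)
    (by
      rintro (j | k | k) -
      · exact ((h j).convexOn_toReal (b j) hC fun X hX => hX.2 j).add_const _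
      · exact ((a k).convexOn hC).add_const _
      · exact ((-a k).convexOn hC).add_const _) hX₁C
    (by
      rintro (j | k | k) -
      · have := hX₁.2.1 j
        rw [← hco j X₁ hX₁C] at this
        have : (F j X₁).toReal ≤ 0 := by exact_mod_cast this
        simp only [hg, Sum.elim_inl]
        linarith
      · simp [hg, hX₁.2.2 k, hε]
      · simp [hg, hX₁.2.2 k, hε]) (v := v)
    (fun X hX hgX => by
      by_contra hlt
      push Not at hlt
      refine (Set.eq_empty_iff_forall_notMem.1 hemp X) ⟨?_, fun j => ?_, fun k => abs_le.2 ⟨?_, ?_⟩⟩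
      · rw [← coe_toReal_of_mem_effDomain b₀ hX.1]
        exact_mod_cast hlt.le
      · have := hgX (Sum.inl j) (Finset.mem_univ _)
        simp only [hg, Sum.elim_inl] at this
        rw [← hco j X hX]
        exact_mod_cast (by linarith : (F j X).toReal ≤ ε)
      · have := hgX (Sum.inr (Sum.inr k)) (Finset.mem_univ _)
        simp only [hg, Sum.elim_inr, LinearMap.neg_apply] at this
        linarith
      · have := hgX (Sum.inr (Sum.inl k)) (Finset.mem_univ _)
        simp only [hg, Sum.elim_inr, Sum.elim_inl] at this
        linarith)
  refine ⟨fun j => μ (Sum.inl j), fun k => μ (Sum.inr (Sum.inl k)) - μ (Sum.inr (Sum.inr k)),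
    fun j => hμ _, fun X hX => (hle X hX).trans ?_⟩
  rw [Fintype.sum_sum_type, Fintype.sum_sum_type, add_assoc]
  refine add_le_add le_rfl (add_le_add (Finset.sum_le_sum fun j _ => ?_) ?_)
  · exact mul_le_mul_of_nonneg_left (by simp only [hg, Sum.elim_inl]; linarith) (hμ _)
  · rw [← Finset.sum_add_distrib]
    refine Finset.sum_le_sum fun k _ => ?_
    have h1 := mul_nonneg (hμ (Sum.inr (Sum.inl k))) hε.le
    have h2 := mul_nonneg (hμ (Sum.inr (Sum.inr k))) hε.le
    simp only [hg, Sum.elim_inl, Sum.elim_inr, LinearMap.neg_apply]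
    linarith

end Compact

/-! ### Relative interior and copies of the variables -/

section Lift

/-- The line through `p` and `q` stays in the affine span, within which `C` is a neighbourhood of
`p`. -/
theorem IsCorePoint.of_mem_intrinsicInterior {V : Type} [AddCommGroup V] [Module ℝ V]
    [TopologicalSpace V] [IsTopologicalAddGroup V] [ContinuousSMul ℝ V] {C : Set V} {p : V}
    (hp : p ∈ intrinsicInterior ℝ C) : IsCorePoint C p := by
  refine ⟨intrinsicInterior_subset hp, fun q hq => ?_⟩
  obtain ⟨y, hy, rfl⟩ := mem_intrinsicInterior.1 hp
  have hqs : q ∈ affineSpan ℝ C := subset_affineSpan ℝ C hq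
  have hmem : ∀ ε : ℝ, (y : V) + ε • ((y : V) - q) ∈ affineSpan ℝ C := fun ε => by
    have := AffineMap.lineMap_mem (-ε) y.2 hqs
    rw [AffineMap.lineMap_apply_module'] at this
    convert this using 1
    match_scalars <;> ring
  set φ : ℝ → affineSpan ℝ C := fun ε => ⟨_, hmem ε⟩ with hφ
  have hcont : Continuous φ := by
    refine Continuous.subtype_mk ?_ _
    fun_prop
  have h0 : φ 0 = y := by ext; simp [hφ]
  have hnhds : φ ⁻¹' ((↑) ⁻¹' C) ∈ nhds (0 : ℝ) := by
    refine hcont.continuousAt.preimage_mem_nhds ?_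
    rw [h0]
    exact mem_interior_iff_mem_nhds.1 hy
  obtain ⟨δ, hδ, hball⟩ := Metric.mem_nhds_iff.1 hnhds
  refine ⟨δ / 2, by positivity, ?_⟩
  exact hball (show δ / 2 ∈ Metric.ball (0 : ℝ) δ by
    rw [Metric.mem_ball, dist_zero_right, Real.norm_of_nonneg (by positivity)]; linarith)

/-- Core points of a finite intersection of preimages under linear maps. -/
theorem IsCorePoint.iInter_preimage {V E β : Type} [AddCommGroup V] [Module ℝ V] [AddCommGroup E]
    [Module ℝ E] [Finite β] {C : β → Set V} (hC : ∀ i, Convex ℝ (C i)) {p : E} (π : β → E →ₗ[ℝ] V)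
    (hp : ∀ i, IsCorePoint (C i) (π i p)) : IsCorePoint {X | ∀ i, π i X ∈ C i} p := by
  refine ⟨fun i => (hp i).1, fun q hq => ?_⟩
  choose ε hε hmem using fun i => (hp i).2 (π i q) (hq i)
  obtain ⟨δ, hδ, hδε⟩ : ∃ δ : ℝ, 0 < δ ∧ ∀ i, δ ≤ ε i := by
    cases isEmpty_or_nonempty β
    · exact ⟨1, one_pos, fun i => isEmptyElim i⟩
    · obtain ⟨i, hi⟩ := Finite.exists_min ε
      exact ⟨ε i, hε i, hi⟩
  refine ⟨δ, hδ, fun i => ?_⟩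
  rw [map_add, map_smul, map_sub]
  exact IsCorePoint.smaller (hC i) (hp i).1 (hmem i) hδ.le (hδε i)

end Lift

/-! ### Finite sums of extended reals -/

theorem EReal.sum_lt_top_iff {ι : Type} {J : Finset ι} {f : ι → EReal} (hb : ∀ j, ⊥ < f j) :
    ∑ j ∈ J, f j < ⊤ ↔ ∀ j ∈ J, f j < ⊤ := by
  classical
  induction J using Finset.induction_on with
  | empty => simp
  | insert j J hj ih =>
    rw [Finset.sum_insert hj, Finset.forall_mem_insert, ← ih]
    constructor
    · intro h
      by_contra hcon
      rw [not_and_or, not_lt_top_iff, not_lt_top_iff] at hcon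
      rcases hcon with h1 | h1
      · rw [h1, EReal.top_add_of_ne_bot (EReal.bot_lt_sum J fun k _ => hb k).ne'] at h
        exact lt_irrefl _ h
      · rw [h1, EReal.add_top_of_ne_bot (hb j).ne'] at h
        exact lt_irrefl _ h
    · exact fun h => EReal.add_lt_top h.1.ne h.2.ne

theorem EReal.sum_eq_coe {ι : Type} {J : Finset ι} {f : ι → EReal} (hb : ∀ j, ⊥ < f j)
    (ht : ∀ j ∈ J, f j < ⊤) : ∑ j ∈ J, f j = ((∑ j ∈ J, (f j).toReal : ℝ) : EReal) := by
  classical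
  induction J using Finset.induction_on with
  | empty => simp
  | insert j J hj ih =>
    rw [Finset.sum_insert hj, Finset.sum_insert hj, ih fun k hk => ht k (by simp [hk]),
      EReal.coe_add, EReal.coe_toReal (ht j (by simp)).ne (hb j).ne']

theorem EReal.sum_le_coe {ι : Type} {J : Finset ι} {f : ι → EReal} {m : ι → ℝ}
    (h : ∀ j ∈ J, f j ≤ m j) : ∑ j ∈ J, f j ≤ ((∑ j ∈ J, m j : ℝ) : EReal) := by
  classical
  induction J using Finset.induction_on with
  | empty => simp
  | insert j J hj ih =>
    rw [Finset.sum_insert hj, Finset.sum_insert hj, EReal.coe_add]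
    exact add_le_add (h j (by simp)) (ih fun k hk => h k (by simp [hk]))

/-- The pairing of recession-type inequalities for a function and its conjugate. -/
theorem IsProperClosedConvex.perspective_pairing {ι : Type} [Fintype ι] {c : (ι → ℝ) → EReal}
    (hc : IsProperClosedConvex c) {υ y : ι → ℝ} {lam ν s : ℝ} (h : perspective c υ lam ≤ 0)
    (hs : perspective (convexConj c) y ν ≤ s) : υ ⬝ᵥ y ≤ lam * s := by
  have h0 : perspective c υ lam ≤ ((0 : ℝ) : EReal) := h
  obtain ⟨hlam, h1⟩ := hc.perspective_le_iff.1 h0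
  have hs' := hs
  rw [hc.conj.perspective_le_iff, hc.biconj] at hs'
  obtain ⟨hν, h2⟩ := hs'
  -- For `ν > 0` the point `y / ν` lies in the domain of the conjugate and can be tested in the
  -- inequality for `υ`.
  rcases hν.lt_or_eq with hν | rfl
  · rw [perspective, if_pos hν, EReal.coe_mul_le_iff hν] at hs
    have hmem : ν⁻¹ • y ∈ effDomain (convexConj c) := hs.trans_lt (EReal.coe_lt_top _)
    have h3 := h1 ⟨_, hmem⟩
    rw [← coe_toReal_of_mem_effDomain hc.conj.bot_lt hmem, EReal.coe_le_coe_iff] at hs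
    simp only [dotProduct_smul, smul_eq_mul] at h3
    have h4 : lam * (convexConj c (ν⁻¹ • y)).toReal ≤ lam * (ν⁻¹ * s) :=
      mul_le_mul_of_nonneg_left hs hlam
    have h5 : ν⁻¹ * υ ⬝ᵥ y ≤ ν⁻¹ * (lam * s) := by linarith
    exact le_of_mul_le_mul_left h5 (inv_pos.2 hν)
  simp only [zero_mul, sub_zero] at h2
  -- For `ν = 0 < lam` the roles are exchanged: `υ / lam` lies in the domain of `c`.
  rcases hlam.lt_or_eq with hlam | rfl
  · rw [perspective, if_pos hlam, EReal.coe_mul_le_iff hlam] at h0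
    have hmem : lam⁻¹ • υ ∈ effDomain c := h0.trans_lt (EReal.coe_lt_top _)
    have h3 := h2 ⟨_, hmem⟩
    simp only [dotProduct_smul, smul_eq_mul, inv_mul_eq_div] at h3
    rw [div_le_iff₀ hlam, dotProduct_comm] at h3
    linarith
  · simp only [zero_mul, sub_zero] at h1 ⊢
    obtain ⟨u, hu⟩ := hc.conj.proper.2
    have hcu := coe_toReal_of_mem_effDomain hc.conj.bot_lt hu
    -- With both scales zero, `y` is a recession direction of the domain of the conjugate, on which
    -- `υ` is nonpositive. A positive `υ ⬝ᵥ y` would be violated far along this ray.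
    have hmem : ∀ k : ℝ, 0 ≤ k → u + k • y ∈ effDomain (convexConj c) := fun k hk => by
      refine lt_of_le_of_lt ((convexConj_le_iff hc.bot_lt
        (r := (convexConj c u).toReal + k * s)).2 fun z t hz => ?_) (EReal.coe_lt_top _)
      have h3 := (convexConj_le_iff hc.bot_lt).1 hcu.ge z t hz
      have h4 := h2 ⟨z, hz.trans_lt (EReal.coe_lt_top _)⟩
      rw [dotProduct_add, dotProduct_smul, smul_eq_mul, dotProduct_comm z y]
      have := mul_le_mul_of_nonneg_left h4 hk
      linarith
    by_contra hpos
    push Not at hpos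
    have h5 := h1 ⟨_, hmem ((|υ ⬝ᵥ u| + 1) / υ ⬝ᵥ y) (by positivity)⟩
    simp only [dotProduct_add, dotProduct_smul, smul_eq_mul] at h5
    rw [div_mul_cancel₀ _ hpos.ne'] at h5
    linarith [neg_abs_le (υ ⬝ᵥ u)]

/-! ### The two problems in terms of conjugate functions -/

theorem sum_elim_dotProduct {m n : ℕ} (w x : Fin m → ℝ) (z y : Fin n → ℝ) :
    Sum.elim w z ⬝ᵥ Sum.elim x y = w ⬝ᵥ x + z ⬝ᵥ y := sumElim_dotProduct_sumElim ..

theorem IsConvexFun.coe_linear {V : Type} [AddCommGroup V] [Module ℝ V] (A : V →ₗ[ℝ] ℝ) :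
    IsConvexFun fun x => (A x : EReal) := by
  simpa using IsConvexFun.linear A 0

namespace RobustProgram

variable {dx dz I L : ℕ} (P : RobustProgram dx dz I L)

theorem f_bot_lt (i : Fin (I + 1)) (x : Fin dx → ℝ) (z : Fin dz → ℝ) : ⊥ < P.f i x z :=
  (P.f_convex i z).bot_lt x

/-- The function `f_i^{*1}` of the stacked vector. -/
noncomputable def dualConj (i : Fin (I + 1)) : (Fin dx ⊕ Fin dz → ℝ) → EReal :=
  stacked (partialConj₁ (P.f i))

/-- The function `(-f_i)^{*2}` of the stacked vector. -/
noncomputable def primalConj (i : Fin (I + 1)) : (Fin dx ⊕ Fin dz → ℝ) → EReal :=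
  stacked (partialConj₂ fun x z => -P.f i x z)

theorem dualConj_elim (i : Fin (I + 1)) (w : Fin dx → ℝ) (z : Fin dz → ℝ) :
    P.dualConj i (Sum.elim w z) = partialConj₁ (P.f i) w z := rfl

theorem primalConj_elim (i : Fin (I + 1)) (x : Fin dx → ℝ) (y : Fin dz → ℝ) :
    P.primalConj i (Sum.elim x y) = partialConj₂ (fun x z => -P.f i x z) x y := rfl

theorem partialConj₁_eq (i : Fin (I + 1)) (w : Fin dx → ℝ) (z : Fin dz → ℝ) :
    partialConj₁ (P.f i) w z = convexConj (fun x => P.f i x z) w := by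
  simp only [partialConj₁, convexConj, dotProduct_comm]

/-- For fixed `x` the function `w ⬝ᵥ x - f i x z` is jointly convex and lower semicontinuous in `(w,
z)` by concavity and closedness in `z`; the supremum over `x` inherits this. Finiteness somewhere
comes from the slice `z = 0`. -/
theorem dualConj_isProperClosedConvex (i : Fin (I + 1)) :
    IsProperClosedConvex (P.dualConj i) := by
  refine .mk' (fun p => ?_) ?_ ?_ ?_
  · rw [show P.dualConj i p = _ from P.partialConj₁_eq i _ _]
    exact convexConj_bot_lt (P.f_convex i _).proper.2 _
  · obtain ⟨w, hw⟩ := (P.f_convex i 0).conj.proper.2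
    exact ⟨Sum.elim w 0, by rwa [dualConj_elim, partialConj₁_eq]⟩
  · refine lowerSemicontinuous_iSup fun x => ?_
    simp only [sub_eq_add_neg]
    refine LowerSemicontinuous.ereal_add ?_ ?_ (fun _ => EReal.bot_lt_coe _)
      fun p => (P.f_concave i x).bot_lt _
    · refine (continuous_coe_real_ereal.comp ?_).lowerSemicontinuous
      unfold dotProduct
      fun_prop
    · exact LowerSemicontinuous.comp (f := fun z => -P.f i x z) (P.f_concave i x).lsc
        (show Continuous fun p : Fin dx ⊕ Fin dz → ℝ => p ∘ Sum.inr by fun_prop)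
  · refine IsConvexFun.iSup fun x => ?_
    simp only [sub_eq_add_neg]
    refine IsConvexFun.add ?_ ?_ (fun _ => EReal.bot_lt_coe _)
      fun p => (P.f_concave i x).bot_lt _
    · convert IsConvexFun.coe_linear
        (dotProductBilin ℝ ℝ x ∘ₗ LinearMap.funLeft ℝ ℝ (Sum.inl : Fin dx → Fin dx ⊕ Fin dz)) using 3
      exact dotProduct_comm _ _
    · exact (P.f_concave i x).convex.comp_linearMap
        (LinearMap.funLeft ℝ ℝ (Sum.inr : Fin dz → Fin dx ⊕ Fin dz))

theorem primalConj_le_iff (i : Fin (I + 1)) (x : Fin dx → ℝ) (y : Fin dz → ℝ) (r : ℝ) :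
    P.primalConj i (Sum.elim x y) ≤ r ↔ ∀ z, P.f i x z ≤ ((r - y ⬝ᵥ z : ℝ) : EReal) := by
  rw [primalConj_elim, partialConj₂, iSup_le_iff]
  refine forall_congr' fun z => ?_
  have h := P.f_bot_lt i x z
  rw [sub_eq_add_neg, neg_neg]
  generalize P.f i x z = a at h
  induction a with
  | bot => exact absurd h (lt_irrefl _)
  | coe a => norm_cast; constructor <;> intro h <;> linarith
  | top => simp [-EReal.coe_sub]

/-- Conjugating in `w` at fixed `z` gives the biconjugate of the slice, which is `f i x z`. The
remaining supremum over `z` is the other partial conjugate. -/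
theorem convexConj_dualConj (i : Fin (I + 1)) : convexConj (P.dualConj i) = P.primalConj i := by
  funext p
  obtain ⟨x, y, rfl⟩ : ∃ x y, p = Sum.elim x y :=
    ⟨p ∘ Sum.inl, p ∘ Sum.inr, (Sum.elim_comp_inl_inr p).symm⟩
  have key : ∀ r : ℝ, convexConj (P.dualConj i) (Sum.elim x y) ≤ r ↔
      P.primalConj i (Sum.elim x y) ≤ r := fun r => by
    rw [convexConj_le_iff (P.dualConj_isProperClosedConvex i).bot_lt, primalConj_le_iff]
    constructor
    · intro h z
      rw [← show convexConj (convexConj fun x => P.f i x z) x = P.f i x z from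
        congrFun (P.f_convex i z).biconj x, convexConj_le_iff (P.f_convex i z).conj.bot_lt]
      intro w t hw
      have := h (Sum.elim w z) t (by rwa [dualConj_elim, partialConj₁_eq])
      rw [sum_elim_dotProduct, dotProduct_comm z] at this
      linarith
    · intro h q t hq
      obtain ⟨w, z, rfl⟩ : ∃ w z, q = Sum.elim w z :=
        ⟨q ∘ Sum.inl, q ∘ Sum.inr, (Sum.elim_comp_inl_inr q).symm⟩
      rw [dualConj_elim, partialConj₁_eq, convexConj_le_iff (P.f_convex i z).bot_lt] at hq
      have := hq x _ (h z)
      rw [sum_elim_dotProduct, dotProduct_comm z, dotProduct_comm w]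
      linarith
  exact le_antisymm (EReal.le_of_forall_coe_ge fun r => (key r).2)
    (EReal.le_of_forall_coe_ge fun r => (key r).1)

theorem primalConj_isProperClosedConvex (i : Fin (I + 1)) :
    IsProperClosedConvex (P.primalConj i) :=
  P.convexConj_dualConj i ▸ (P.dualConj_isProperClosedConvex i).conj

/-- The perspective of the conjugate of `c_ℓ`. -/
noncomputable def conPersp (ℓ : Fin L) (y : Fin dz → ℝ) (ν : ℝ) : EReal :=
  perspective (convexConj (P.c ℓ)) y ν

theorem conPersp_bot_lt (ℓ : Fin L) (y : Fin dz → ℝ) (ν : ℝ) : ⊥ < P.conPersp ℓ y ν :=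
  (P.c_convex ℓ).conj.perspective_bot_lt y ν

theorem primalFun_eq (i : Fin (I + 1)) (p : PrimalVar dx dz I L) :
    P.primalFun i p = P.primalConj i (Sum.elim p.1 (p.2.1 i 0)) +
      ∑ ℓ, P.conPersp ℓ (p.2.1 i ℓ.succ) (p.2.2 i ℓ) := by
  obtain ⟨x, y, ν⟩ := p
  simp only [primalFun, primalConj_elim, conPersp]

theorem primalFun_bot_lt (i : Fin (I + 1)) (p : PrimalVar dx dz I L) : ⊥ < P.primalFun i p := by
  rw [primalFun_eq]
  exact EReal.bot_lt_add_iff.2 ⟨(P.primalConj_isProperClosedConvex i).bot_lt _,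
    EReal.bot_lt_sum _ fun _ _ => P.conPersp_bot_lt ..⟩

theorem primalFun_lt_top_iff (i : Fin (I + 1)) (p : PrimalVar dx dz I L) :
    P.primalFun i p < ⊤ ↔ P.primalConj i (Sum.elim p.1 (p.2.1 i 0)) < ⊤ ∧
      ∀ ℓ, P.conPersp ℓ (p.2.1 i ℓ.succ) (p.2.2 i ℓ) < ⊤ := by
  have hs := EReal.sum_lt_top_iff (J := Finset.univ)
    (fun ℓ => P.conPersp_bot_lt ℓ (p.2.1 i ℓ.succ) (p.2.2 i ℓ))
  simp only [Finset.mem_univ, true_implies] at hs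
  rw [← hs, primalFun_eq]
  constructor
  · intro h
    by_contra hcon
    rw [not_and_or, not_lt_top_iff, not_lt_top_iff] at hcon
    rcases hcon with h1 | h1
    · rw [h1, EReal.top_add_of_ne_bot (EReal.bot_lt_sum _ fun _ _ =>
        P.conPersp_bot_lt ..).ne'] at h
      exact lt_irrefl _ h
    · rw [h1, EReal.add_top_of_ne_bot
        ((P.primalConj_isProperClosedConvex i).bot_lt _).ne'] at h
      exact lt_irrefl _ h
  · exact fun h => EReal.add_lt_top h.1.ne h.2.ne

theorem primalFun_eq_coe {i : Fin (I + 1)} {p : PrimalVar dx dz I L} (h : P.primalFun i p < ⊤) :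
    P.primalFun i p = (((P.primalConj i (Sum.elim p.1 (p.2.1 i 0))).toReal +
      ∑ ℓ, (P.conPersp ℓ (p.2.1 i ℓ.succ) (p.2.2 i ℓ)).toReal : ℝ) : EReal) := by
  obtain ⟨h1, h2⟩ := (P.primalFun_lt_top_iff i p).1 h
  rw [primalFun_eq, EReal.sum_eq_coe (fun ℓ => P.conPersp_bot_lt ..) fun ℓ _ => h2 ℓ,
    EReal.coe_add, coe_toReal_of_mem_effDomain (P.primalConj_isProperClosedConvex i).bot_lt h1]

/-- The perspective of `f_i^{*1}`. -/
noncomputable def objPersp (i : Fin (I + 1)) (q : Fin dx ⊕ Fin dz → ℝ) (t : ℝ) : EReal :=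
  perspective (P.dualConj i) q t

theorem objPersp_bot_lt (i : Fin (I + 1)) (q : Fin dx ⊕ Fin dz → ℝ) (t : ℝ) :
    ⊥ < P.objPersp i q t :=
  (P.dualConj_isProperClosedConvex i).perspective_bot_lt q t

/-- The negative of the dual objective. -/
noncomputable def dualCost (q : DualVar dx dz I) : EReal :=
  P.dualConj 0 (Sum.elim (q.1 0) q.2.1) +
    ∑ i : Fin I, P.objPersp i.succ (Sum.elim (q.1 i.succ) (q.2.2.2 i)) (q.2.2.1 i)

theorem dualObj_eq (q : DualVar dx dz I) : P.dualObj q = -P.dualCost q := by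
  rw [dualCost, EReal.neg_add
    (Or.inl ((P.dualConj_isProperClosedConvex 0).bot_lt _).ne')
    (Or.inr (EReal.bot_lt_sum _ fun _ _ => P.objPersp_bot_lt ..).ne')]
  rfl

theorem dualCost_bot_lt (q : DualVar dx dz I) : ⊥ < P.dualCost q :=
  EReal.bot_lt_add_iff.2 ⟨(P.dualConj_isProperClosedConvex 0).bot_lt _,
    EReal.bot_lt_sum _ fun _ _ => P.objPersp_bot_lt ..⟩

theorem dualCost_lt_top_iff (q : DualVar dx dz I) :
    P.dualCost q < ⊤ ↔ P.dualConj 0 (Sum.elim (q.1 0) q.2.1) < ⊤ ∧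
      ∀ i : Fin I, P.objPersp i.succ (Sum.elim (q.1 i.succ) (q.2.2.2 i)) (q.2.2.1 i) < ⊤ := by
  have hs := EReal.sum_lt_top_iff (J := Finset.univ) (fun i : Fin I =>
    P.objPersp_bot_lt i.succ (Sum.elim (q.1 i.succ) (q.2.2.2 i)) (q.2.2.1 i))
  simp only [Finset.mem_univ, true_implies] at hs
  rw [← hs, dualCost]
  constructor
  · intro h
    by_contra hcon
    rw [not_and_or, not_lt_top_iff, not_lt_top_iff] at hcon
    rcases hcon with h1 | h1
    · rw [h1, EReal.top_add_of_ne_bot (EReal.bot_lt_sum _ fun _ _ =>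
        P.objPersp_bot_lt ..).ne'] at h
      exact lt_irrefl _ h
    · rw [h1, EReal.add_top_of_ne_bot
        ((P.dualConj_isProperClosedConvex 0).bot_lt _).ne'] at h
      exact lt_irrefl _ h
  · exact fun h => EReal.add_lt_top h.1.ne h.2.ne

theorem dualCost_eq_coe {q : DualVar dx dz I} (h : P.dualCost q < ⊤) :
    P.dualCost q = (((P.dualConj 0 (Sum.elim (q.1 0) q.2.1)).toReal +
      ∑ i : Fin I, (P.objPersp i.succ (Sum.elim (q.1 i.succ) (q.2.2.2 i))
        (q.2.2.1 i)).toReal : ℝ) : EReal) := by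
  obtain ⟨h1, h2⟩ := (P.dualCost_lt_top_iff q).1 h
  rw [dualCost, EReal.sum_eq_coe (fun i => P.objPersp_bot_lt ..) fun i _ => h2 i,
    EReal.coe_add, coe_toReal_of_mem_effDomain (P.dualConj_isProperClosedConvex 0).bot_lt h1]

theorem mem_primal_solutions {p : PrimalVar dx dz I L} : p ∈ P.primalConstraints.solutions ↔
    (∀ i ℓ, 0 ≤ p.2.2 i ℓ) ∧ (∀ i : Fin I, P.primalFun i.succ p ≤ 0) ∧
      ∀ i k, ∑ ℓ, p.2.1 i ℓ k = 0 := by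
  simp only [ConstraintSystem.solutions, primalConstraints, Set.mem_ofPred_eq, Prod.forall,
    EReal.coe_eq_zero]

theorem mem_dual_solutions {q : DualVar dx dz I} : q ∈ P.dualConstraints.solutions ↔
    (∀ i, 0 ≤ q.2.2.1 i) ∧ ((∀ ℓ, P.c ℓ q.2.1 ≤ 0) ∧
      ∀ i ℓ, perspective (P.c ℓ) (q.2.2.2 i) (q.2.2.1 i) ≤ 0) ∧ ∀ k, ∑ i, q.1 i k = 0 := by
  simp only [ConstraintSystem.solutions, dualConstraints, Set.mem_ofPred_eq, Sum.forall,
    Prod.forall, EReal.coe_eq_zero, Sum.elim_inl, Sum.elim_inr]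

theorem sum_dotProduct_eq_zero {ι κ : Type} [Fintype ι] [Fintype κ] (w : κ → ι → ℝ) (x : ι → ℝ)
    (h : ∀ k, ∑ i, w i k = 0) : ∑ i, w i ⬝ᵥ x = 0 := by
  simp only [dotProduct]
  rw [Finset.sum_comm]
  refine Finset.sum_eq_zero fun k _ => ?_
  rw [← Finset.sum_mul, h, zero_mul]

theorem weak_duality {p : PrimalVar dx dz I L} {q : DualVar dx dz I}
    (hp : p ∈ P.primalConstraints.solutions) (hq : q ∈ P.dualConstraints.solutions) :
    P.dualObj q ≤ P.primalObj p := by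
  obtain ⟨hν, hpi, hpe⟩ := P.mem_primal_solutions.1 hp
  obtain ⟨hlam, ⟨hc₀, hc⟩, hqe⟩ := P.mem_dual_solutions.1 hq
  obtain ⟨x, y, ν⟩ := p
  obtain ⟨w, z₀, lam, υ⟩ := q
  simp only at hν hpe hlam hc₀ hc hqe
  rw [dualObj_eq]
  rcases eq_top_or_lt_top (P.primalObj (x, y, ν)) with htop | hp₀
  · rw [htop]; exact le_top
  rcases eq_top_or_lt_top (P.dualCost (w, z₀, lam, υ)) with htop | hq₀
  · rw [htop, EReal.neg_top]; exact bot_le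
  obtain ⟨hP₀, hPℓ⟩ := (P.primalFun_lt_top_iff 0 _).1 hp₀
  obtain ⟨hQ₀, hQi⟩ := (P.dualCost_lt_top_iff _).1 hq₀
  rw [primalObj, P.primalFun_eq_coe hp₀, P.dualCost_eq_coe hq₀, ← EReal.coe_neg,
    EReal.coe_le_coe_iff]
  simp only at hP₀ hPℓ hQ₀ hQi ⊢
  have hpit : ∀ i : Fin I, P.primalFun i.succ (x, y, ν) < ⊤ := fun i =>
    (hpi i).trans_lt EReal.zero_lt_top
  have hdc := fun i => (P.dualConj_isProperClosedConvex i)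
  have hpc := fun i => (P.primalConj_isProperClosedConvex i)
  have hpb := fun i : Fin I => (P.primalFun_lt_top_iff i.succ _).1 (hpit i)
  simp only at hpb
  -- Fenchel–Young for the objective
  have hA₀ : w 0 ⬝ᵥ x + z₀ ⬝ᵥ y 0 0 ≤ (P.dualConj 0 (Sum.elim (w 0) z₀)).toReal +
      (P.primalConj 0 (Sum.elim x (y 0 0))).toReal := by
    have e := coe_toReal_of_mem_effDomain (hpc 0).bot_lt hP₀
    have h := e.ge
    nth_rw 1 [← P.convexConj_dualConj] at h
    have := (convexConj_le_iff (hdc 0).bot_lt).1 h (Sum.elim (w 0) z₀) _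
      (coe_toReal_of_mem_effDomain (hdc 0).bot_lt hQ₀).ge
    rw [sum_elim_dotProduct] at this
    linarith
  -- The perspective form of Fenchel–Young: test the supremum formula at the point `(x, y_{i0})` of
  -- the domain of the conjugate.
  have hA : ∀ i : Fin I, w i.succ ⬝ᵥ x + υ i ⬝ᵥ y i.succ 0 -
      lam i * (P.primalConj i.succ (Sum.elim x (y i.succ 0))).toReal ≤
      (P.objPersp i.succ (Sum.elim (w i.succ) (υ i)) (lam i)).toReal := fun i => by
    have h := ((hdc i.succ).perspective_le_iff.1
      (EReal.coe_toReal (hQi i).ne (P.objPersp_bot_lt ..).ne').ge).2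
    rw [P.convexConj_dualConj] at h
    have := h ⟨Sum.elim x (y i.succ 0), (hpb i).1⟩
    simp only [sum_elim_dotProduct] at this
    exact this
  have hC₀ : ∀ ℓ, y 0 ℓ.succ ⬝ᵥ z₀ ≤ (P.conPersp ℓ (y 0 ℓ.succ) (ν 0 ℓ)).toReal := fun ℓ => by
    have := (P.c_convex ℓ).perspective_pairing (υ := z₀) (lam := 1) (y := y 0 ℓ.succ)
      (ν := ν 0 ℓ) (by rw [perspective_one]; exact hc₀ ℓ)
      (EReal.coe_toReal (hPℓ ℓ).ne (P.conPersp_bot_lt ..).ne').ge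
    rwa [one_mul, dotProduct_comm] at this
  have hC : ∀ (i : Fin I) ℓ, y i.succ ℓ.succ ⬝ᵥ υ i ≤
      lam i * (P.conPersp ℓ (y i.succ ℓ.succ) (ν i.succ ℓ)).toReal := fun i ℓ => by
    rw [dotProduct_comm]
    exact (P.c_convex ℓ).perspective_pairing (hc i ℓ)
      (EReal.coe_toReal ((hpb i).2 ℓ).ne (P.conPersp_bot_lt ..).ne').ge
  have hF : ∀ i : Fin I, (P.primalConj i.succ (Sum.elim x (y i.succ 0))).toReal +
      ∑ ℓ, (P.conPersp ℓ (y i.succ ℓ.succ) (ν i.succ ℓ)).toReal ≤ 0 := fun i => by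
    have h := hpi i
    rw [P.primalFun_eq_coe (hpit i)] at h
    exact_mod_cast h
  have hsum : ∀ (i : Fin (I + 1)) (z : Fin dz → ℝ), y i 0 ⬝ᵥ z + ∑ ℓ : Fin L, y i ℓ.succ ⬝ᵥ z = 0 :=
    fun i z => by
      rw [← Fin.sum_univ_succ (f := fun ℓ => y i ℓ ⬝ᵥ z)]
      exact sum_dotProduct_eq_zero _ _ (hpe i)
  -- The `i`-th primal constraint is multiplied by `lam i ≥ 0`. All terms with `υ i` cancel because
  -- the `y_{iℓ}` sum to zero over `ℓ`.
  have hB : ∀ i : Fin I, w i.succ ⬝ᵥ x ≤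
      (P.objPersp i.succ (Sum.elim (w i.succ) (υ i)) (lam i)).toReal := fun i => by
    have h1 := mul_le_mul_of_nonneg_left (hF i) (hlam i)
    rw [mul_zero, mul_add, Finset.mul_sum] at h1
    have h2 := Finset.sum_le_sum fun ℓ (_ : ℓ ∈ Finset.univ) => hC i ℓ
    have h3 := hsum i.succ (υ i)
    have h4 := hA i
    rw [dotProduct_comm (υ i)] at h4
    linarith
  have hw := sum_dotProduct_eq_zero w x hqe
  rw [Fin.sum_univ_succ] at hw
  have h1 := Finset.sum_le_sum fun i (_ : i ∈ Finset.univ) => hB i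
  have h2 := Finset.sum_le_sum fun ℓ (_ : ℓ ∈ Finset.univ) => hC₀ ℓ
  have h3 := hsum 0 z₀
  rw [dotProduct_comm z₀] at hA₀
  linarith

theorem dualSup_le_primalInf : P.dualSup ≤ P.primalInf :=
  iSup₂_le fun _ hq => le_iInf₂ fun _ hp => P.weak_duality hp hq

end RobustProgram

/-! ### From multipliers to solutions of the other problem -/

theorem nonneg_of_forall_le_mul {v K s : ℝ} (h : ∀ t : ℝ, 0 ≤ t → v ≤ K + t * s) : 0 ≤ s := by
  by_contra hs
  push Not at hs
  have h1 := h ((|v - K| + 1) / (-s)) (div_nonneg (by positivity) (by linarith))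
  have h2 : (|v - K| + 1) / (-s) * s = -(|v - K| + 1) := by
    rw [div_neg, neg_mul, div_mul_cancel₀ _ hs.ne]
  rw [h2] at h1
  linarith [neg_abs_le (v - K)]

/-- A lower bound for a sum of functions of independent variables splits. -/
theorem exists_split_of_le_sum {A : Type} [Fintype A] {D : A → Type} [∀ a, Nonempty (D a)]
    {φ : ∀ a, D a → ℝ} {v : ℝ} (h : ∀ p : ∀ a, D a, v ≤ ∑ a, φ a (p a)) :
    ∃ m : A → ℝ, (∀ a d, m a ≤ φ a d) ∧ v ≤ ∑ a, m a := by
  classical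
  -- Freezing all other blocks at arbitrary points bounds the remaining one from below, so real
  -- infima exist.
  have hbdd : ∀ a, BddBelow (Set.range (φ a)) := fun a => by
    set p₀ : ∀ a, D a := fun a => Classical.arbitrary _
    refine ⟨v - ∑ b ∈ Finset.univ.erase a, φ b (p₀ b), ?_⟩
    rintro _ ⟨d, rfl⟩
    have h1 := h (Function.update p₀ a d)
    rw [← Finset.add_sum_erase _ _ (Finset.mem_univ a), Function.update_self] at h1
    have h2 : ∑ b ∈ Finset.univ.erase a, φ b (Function.update p₀ a d b) =
        ∑ b ∈ Finset.univ.erase a, φ b (p₀ b) := Finset.sum_congr rfl fun b hb => by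
      rw [Function.update_of_ne (Finset.ne_of_mem_erase hb)]
    linarith
  refine ⟨fun a => ⨅ d, φ a d, fun a d => ciInf_le (hbdd a) d, ?_⟩
  refine le_of_forall_pos_le_add fun ε hε => ?_
  -- The error is shared among the blocks; the `+ 1` covers an empty index type.
  have hδ : 0 < ε / (Fintype.card A + 1) := by positivity
  choose p hp using fun a => exists_lt_of_ciInf_lt
    (show (⨅ d, φ a d) < (⨅ d, φ a d) + ε / (Fintype.card A + 1) by linarith)
  refine (h p).trans ((Finset.sum_le_sum fun a _ => (hp a).le).trans ?_)
  rw [Finset.sum_add_distrib, Finset.sum_const, Finset.card_univ, nsmul_eq_mul]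
  have : (Fintype.card A : ℝ) * (ε / (Fintype.card A + 1)) ≤ ε := by
    rw [mul_div_assoc', div_le_iff₀ (by positivity)]
    nlinarith
  linarith

/-- The same with additional conic variables, whose contributions must be nonnegative. -/
theorem exists_split_of_le_sum_cone {A B : Type} [Fintype A] [Fintype B] {D : A → Type}
    [∀ a, Nonempty (D a)] {U : B → Type} [∀ b, Nonempty (U b)] {φ : ∀ a, D a → ℝ}
    {ψ : ∀ b, U b → ℝ} {v : ℝ} (h : ∀ (p : ∀ a, D a) (u : ∀ b, U b) (t : B → ℝ), (∀ b, 0 ≤ t b) →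
      v ≤ ∑ a, φ a (p a) + ∑ b, t b * ψ b (u b)) :
    (∀ b d, 0 ≤ ψ b d) ∧ ∃ m : A → ℝ, (∀ a d, m a ≤ φ a d) ∧ v ≤ ∑ a, m a := by
  classical
  constructor
  · intro b d
    -- Only block `b` is given a nonzero scale; a lower bound that survives arbitrarily large scales
    -- forces its slope to be nonnegative.
    refine nonneg_of_forall_le_mul (v := v)
      (K := ∑ a, φ a (Classical.arbitrary (D a))) fun t ht => ?_
    have h1 := h (fun a => Classical.arbitrary _)
      (Function.update (fun b => Classical.arbitrary _) b d) (Pi.single b t)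
      (fun c => by
        by_cases hc : c = b
        · subst hc; simpa using ht
        · simp [hc])
    rw [Finset.sum_eq_single b (fun c _ hc => by simp [hc]) (by simp)] at h1
    simpa using h1
  · exact exists_split_of_le_sum fun p => by
      simpa using h p (fun b => Classical.arbitrary _) 0 fun _ => le_rfl

namespace RobustProgram

variable {dx dz I L : ℕ}

/-! #### The primal problem with a copy of `x` for every constraint -/

/-- Decision vectors `((x_i)_i, y, ν)`. -/
abbrev PrimalLift (dx dz I L : ℕ) : Type :=
  (Fin (I + 1) → Fin dx → ℝ) × (Fin (I + 1) → Fin (L + 1) → Fin dz → ℝ) × (Fin (I + 1) → Fin L → ℝ)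

/-- The decision vector seen by the `i`-th function. -/
def primalProj (i : Fin (I + 1)) : PrimalLift dx dz I L →ₗ[ℝ] PrimalVar dx dz I L :=
  LinearMap.prodMap (LinearMap.proj i) LinearMap.id

/-- The equality constraints `x_i = x_0` and `∑_ℓ y_{iℓ} = 0`. -/
def primalEq : (Fin I × Fin dx) ⊕ (Fin (I + 1) × Fin dz) → PrimalLift dx dz I L →ₗ[ℝ] ℝ :=
  Sum.elim
    (fun s =>
      { toFun := fun X => X.1 s.1.succ s.2 - X.1 0 s.2
        map_add' := fun X Y => by simp; ring
        map_smul' := fun r X => by simp; ring })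
    (fun s =>
      { toFun := fun X => ∑ ℓ, X.2.1 s.1 ℓ s.2
        map_add' := fun X Y => by simp [Finset.sum_add_distrib]
        map_smul' := fun r X => by simp [Finset.mul_sum] })

variable (P : RobustProgram dx dz I L)

/-- The objective of the lifted primal problem. -/
noncomputable def primalLiftObj (X : PrimalLift dx dz I L) : EReal :=
  P.primalFun 0 (primalProj 0 X)

/-- The constraint functions of the lifted primal problem. -/
noncomputable def primalLiftIneq (i : Fin I) (X : PrimalLift dx dz I L) : EReal :=
  P.primalFun i.succ (primalProj i.succ X)

/-- The vector `w 0` collects the multipliers of all equations `x_i = x_0` and the other `w i` are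
their negatives. Thus the dual constraint `∑ w_i = 0` holds by construction. -/
theorem primalEq_sum (η : (Fin I × Fin dx) ⊕ (Fin (I + 1) × Fin dz) → ℝ)
    (w : Fin (I + 1) → Fin dx → ℝ) (z : Fin (I + 1) → Fin dz → ℝ)
    (hw₀ : ∀ k, w 0 k = ∑ i : Fin I, η (Sum.inl (i, k)))
    (hw : ∀ i k, w (Fin.succ i) k = -η (Sum.inl (i, k)))
    (hz : ∀ i k, z i k = -η (Sum.inr (i, k))) (X : PrimalLift dx dz I L) :
    ∑ s, η s * primalEq s X =
      -∑ i, (w i ⬝ᵥ X.1 i + ∑ ℓ, z i ⬝ᵥ X.2.1 i ℓ) := by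
  rw [Fintype.sum_sum_type, Fintype.sum_prod_type, Fintype.sum_prod_type, Finset.sum_add_distrib,
    neg_add]
  congr 1
  · rw [Fin.sum_univ_succ]
    simp only [dotProduct, hw₀, hw, primalEq, Sum.elim_inl, LinearMap.coe_mk, AddHom.coe_mk,
      mul_sub, Finset.sum_sub_distrib, Finset.sum_mul, neg_mul, Finset.sum_neg_distrib]
    rw [Finset.sum_comm (γ := Fin dx)]
    ring
  · simp only [dotProduct, hz, primalEq, Sum.elim_inr, LinearMap.coe_mk, AddHom.coe_mk,
      neg_mul, Finset.sum_neg_distrib, neg_neg, Finset.mul_sum]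
    exact Finset.sum_congr rfl fun i _ => Finset.sum_comm

theorem dualCost_eq_sum {lam : Fin (I + 1) → ℝ} (hlam : lam 0 = 1) (w : Fin (I + 1) → Fin dx → ℝ)
    (z : Fin (I + 1) → Fin dz → ℝ) :
    P.dualCost (w, z 0, fun i => lam i.succ, fun i => z i.succ) =
      ∑ i, P.objPersp i (Sum.elim (w i) (z i)) (lam i) := by
  rw [Fin.sum_univ_succ, hlam, objPersp, perspective_one]
  rfl

theorem exists_dual_of_bounds {lam : Fin (I + 1) → ℝ} (hlam : lam 0 = 1) (hlam0 : ∀ i, 0 ≤ lam i)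
    {w : Fin (I + 1) → Fin dx → ℝ} (hw : ∀ k, ∑ i, w i k = 0) {z : Fin (I + 1) → Fin dz → ℝ}
    {m : Fin (I + 1) → ℝ}
    (hobj : ∀ i, P.objPersp i (Sum.elim (w i) (z i)) (lam i) ≤ ((-m i : ℝ) : EReal))
    (hcon : ∀ i ℓ, perspective (P.c ℓ) (z i) (lam i) ≤ 0) {v : ℝ} (hv : v ≤ ∑ i, m i) :
    ∃ q ∈ P.dualConstraints.solutions, (v : EReal) ≤ P.dualObj q := by
  refine ⟨(w, z 0, fun i => lam i.succ, fun i => z i.succ), ?_, ?_⟩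
  · rw [mem_dual_solutions]
    refine ⟨fun i => hlam0 _, ⟨fun ℓ => ?_, fun i ℓ => hcon i.succ ℓ⟩, hw⟩
    have := hcon 0 ℓ
    rwa [hlam, perspective_one] at this
  · rw [dualObj_eq, EReal.le_neg, P.dualCost_eq_sum hlam]
    refine (EReal.sum_le_coe fun i _ => hobj i).trans ?_
    rw [← EReal.coe_neg, EReal.coe_le_coe_iff, Finset.sum_neg_distrib]
    linarith

/-- The Lagrangian separates into one block `(x_i, y_{i0})` for each `i` and one conic block
`(y_{iℓ}, ν_{iℓ})` for each pair. The infima of the former are negated perspectives of `f_i^{*1}`,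
and nonnegativity of the latter is the constraint `λ_i c_ℓ(υ_i/λ_i) ≤ 0`. The supremum formula for
perspectives handles `λ_i = 0` as well. -/
theorem exists_dual_of_isMultiplier {v : ℝ} {μ : Fin I → ℝ}
    {η : (Fin I × Fin dx) ⊕ (Fin (I + 1) × Fin dz) → ℝ}
    (h : IsMultiplier P.primalLiftObj P.primalLiftIneq primalEq v μ η) :
    ∃ q ∈ P.dualConstraints.solutions, (v : EReal) ≤ P.dualObj q := by
  classical
  -- The objective is treated as a constraint function with multiplier `1`, so that all blocks have
  -- the same form.
  set lam : Fin (I + 1) → ℝ := Fin.cons 1 μ with hlam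
  have hlam0 : ∀ i, 0 ≤ lam i := fun i => by
    refine Fin.cases ?_ (fun i => ?_) i
    · simp [hlam]
    · simpa [hlam] using h.nonneg i
  set w : Fin (I + 1) → Fin dx → ℝ :=
    Fin.cons (fun k => ∑ i : Fin I, η (Sum.inl (i, k))) fun i k => -η (Sum.inl (i, k)) with hw
  set z : Fin (I + 1) → Fin dz → ℝ := fun i k => -η (Sum.inr (i, k)) with hz
  have hpc := fun i => P.primalConj_isProperClosedConvex i
  have hcc := fun ℓ => (P.c_convex ℓ).conj
  have key : ∀ (p : ∀ i : Fin (I + 1), effDomain (P.primalConj i))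
      (u : ∀ b : Fin (I + 1) × Fin L, effDomain (convexConj (P.c b.2)))
      (t : Fin (I + 1) × Fin L → ℝ), (∀ b, 0 ≤ t b) →
      v ≤ ∑ i, (lam i * (P.primalConj i (p i)).toReal - Sum.elim (w i) (z i) ⬝ᵥ (p i)) +
        ∑ b, t b * (lam b.1 * (convexConj (P.c b.2) (u b)).toReal - z b.1 ⬝ᵥ (u b)) := by
    intro p u t ht
    set X : PrimalLift dx dz I L := (fun i => (p i : Fin dx ⊕ Fin dz → ℝ) ∘ Sum.inl,
      fun i => Fin.cons ((p i : Fin dx ⊕ Fin dz → ℝ) ∘ Sum.inr) fun ℓ => t (i, ℓ) • (u (i, ℓ)).1,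
      fun i ℓ => t (i, ℓ)) with hX
    have hconj : ∀ i, Sum.elim (primalProj i X).1 ((primalProj i X).2.1 i 0) = (p i).1 := fun i =>
      Sum.elim_comp_inl_inr _
    have hper : ∀ i ℓ, P.conPersp ℓ ((primalProj i X).2.1 i ℓ.succ) ((primalProj i X).2.2 i ℓ) =
        ((t (i, ℓ) * (convexConj (P.c ℓ) (u (i, ℓ))).toReal : ℝ) : EReal) := fun i ℓ =>
      (hcc ℓ).perspective_smul (u (i, ℓ)).2 (ht _)
    have hlt : ∀ i, P.primalFun i (primalProj i X) < ⊤ := fun i => by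
      rw [primalFun_lt_top_iff, hconj]
      exact ⟨(p i).2, fun ℓ => by rw [hper]; exact EReal.coe_lt_top _⟩
    have hval : ∀ i, (P.primalFun i (primalProj i X)).toReal = (P.primalConj i (p i)).toReal +
        ∑ ℓ, t (i, ℓ) * (convexConj (P.c ℓ) (u (i, ℓ))).toReal := fun i => by
      rw [P.primalFun_eq_coe (hlt i), hconj, EReal.toReal_coe]
      simp only [hper, EReal.toReal_coe]
    have h1 := h.le X ⟨hlt 0, fun i => hlt i.succ⟩
    rw [primalEq_sum η w z (fun k => by simp [hw]) (fun i k => by simp [hw]) (fun i k => rfl)] at h1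
    have h2 : (P.primalLiftObj X).toReal + ∑ i, μ i * (P.primalLiftIneq i X).toReal =
        ∑ i, lam i * (P.primalFun i (primalProj i X)).toReal := by
      rw [Fin.sum_univ_succ]
      simp [hlam, primalLiftObj, primalLiftIneq]
    rw [h2, ← sub_eq_add_neg, ← Finset.sum_sub_distrib] at h1
    refine h1.trans (le_of_eq ?_)
    rw [Fintype.sum_prod_type, ← Finset.sum_add_distrib]
    refine Finset.sum_congr rfl fun i _ => ?_
    rw [hval, Fin.sum_univ_succ]
    have e1 : Sum.elim (w i) (z i) ⬝ᵥ (p i).1 = w i ⬝ᵥ X.1 i + z i ⬝ᵥ X.2.1 i 0 := by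
      rw [← Sum.elim_comp_inl_inr (p i).1, sum_elim_dotProduct]
      rfl
    have e2 : ∀ ℓ : Fin L, z i ⬝ᵥ X.2.1 i ℓ.succ = t (i, ℓ) * z i ⬝ᵥ (u (i, ℓ)).1 := fun ℓ => by
      simp only [hX, Fin.cons_succ, dotProduct_smul, smul_eq_mul]
    rw [e1]
    simp only [e2, mul_add, Finset.mul_sum, mul_sub, Finset.sum_sub_distrib, mul_left_comm (lam i)]
    ring
  have hne : ∀ i, Nonempty (effDomain (P.primalConj i)) := fun i =>
    (hpc i).proper.2.elim fun x hx => ⟨⟨x, hx⟩⟩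
  have hne' : ∀ b : Fin (I + 1) × Fin L, Nonempty (effDomain (convexConj (P.c b.2))) := fun b =>
    (hcc b.2).proper.2.elim fun x hx => ⟨⟨x, hx⟩⟩
  obtain ⟨hcone, m, hm, hvm⟩ := exists_split_of_le_sum_cone
    (A := Fin (I + 1)) (B := Fin (I + 1) × Fin L)
    (D := fun i => effDomain (P.primalConj i)) (U := fun b => effDomain (convexConj (P.c b.2)))
    (φ := fun i (p : effDomain (P.primalConj i)) =>
      lam i * (P.primalConj i p).toReal - Sum.elim (w i) (z i) ⬝ᵥ (p : Fin dx ⊕ Fin dz → ℝ))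
    (ψ := fun b (u : effDomain (convexConj (P.c b.2))) =>
      lam b.1 * (convexConj (P.c b.2) u).toReal - z b.1 ⬝ᵥ (u : Fin dz → ℝ)) key
  have hobj : ∀ i, P.objPersp i (Sum.elim (w i) (z i)) (lam i) ≤ ((-m i : ℝ) : EReal) := fun i => by
    rw [objPersp, (P.dualConj_isProperClosedConvex i).perspective_le_iff, P.convexConj_dualConj]
    exact ⟨hlam0 i, fun y => by linarith [hm i y]⟩
  have hcon : ∀ i ℓ, perspective (P.c ℓ) (z i) (lam i) ≤ 0 := fun i ℓ => by
    rw [← EReal.coe_zero, (P.c_convex ℓ).perspective_le_iff]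
    exact ⟨hlam0 i, fun y => by linarith [hcone (i, ℓ) y]⟩
  exact P.exists_dual_of_bounds (by simp [hlam]) hlam0
    (fun k => by rw [Fin.sum_univ_succ]; simp [hw]) hobj hcon hvm

end RobustProgram

/-- A lower bound for a sum splits: one separate variable, and two families of conic variables. -/
theorem exists_split_of_le_sum_cone₂ {A B C : Type} [Fintype A] [Fintype B] [Fintype C] {D₀ : Type}
    [Nonempty D₀] {D : A → Type} [∀ a, Nonempty (D a)] {U : B → Type} [∀ b, Nonempty (U b)]
    {W : C → Type} [∀ c, Nonempty (W c)] {φ₀ : D₀ → ℝ} {φ : ∀ a, D a → ℝ} {ψ : ∀ b, U b → ℝ}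
    {χ : ∀ c, W c → ℝ} {v : ℝ}
    (h : ∀ (p₀ : D₀) (p : ∀ a, D a) (u : ∀ b, U b) (w : ∀ c, W c) (s : B → ℝ) (t : C → ℝ),
      (∀ b, 0 ≤ s b) → (∀ c, 0 ≤ t c) →
      v ≤ φ₀ p₀ + ∑ a, φ a (p a) + (∑ b, s b * ψ b (u b) + ∑ c, t c * χ c (w c))) :
    (∀ b d, 0 ≤ ψ b d) ∧ (∀ c d, 0 ≤ χ c d) ∧
      ∃ (m₀ : ℝ) (m : A → ℝ), (∀ d, m₀ ≤ φ₀ d) ∧ (∀ a d, m a ≤ φ a d) ∧ v ≤ m₀ + ∑ a, m a := by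
  have hψ := (exists_split_of_le_sum_cone (A := A) (B := B) (D := D) (U := U) (φ := φ) (ψ := ψ)
    (v := v - φ₀ (Classical.arbitrary D₀)) fun p u s hs => by
      have := h (Classical.arbitrary D₀) p u (fun c => Classical.arbitrary _) s 0 hs
        fun _ => le_rfl
      simp only [Pi.zero_apply, zero_mul, Finset.sum_const_zero, add_zero] at this
      linarith).1
  have hχ := (exists_split_of_le_sum_cone (A := A) (B := C) (D := D) (U := W) (φ := φ) (ψ := χ)
    (v := v - φ₀ (Classical.arbitrary D₀)) fun p w t ht => by
      have := h (Classical.arbitrary D₀) p (fun c => Classical.arbitrary _) w 0 t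
        (fun _ => le_rfl) ht
      simp only [Pi.zero_apply, zero_mul, Finset.sum_const_zero, zero_add] at this
      linarith).1
  refine ⟨hψ, hχ, ?_⟩
  -- The distinguished variable becomes the block `none` of one enlarged family.
  let D' : Option A → Type := fun a => a.elim D₀ D
  let φ' : ∀ a, D' a → ℝ := fun a => match a with
    | none => φ₀
    | some a => φ a
  have : ∀ a, Nonempty (D' a) := fun a => match a with
    | none => ‹Nonempty D₀›
    | some a => inferInstanceAs (Nonempty (D a))
  obtain ⟨m, hm, hv⟩ := exists_split_of_le_sum (φ := φ') (v := v) fun p => by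
    rw [Fintype.sum_option]
    have := h (p none) (fun a => p (some a)) (fun c => Classical.arbitrary _)
      (fun c => Classical.arbitrary _) 0 0 (fun _ => le_rfl) fun _ => le_rfl
    simp only [Pi.zero_apply, zero_mul, Finset.sum_const_zero, add_zero] at this
    exact this
  rw [Fintype.sum_option] at hv
  exact ⟨m none, fun a => m (some a), hm none, fun a => hm (some a), hv⟩

/-- Abel-type regrouping for constraints equating every copy with copy `0`: the resulting
coefficients sum to zero. -/
theorem sum_mul_sub_eq {n : ℕ} {e : Fin n → ℝ} {c : Fin (n + 1) → ℝ} (h₀ : c 0 = ∑ ℓ, e ℓ)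
    (h : ∀ ℓ, c (Fin.succ ℓ) = -e ℓ) (b : Fin (n + 1) → ℝ) :
    ∑ ℓ, e ℓ * (b (Fin.succ ℓ) - b 0) = -∑ ℓ, c ℓ * b ℓ := by
  rw [Fin.sum_univ_succ, h₀]
  simp only [h, mul_sub, Finset.sum_sub_distrib, Finset.sum_mul, neg_mul, Finset.sum_neg_distrib]
  ring

namespace RobustProgram

variable {dx dz I L : ℕ}

/-! #### The dual problem with a copy of `(z₀, lam, υ)` for every `ℓ` -/

/-- Decision vectors `(w, (z₀, lam, υ)_ℓ)`. -/
abbrev DualLift (dx dz I L : ℕ) : Type :=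
  (Fin (I + 1) → Fin dx → ℝ) × (Fin (L + 1) → (Fin dz → ℝ) × (Fin I → ℝ) × (Fin I → Fin dz → ℝ))

/-- The decision vector seen by the objective (`ℓ = 0`) or by the constraints for `c_ℓ`. -/
def dualProj (ℓ : Fin (L + 1)) : DualLift dx dz I L →ₗ[ℝ] DualVar dx dz I :=
  LinearMap.prodMap LinearMap.id (LinearMap.proj ℓ)

/-- The equality constraints `∑_i w_i = 0`, and equality of all copies. -/
def dualEq : Fin dx ⊕ (Fin dz × Fin L) ⊕ (Fin I × Fin L) ⊕ ((Fin I × Fin dz) × Fin L) →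
    DualLift dx dz I L →ₗ[ℝ] ℝ :=
  Sum.elim
    (fun k =>
      { toFun := fun X => ∑ i, X.1 i k
        map_add' := fun X Y => by simp [Finset.sum_add_distrib]
        map_smul' := fun r X => by simp [Finset.mul_sum] }) <|
  Sum.elim
    (fun s =>
      { toFun := fun X => (X.2 s.2.succ).1 s.1 - (X.2 0).1 s.1
        map_add' := fun X Y => by simp; ring
        map_smul' := fun r X => by simp; ring }) <|
  Sum.elim
    (fun s =>
      { toFun := fun X => (X.2 s.2.succ).2.1 s.1 - (X.2 0).2.1 s.1
        map_add' := fun X Y => by simp; ring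
        map_smul' := fun r X => by simp; ring })
    (fun s =>
      { toFun := fun X => (X.2 s.2.succ).2.2 s.1.1 s.1.2 - (X.2 0).2.2 s.1.1 s.1.2
        map_add' := fun X Y => by simp; ring
        map_smul' := fun r X => by simp; ring })

variable (P : RobustProgram dx dz I L)

/-- The objective of the lifted dual problem, to be minimized. -/
noncomputable def dualLiftObj (X : DualLift dx dz I L) : EReal :=
  P.dualCost (dualProj 0 X)

/-- The copy of the variables that enters a constraint. -/
def dualCopy : Fin L ⊕ Fin I × Fin L → Fin (L + 1) := Sum.elim Fin.succ fun s => s.2.succ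

/-- The constraint functions of the lifted dual problem. -/
noncomputable def dualLiftIneq (j : Fin L ⊕ Fin I × Fin L) (X : DualLift dx dz I L) : EReal :=
  P.dualConstraints.ineq j (dualProj (dualCopy j) X)

/-- The multipliers turn into primal variables: `x` belongs to `∑ w_i = 0`, while `y₀` and `y`
belong to the copies of `z₀` and `υ`. The auxiliary `ρ` belongs to the copies of `lam`. The
coefficients at index `0` make `y₀`, `y` and `ρ` sum to zero over `ℓ`. -/
theorem dualEq_sum
    (η : Fin dx ⊕ (Fin dz × Fin L) ⊕ (Fin I × Fin L) ⊕ ((Fin I × Fin dz) × Fin L) → ℝ)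
    (x : Fin dx → ℝ) (y₀ : Fin (L + 1) → Fin dz → ℝ) (ρ : Fin I → Fin (L + 1) → ℝ)
    (y : Fin I → Fin (L + 1) → Fin dz → ℝ) (hx : ∀ k, x k = -η (Sum.inl k))
    (hy₀0 : ∀ k, y₀ 0 k = ∑ ℓ, η (Sum.inr (Sum.inl (k, ℓ))))
    (hy₀ : ∀ k ℓ, y₀ (Fin.succ ℓ) k = -η (Sum.inr (Sum.inl (k, ℓ))))
    (hρ0 : ∀ i, ρ i 0 = ∑ ℓ, η (Sum.inr (Sum.inr (Sum.inl (i, ℓ)))))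
    (hρ : ∀ i ℓ, ρ i (Fin.succ ℓ) = -η (Sum.inr (Sum.inr (Sum.inl (i, ℓ)))))
    (hy0 : ∀ i k, y i 0 k = ∑ ℓ, η (Sum.inr (Sum.inr (Sum.inr ((i, k), ℓ)))))
    (hy : ∀ i k ℓ, y i (Fin.succ ℓ) k = -η (Sum.inr (Sum.inr (Sum.inr ((i, k), ℓ)))))
    (X : DualLift dx dz I L) :
    ∑ s, η s * dualEq s X = -(∑ i, x ⬝ᵥ X.1 i + ∑ ℓ, y₀ ℓ ⬝ᵥ (X.2 ℓ).1 +
      ∑ i, ∑ ℓ, (ρ i ℓ * (X.2 ℓ).2.1 i + y i ℓ ⬝ᵥ (X.2 ℓ).2.2 i)) := by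
  have e1 : ∑ k, η (Sum.inl k) * dualEq (L := L) (Sum.inl k) X = -∑ i, x ⬝ᵥ X.1 i := by
    simp only [dualEq, Sum.elim_inl, LinearMap.coe_mk, AddHom.coe_mk, dotProduct, hx, neg_mul,
      Finset.sum_neg_distrib, neg_neg, Finset.mul_sum]
    exact Finset.sum_comm
  have e2 : ∑ s, η (Sum.inr (Sum.inl s)) * dualEq (Sum.inr (Sum.inl s)) X =
      -∑ ℓ, y₀ ℓ ⬝ᵥ (X.2 ℓ).1 := by
    rw [Fintype.sum_prod_type]
    simp only [dotProduct]
    rw [Finset.sum_comm (γ := Fin (L + 1)), ← Finset.sum_neg_distrib]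
    exact Finset.sum_congr rfl fun k _ =>
      sum_mul_sub_eq (c := fun ℓ => y₀ ℓ k) (hy₀0 k) (hy₀ k) fun ℓ => (X.2 ℓ).1 k
  have e3 : ∑ s, η (Sum.inr (Sum.inr (Sum.inl s))) * dualEq (Sum.inr (Sum.inr (Sum.inl s))) X =
      -∑ i, ∑ ℓ, ρ i ℓ * (X.2 ℓ).2.1 i := by
    rw [Fintype.sum_prod_type, ← Finset.sum_neg_distrib]
    exact Finset.sum_congr rfl fun i _ =>
      sum_mul_sub_eq (c := ρ i) (hρ0 i) (hρ i) fun ℓ => (X.2 ℓ).2.1 i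
  have e4 : ∑ s, η (Sum.inr (Sum.inr (Sum.inr s))) * dualEq (Sum.inr (Sum.inr (Sum.inr s))) X =
      -∑ i, ∑ ℓ, y i ℓ ⬝ᵥ (X.2 ℓ).2.2 i := by
    rw [Fintype.sum_prod_type, Fintype.sum_prod_type, ← Finset.sum_neg_distrib]
    refine Finset.sum_congr rfl fun i _ => ?_
    simp only [dotProduct]
    rw [Finset.sum_comm (γ := Fin (L + 1)), ← Finset.sum_neg_distrib]
    exact Finset.sum_congr rfl fun k _ =>
      sum_mul_sub_eq (c := fun ℓ => y i ℓ k) (hy0 i k) (hy i k) fun ℓ => (X.2 ℓ).2.2 i k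
  rw [Fintype.sum_sum_type, Fintype.sum_sum_type, Fintype.sum_sum_type, e1, e2, e3, e4]
  simp only [Finset.sum_add_distrib]
  ring

/-- The numbers `-ρ i ℓ` distribute the right-hand side `0` of the `i`-th constraint over its
summands. -/
theorem exists_primal_of_bounds {x : Fin dx → ℝ} {y : Fin (I + 1) → Fin (L + 1) → Fin dz → ℝ}
    {ν : Fin (I + 1) → Fin L → ℝ} (hν : ∀ i ℓ, 0 ≤ ν i ℓ) (hy : ∀ i k, ∑ ℓ, y i ℓ k = 0)
    {ρ : Fin I → Fin (L + 1) → ℝ} (hρ : ∀ i, ∑ ℓ, ρ i ℓ = 0) {m₀ : ℝ} {m : Fin L → ℝ}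
    (hobj₀ : P.primalConj 0 (Sum.elim x (y 0 0)) ≤ ((-m₀ : ℝ) : EReal))
    (hobj : ∀ ℓ, P.conPersp ℓ (y 0 ℓ.succ) (ν 0 ℓ) ≤ ((-m ℓ : ℝ) : EReal))
    (hcon₀ : ∀ i : Fin I, P.primalConj i.succ (Sum.elim x (y i.succ 0)) ≤ ((-ρ i 0 : ℝ) : EReal))
    (hcon : ∀ (i : Fin I) ℓ, P.conPersp ℓ (y i.succ ℓ.succ) (ν i.succ ℓ) ≤
      ((-ρ i ℓ.succ : ℝ) : EReal)) {v : ℝ} (hv : v ≤ m₀ + ∑ ℓ, m ℓ) :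
    ∃ p ∈ P.primalConstraints.solutions, P.primalObj p ≤ ((-v : ℝ) : EReal) := by
  refine ⟨(x, y, ν), P.mem_primal_solutions.2 ⟨hν, fun i => ?_, hy⟩, ?_⟩
  · rw [primalFun_eq]
    refine (add_le_add (hcon₀ i) (EReal.sum_le_coe fun ℓ _ => hcon i ℓ)).trans (le_of_eq ?_)
    rw [← EReal.coe_add, ← EReal.coe_zero, EReal.coe_eq_coe_iff, Finset.sum_neg_distrib]
    have := hρ i
    rw [Fin.sum_univ_succ] at this
    linarith
  · rw [primalObj, primalFun_eq]
    refine (add_le_add hobj₀ (EReal.sum_le_coe fun ℓ _ => hobj ℓ)).trans ?_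
    rw [← EReal.coe_add, EReal.coe_le_coe_iff, Finset.sum_neg_distrib]
    linarith

theorem dualLiftIneq_inl (ℓ : Fin L) (X : DualLift dx dz I L) :
    P.dualLiftIneq (Sum.inl ℓ) X = P.c ℓ (X.2 ℓ.succ).1 := rfl

theorem dualLiftIneq_inr (s : Fin I × Fin L) (X : DualLift dx dz I L) :
    P.dualLiftIneq (Sum.inr s) X =
      perspective (P.c s.2) ((X.2 s.2.succ).2.2 s.1) ((X.2 s.2.succ).2.1 s.1) := rfl

/-- The test vectors for multipliers of the lifted dual problem. -/
def dualTest (q₀ : Fin dx ⊕ Fin dz → ℝ) (Z : Fin L → Fin dz → ℝ) (r : Fin I → Fin dx ⊕ Fin dz → ℝ)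
    (ζ : Fin I × Fin L → Fin dz → ℝ) (s : Fin I → ℝ) (t : Fin I × Fin L → ℝ) :
    DualLift dx dz I L :=
  (Fin.cons (q₀ ∘ Sum.inl) fun i => s i • r i ∘ Sum.inl,
    Fin.cons (q₀ ∘ Sum.inr, s, fun i => s i • r i ∘ Sum.inr)
      fun ℓ => (Z ℓ, fun i => t (i, ℓ), fun i => t (i, ℓ) • ζ (i, ℓ)))

theorem IsMultiplier.le_dualTest {v : ℝ} {μ : Fin L ⊕ Fin I × Fin L → ℝ}
    {η : Fin dx ⊕ (Fin dz × Fin L) ⊕ (Fin I × Fin L) ⊕ ((Fin I × Fin dz) × Fin L) → ℝ}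
    (h : IsMultiplier P.dualLiftObj P.dualLiftIneq dualEq v μ η)
    {x : Fin dx → ℝ} {y₀ : Fin (L + 1) → Fin dz → ℝ} {ρ : Fin I → Fin (L + 1) → ℝ}
    {y : Fin I → Fin (L + 1) → Fin dz → ℝ}
    (hη : ∀ X, ∑ s, η s * dualEq s X = -(∑ i, x ⬝ᵥ X.1 i + ∑ ℓ, y₀ ℓ ⬝ᵥ (X.2 ℓ).1 +
      ∑ i, ∑ ℓ, (ρ i ℓ * (X.2 ℓ).2.1 i + y i ℓ ⬝ᵥ (X.2 ℓ).2.2 i)))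
    (q₀ : effDomain (P.dualConj 0)) (Z : ∀ ℓ, effDomain (P.c ℓ))
    (r : ∀ i : Fin I, effDomain (P.dualConj i.succ)) (ζ : ∀ b : Fin I × Fin L, effDomain (P.c b.2))
    {s : Fin I → ℝ} {t : Fin I × Fin L → ℝ} (hs : ∀ i, 0 ≤ s i) (ht : ∀ b, 0 ≤ t b) :
    v ≤ ((P.dualConj 0 q₀).toReal - Sum.elim x (y₀ 0) ⬝ᵥ (q₀ : Fin dx ⊕ Fin dz → ℝ)) +
      ∑ ℓ, (μ (Sum.inl ℓ) * (P.c ℓ (Z ℓ)).toReal - y₀ ℓ.succ ⬝ᵥ (Z ℓ : Fin dz → ℝ)) +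
      (∑ i : Fin I, s i * ((P.dualConj i.succ (r i)).toReal -
          Sum.elim x (y i 0) ⬝ᵥ (r i : Fin dx ⊕ Fin dz → ℝ) - ρ i 0) +
        ∑ b : Fin I × Fin L, t b * (μ (Sum.inr b) * (P.c b.2 (ζ b)).toReal -
          y b.1 b.2.succ ⬝ᵥ (ζ b : Fin dz → ℝ) - ρ b.1 b.2.succ)) := by
  have hdc := fun i => P.dualConj_isProperClosedConvex i
  obtain ⟨X, hX⟩ : ∃ X : DualLift dx dz I L, X = dualTest q₀ (fun ℓ => Z ℓ) (fun i => r i)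
    (fun b => ζ b) s t := ⟨_, rfl⟩
  have hX0 : Sum.elim ((dualProj 0 X).1 0) (dualProj 0 X).2.1 = q₀.1 := by
    rw [hX]; exact Sum.elim_comp_inl_inr _
  have hXi : ∀ i : Fin I, P.objPersp i.succ
      (Sum.elim ((dualProj 0 X).1 i.succ) ((dualProj 0 X).2.2.2 i)) ((dualProj 0 X).2.2.1 i) =
      ((s i * (P.dualConj i.succ (r i)).toReal : ℝ) : EReal) := fun i => by
    rw [← (hdc i.succ).perspective_smul (r i).2 (hs i), hX]
    have : Sum.elim (s i • (r i).1 ∘ Sum.inl) (s i • (r i).1 ∘ Sum.inr) = s i • (r i).1 := by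
      ext (k | k) <;> rfl
    rw [← this]
    rfl
  have hXc : ∀ ℓ, P.dualLiftIneq (Sum.inl ℓ) X = P.c ℓ (Z ℓ) := fun ℓ => by
    rw [dualLiftIneq_inl, hX]; rfl
  have hXb : ∀ b, P.dualLiftIneq (Sum.inr b) X = ((t b * (P.c b.2 (ζ b)).toReal : ℝ) : EReal) :=
    fun b => by
      rw [dualLiftIneq_inr, hX, ← (P.c_convex b.2).perspective_smul (ζ b).2 (ht b)]
      rfl
  have hlt : P.dualLiftObj X < ⊤ := by
    rw [dualLiftObj, dualCost_lt_top_iff, hX0]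
    exact ⟨q₀.2, fun i => by rw [hXi]; exact EReal.coe_lt_top _⟩
  have h1 := h.le X ⟨hlt, by
    rintro (ℓ | b)
    · rw [hXc]; exact (Z ℓ).2
    · rw [hXb]; exact EReal.coe_lt_top _⟩
  have hval : (P.dualLiftObj X).toReal = (P.dualConj 0 q₀).toReal +
      ∑ i : Fin I, s i * (P.dualConj i.succ (r i)).toReal := by
    rw [dualLiftObj, P.dualCost_eq_coe hlt, hX0, EReal.toReal_coe]
    simp only [hXi, EReal.toReal_coe]
  rw [hη, hval, Fintype.sum_sum_type] at h1
  simp only [hXc, hXb, EReal.toReal_coe] at h1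
  refine h1.trans (le_of_eq ?_)
  have f1 : ∑ i, x ⬝ᵥ X.1 i = x ⬝ᵥ (q₀.1 ∘ Sum.inl) +
      ∑ i, s i * x ⬝ᵥ ((r i).1 ∘ Sum.inl) := by
    rw [Fin.sum_univ_succ, hX]
    simp only [dualTest, Fin.cons_zero, Fin.cons_succ, dotProduct_smul, smul_eq_mul]
  have f2 : ∑ ℓ, y₀ ℓ ⬝ᵥ (X.2 ℓ).1 = y₀ 0 ⬝ᵥ (q₀.1 ∘ Sum.inr) +
      ∑ ℓ, y₀ (Fin.succ ℓ) ⬝ᵥ (Z ℓ).1 := by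
    rw [Fin.sum_univ_succ, hX]
    simp only [dualTest, Fin.cons_zero, Fin.cons_succ]
  have f3 : ∀ i, ∑ ℓ, (ρ i ℓ * (X.2 ℓ).2.1 i + y i ℓ ⬝ᵥ (X.2 ℓ).2.2 i) =
      s i * (ρ i 0 + y i 0 ⬝ᵥ ((r i).1 ∘ Sum.inr)) +
      ∑ ℓ, t (i, ℓ) * (ρ i (Fin.succ ℓ) + y i (Fin.succ ℓ) ⬝ᵥ (ζ (i, ℓ)).1) := fun i => by
    rw [Fin.sum_univ_succ, hX]
    simp only [dualTest, Fin.cons_zero, Fin.cons_succ, dotProduct_smul, smul_eq_mul, mul_add,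
      mul_comm (ρ i _)]
  have f4 : ∀ (a : Fin dx → ℝ) (b : Fin dz → ℝ) (q : Fin dx ⊕ Fin dz → ℝ),
      Sum.elim a b ⬝ᵥ q = a ⬝ᵥ (q ∘ Sum.inl) + b ⬝ᵥ (q ∘ Sum.inr) := fun a b q => by
    rw [← sum_elim_dotProduct, Sum.elim_comp_inl_inr]
  rw [f1, f2]
  simp only [f3, f4, Fintype.sum_prod_type, mul_add, mul_sub, Finset.sum_add_distrib,
    Finset.sum_sub_distrib, mul_left_comm (μ _)]
  ring

/-- In the separated Lagrangian, the blocks of `z₀` bound the summands of the primal objective. The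
conic blocks, which carry the scale `lam i`, must have nonnegative slope; this bounds the summands
of the `i`-th primal constraint by `-ρ i ℓ`. The inequality multipliers become `ν`. -/
theorem exists_primal_of_isMultiplier {v : ℝ} {μ : Fin L ⊕ Fin I × Fin L → ℝ}
    {η : Fin dx ⊕ (Fin dz × Fin L) ⊕ (Fin I × Fin L) ⊕ ((Fin I × Fin dz) × Fin L) → ℝ}
    (h : IsMultiplier P.dualLiftObj P.dualLiftIneq dualEq v μ η) :
    ∃ p ∈ P.primalConstraints.solutions, P.primalObj p ≤ ((-v : ℝ) : EReal) := by
  obtain ⟨x, hx⟩ : ∃ x : Fin dx → ℝ, ∀ k, x k = -η (Sum.inl k) := ⟨_, fun _ => rfl⟩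
  obtain ⟨y₀, hy₀0, hy₀⟩ : ∃ y₀ : Fin (L + 1) → Fin dz → ℝ,
      (∀ k, y₀ 0 k = ∑ ℓ, η (Sum.inr (Sum.inl (k, ℓ)))) ∧
      ∀ k ℓ, y₀ (Fin.succ ℓ) k = -η (Sum.inr (Sum.inl (k, ℓ))) :=
    ⟨Fin.cons (fun k => ∑ ℓ, η (Sum.inr (Sum.inl (k, ℓ)))) fun ℓ k => -η (Sum.inr (Sum.inl (k, ℓ))),
      fun _ => rfl, fun _ _ => rfl⟩
  obtain ⟨ρ, hρ0, hρ⟩ : ∃ ρ : Fin I → Fin (L + 1) → ℝ,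
      (∀ i, ρ i 0 = ∑ ℓ, η (Sum.inr (Sum.inr (Sum.inl (i, ℓ))))) ∧
      ∀ i ℓ, ρ i (Fin.succ ℓ) = -η (Sum.inr (Sum.inr (Sum.inl (i, ℓ)))) :=
    ⟨fun i => Fin.cons (∑ ℓ, η (Sum.inr (Sum.inr (Sum.inl (i, ℓ)))))
      fun ℓ => -η (Sum.inr (Sum.inr (Sum.inl (i, ℓ)))), fun _ => rfl, fun _ _ => rfl⟩
  obtain ⟨y, hy0, hy⟩ : ∃ y : Fin I → Fin (L + 1) → Fin dz → ℝ,
      (∀ i k, y i 0 k = ∑ ℓ, η (Sum.inr (Sum.inr (Sum.inr ((i, k), ℓ))))) ∧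
      ∀ i k ℓ, y i (Fin.succ ℓ) k = -η (Sum.inr (Sum.inr (Sum.inr ((i, k), ℓ)))) :=
    ⟨fun i => Fin.cons (fun k => ∑ ℓ, η (Sum.inr (Sum.inr (Sum.inr ((i, k), ℓ)))))
      fun ℓ k => -η (Sum.inr (Sum.inr (Sum.inr ((i, k), ℓ)))), fun _ _ => rfl, fun _ _ _ => rfl⟩
  have key := IsMultiplier.le_dualTest P h
    (dualEq_sum η x y₀ ρ y hx hy₀0 hy₀ hρ0 hρ hy0 hy)
  have hdc := fun i => P.dualConj_isProperClosedConvex i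
  have i1 : ∀ i, Nonempty (effDomain (P.dualConj i)) := fun i =>
    (hdc i).proper.2.elim fun x hx => ⟨⟨x, hx⟩⟩
  have i2 : ∀ ℓ, Nonempty (effDomain (P.c ℓ)) := fun ℓ =>
    (P.c_convex ℓ).proper.2.elim fun x hx => ⟨⟨x, hx⟩⟩
  have i3 : ∀ b : Fin I × Fin L, Nonempty (effDomain (P.c b.2)) := fun b => i2 b.2
  have i4 : ∀ i : Fin I, Nonempty (effDomain (P.dualConj i.succ)) := fun i => i1 i.succ
  obtain ⟨hψ, hχ, m₀, m, hm₀, hm, hvm⟩ := exists_split_of_le_sum_cone₂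
    (A := Fin L) (B := Fin I) (C := Fin I × Fin L) (D₀ := effDomain (P.dualConj 0))
    (D := fun ℓ => effDomain (P.c ℓ)) (U := fun i => effDomain (P.dualConj i.succ))
    (W := fun b => effDomain (P.c b.2))
    (φ₀ := fun q₀ => (P.dualConj 0 q₀).toReal - Sum.elim x (y₀ 0) ⬝ᵥ (q₀ : Fin dx ⊕ Fin dz → ℝ))
    (φ := fun ℓ Z => μ (Sum.inl ℓ) * (P.c ℓ Z).toReal - y₀ ℓ.succ ⬝ᵥ (Z : Fin dz → ℝ))
    (ψ := fun i r => (P.dualConj i.succ r).toReal -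
          Sum.elim x (y i 0) ⬝ᵥ (r : Fin dx ⊕ Fin dz → ℝ) - ρ i 0)
    (χ := fun b ζ => μ (Sum.inr b) * (P.c b.2 ζ).toReal -
          y b.1 b.2.succ ⬝ᵥ (ζ : Fin dz → ℝ) - ρ b.1 b.2.succ) (v := v)
    (fun q₀ Z r ζ s t hs ht => key q₀ Z r ζ hs ht)
  have hconj : ∀ (i : Fin (I + 1)) (p : Fin dx ⊕ Fin dz → ℝ) (a : ℝ),
      (∀ q : effDomain (P.dualConj i), a ≤ (P.dualConj i q).toReal - p ⬝ᵥ q.1) →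
      P.primalConj i p ≤ ((-a : ℝ) : EReal) := fun i p a ha => by
    rw [← P.convexConj_dualConj, convexConj_eq_iSup (hdc i).bot_lt]
    exact iSup_le fun q => EReal.coe_le_coe_iff.2 (by linarith [ha q])
  have hper : ∀ (ℓ : Fin L) (u : Fin dz → ℝ) (n a : ℝ), 0 ≤ n →
      (∀ z : effDomain (P.c ℓ), a ≤ n * (P.c ℓ z).toReal - u ⬝ᵥ z.1) →
      P.conPersp ℓ u n ≤ ((-a : ℝ) : EReal) := fun ℓ u n a hn ha => by
    rw [conPersp, (P.c_convex ℓ).perspective_conj_eq u hn]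
    exact iSup_le fun q => EReal.coe_le_coe_iff.2 (by linarith [ha q])
  refine P.exists_primal_of_bounds (x := x) (y := Fin.cons y₀ y)
    (ν := Fin.cons (fun ℓ => μ (Sum.inl ℓ)) fun i ℓ => μ (Sum.inr (i, ℓ))) (ρ := ρ) (m₀ := m₀)
    (m := m) ?_ ?_ ?_ ?_ ?_ ?_ ?_ hvm
  · refine fun i ℓ => Fin.cases ?_ (fun i => ?_) i
    · exact h.nonneg _
    · exact h.nonneg _
  · refine fun i k => Fin.cases ?_ (fun i => ?_) i
    · rw [Fin.sum_univ_succ]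
      simp only [Fin.cons_zero, hy₀0, hy₀, Finset.sum_neg_distrib, add_neg_cancel]
    · rw [Fin.sum_univ_succ]
      simp only [Fin.cons_succ, hy0, hy, Finset.sum_neg_distrib, add_neg_cancel]
  · intro i
    rw [Fin.sum_univ_succ]
    simp only [hρ0, hρ, Finset.sum_neg_distrib, add_neg_cancel]
  · exact hconj 0 _ _ hm₀
  · exact fun ℓ => hper ℓ _ _ _ (h.nonneg _) (hm ℓ)
  · exact fun i => hconj i.succ _ _ fun q => by
      have := hψ i q
      simp only [Fin.cons_succ]
      linarith
  · exact fun i ℓ => hper ℓ _ _ _ (h.nonneg _) fun q => by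
      have := hχ (i, ℓ) q
      simp only [Fin.cons_succ]
      linarith

end RobustProgram

namespace RobustProgram

variable {dx dz I L : ℕ} (P : RobustProgram dx dz I L)

/-! ### Convexity and semicontinuity of the functions in the two problems -/

theorem primalFun_convex (i : Fin (I + 1)) : IsConvexFun (P.primalFun i) := by
  let A : PrimalVar dx dz I L →ₗ[ℝ] (Fin dx ⊕ Fin dz → ℝ) :=
    { toFun := fun p => Sum.elim p.1 (p.2.1 i 0)
      map_add' := fun p q => by ext (k | k) <;> rfl
      map_smul' := fun r p => by ext (k | k) <;> rfl }
  let B : Fin L → PrimalVar dx dz I L →ₗ[ℝ] (Fin dz → ℝ) × ℝ := fun ℓ =>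
    { toFun := fun p => (p.2.1 i ℓ.succ, p.2.2 i ℓ)
      map_add' := fun p q => rfl
      map_smul' := fun r p => rfl }
  have h := IsConvexFun.add ((P.primalConj_isProperClosedConvex i).convex.comp_linearMap A)
    (IsConvexFun.sum Finset.univ
      (fun ℓ => ((P.c_convex ℓ).conj.perspective_convex).comp_linearMap (B ℓ))
      fun ℓ x => P.conPersp_bot_lt ..)
    (fun x => (P.primalConj_isProperClosedConvex i).bot_lt _)
    fun x => EReal.bot_lt_sum _ fun ℓ _ => P.conPersp_bot_lt ..
  exact h

theorem primalFun_lsc (i : Fin (I + 1)) : LowerSemicontinuous (P.primalFun i) := by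
  have hA : Continuous fun p : PrimalVar dx dz I L => Sum.elim p.1 (p.2.1 i 0) := by
    refine continuous_pi fun k => ?_
    rcases k with k | k
    · exact (continuous_apply k).comp continuous_fst
    · simp only [Sum.elim_inr]; fun_prop
  have hB : ∀ ℓ : Fin L, Continuous fun p : PrimalVar dx dz I L => (p.2.1 i ℓ.succ, p.2.2 i ℓ) :=
    fun ℓ => by fun_prop
  have h := LowerSemicontinuous.ereal_add ((P.primalConj_isProperClosedConvex i).lsc.comp hA)
    (LowerSemicontinuous.ereal_sum Finset.univ
      (fun ℓ => ((P.c_convex ℓ).conj.perspective_lsc).comp (hB ℓ))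
      fun ℓ x => P.conPersp_bot_lt ..)
    (fun x => (P.primalConj_isProperClosedConvex i).bot_lt _)
    fun x => EReal.bot_lt_sum _ fun ℓ _ => P.conPersp_bot_lt ..
  exact h

theorem dualCost_convex : IsConvexFun P.dualCost := by
  let A : DualVar dx dz I →ₗ[ℝ] (Fin dx ⊕ Fin dz → ℝ) :=
    { toFun := fun q => Sum.elim (q.1 0) q.2.1
      map_add' := fun p q => by ext (k | k) <;> rfl
      map_smul' := fun r p => by ext (k | k) <;> rfl }
  let B : Fin I → DualVar dx dz I →ₗ[ℝ] (Fin dx ⊕ Fin dz → ℝ) × ℝ := fun i =>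
    { toFun := fun q => (Sum.elim (q.1 i.succ) (q.2.2.2 i), q.2.2.1 i)
      map_add' := fun p q => by
        refine Prod.ext ?_ rfl
        ext (k | k) <;> rfl
      map_smul' := fun r p => by
        refine Prod.ext ?_ rfl
        ext (k | k) <;> rfl }
  have h := IsConvexFun.add ((P.dualConj_isProperClosedConvex 0).convex.comp_linearMap A)
    (IsConvexFun.sum Finset.univ
      (fun i : Fin I =>
        ((P.dualConj_isProperClosedConvex i.succ).perspective_convex).comp_linearMap (B i))
      fun i x => P.objPersp_bot_lt ..)
    (fun x => (P.dualConj_isProperClosedConvex 0).bot_lt _)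
    fun x => EReal.bot_lt_sum _ fun i _ => P.objPersp_bot_lt ..
  exact h

theorem dualCost_lsc : LowerSemicontinuous P.dualCost := by
  have hA : Continuous fun q : DualVar dx dz I => Sum.elim (q.1 0) q.2.1 := by
    refine continuous_pi fun k => ?_
    rcases k with k | k
    · simp only [Sum.elim_inl]; fun_prop
    · simp only [Sum.elim_inr]; fun_prop
  have hB : ∀ i : Fin I, Continuous fun q : DualVar dx dz I =>
      (Sum.elim (q.1 i.succ) (q.2.2.2 i), q.2.2.1 i) := fun i => by
    refine Continuous.prodMk (continuous_pi fun k => ?_) (by fun_prop)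
    rcases k with k | k
    · simp only [Sum.elim_inl]; fun_prop
    · simp only [Sum.elim_inr]; fun_prop
  have h := LowerSemicontinuous.ereal_add ((P.dualConj_isProperClosedConvex 0).lsc.comp hA)
    (LowerSemicontinuous.ereal_sum Finset.univ
      (fun i : Fin I => ((P.dualConj_isProperClosedConvex i.succ).perspective_lsc).comp (hB i))
      fun i x => P.objPersp_bot_lt ..)
    (fun x => (P.dualConj_isProperClosedConvex 0).bot_lt _)
    fun x => EReal.bot_lt_sum _ fun i _ => P.objPersp_bot_lt ..
  exact h

theorem dualIneq_convex (j : Fin L ⊕ Fin I × Fin L) : IsConvexFun (P.dualConstraints.ineq j) := by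
  rcases j with ℓ | ⟨i, ℓ⟩
  · let A : DualVar dx dz I →ₗ[ℝ] (Fin dz → ℝ) :=
      LinearMap.fst ℝ _ _ ∘ₗ LinearMap.snd ℝ _ _
    exact (P.c_convex ℓ).convex.comp_linearMap A
  · let B : DualVar dx dz I →ₗ[ℝ] (Fin dz → ℝ) × ℝ :=
      { toFun := fun q => (q.2.2.2 i, q.2.2.1 i)
        map_add' := fun p q => rfl
        map_smul' := fun r p => rfl }
    exact (P.c_convex ℓ).perspective_convex.comp_linearMap B

theorem dualIneq_lsc (j : Fin L ⊕ Fin I × Fin L) :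
    LowerSemicontinuous (P.dualConstraints.ineq j) := by
  rcases j with ℓ | ⟨i, ℓ⟩
  · have hA : Continuous fun q : DualVar dx dz I => q.2.1 := by fun_prop
    exact (P.c_convex ℓ).lsc.comp hA
  · have hB : Continuous fun q : DualVar dx dz I => (q.2.2.2 i, q.2.2.1 i) := by fun_prop
    exact (P.c_convex ℓ).perspective_lsc.comp hB

theorem dualIneq_bot_lt (j : Fin L ⊕ Fin I × Fin L) (q : DualVar dx dz I) :
    ⊥ < P.dualConstraints.ineq j q := by
  rcases j with ℓ | ⟨i, ℓ⟩
  · exact (P.c_convex ℓ).bot_lt _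
  · exact (P.c_convex ℓ).perspective_bot_lt _ _

/-! ### The primal problem -/

/-- A primal decision vector with equal copies. -/
def primalEmbed : PrimalVar dx dz I L →ₗ[ℝ] PrimalLift dx dz I L :=
  LinearMap.prodMap (LinearMap.pi fun _ => LinearMap.id) LinearMap.id

theorem primalProj_embed (i : Fin (I + 1)) (p : PrimalVar dx dz I L) :
    primalProj i (primalEmbed p) = p := rfl

theorem primalEq_embed {p : PrimalVar dx dz I L} (hp : p ∈ P.primalConstraints.solutions) (s) :
    primalEq s (primalEmbed p) = 0 := by
  rcases s with s | s
  · simp [primalEq, primalEmbed]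
  · exact (P.mem_primal_solutions.1 hp).2.2 _ _

/-- The lifted program has no sign restriction on `ν`; it is recovered from finiteness of the
perspectives, which are `⊤` at negative scales. -/
theorem exists_of_mem_primalLift {X : PrimalLift dx dz I L} (h₀ : P.primalLiftObj X < ⊤)
    (h : ∀ i, P.primalLiftIneq i X ≤ 0) (he : ∀ s, primalEq s X = 0) :
    ∃ p ∈ P.primalRegion, X = primalEmbed p := by
  have hX : X = primalEmbed (primalProj 0 X) := by
    refine Prod.ext (funext fun i => funext fun k => ?_) rfl
    refine Fin.cases rfl (fun i => ?_) i
    exact sub_eq_zero.1 (he (Sum.inl (i, k)))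
  obtain ⟨p, hp⟩ : ∃ p, X = primalEmbed p := ⟨_, hX⟩
  subst hp
  have h₀' : P.primalFun 0 p < ⊤ := h₀
  have h' : ∀ i : Fin I, P.primalFun i.succ p ≤ 0 := h
  refine ⟨p, ⟨P.mem_primal_solutions.2 ⟨fun i ℓ => ?_, h', fun i k => he (Sum.inr (i, k))⟩,
    h₀'.ne⟩, rfl⟩
  have hlt : P.primalFun i p < ⊤ := Fin.cases h₀' (fun i => (h' i).trans_lt EReal.zero_lt_top) i
  exact nonneg_of_perspective_lt_top (((P.primalFun_lt_top_iff i p).1 hlt).2 ℓ)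

theorem primalLiftObj_convex : IsConvexFun P.primalLiftObj :=
  (P.primalFun_convex 0).comp_linearMap (primalProj 0)

theorem primalLiftIneq_convex (i : Fin I) : IsConvexFun (P.primalLiftIneq i) :=
  (P.primalFun_convex i.succ).comp_linearMap (primalProj i.succ)

theorem exists_dual_of_primal_slater {p : PrimalVar dx dz I L}
    (hp : P.primalConstraints.IsMinSlaterPoint P.primalObj p) {v : ℝ}
    (hv : (v : EReal) ≤ P.primalInf) :
    ∃ q ∈ P.dualConstraints.solutions, (v : EReal) ≤ P.dualObj q := by
  obtain ⟨hS, h₀⟩ := hp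
  have hdom : programDomain P.primalLiftObj P.primalLiftIneq =
      {X | ∀ i, primalProj i X ∈ effDomain (P.primalFun i)} := by
    ext X
    refine ⟨fun hX i => Fin.cases hX.1 hX.2 i, fun hX => ⟨hX 0, fun i => hX i.succ⟩⟩
  have hcore : IsCorePoint (programDomain P.primalLiftObj P.primalLiftIneq) (primalEmbed p) := by
    rw [hdom]
    refine IsCorePoint.iInter_preimage (fun i => (P.primalFun_convex i).convex_effDomain) _
      fun i => ?_
    rw [primalProj_embed]
    exact Fin.cases (IsCorePoint.of_mem_intrinsicInterior h₀)
      (fun i => IsCorePoint.of_mem_intrinsicInterior (hS.mem_ri_ineq i)) i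
  obtain ⟨μ, η, hm⟩ := exists_isMultiplier_slater (a := primalEq) P.primalLiftObj_convex
    P.primalLiftIneq_convex (fun X => P.primalFun_bot_lt _ _) (fun i X => P.primalFun_bot_lt _ _)
    hcore (fun i => by
      by_cases hl : P.primalConstraints.IsLinear (P.primalConstraints.ineq i)
      · obtain ⟨g, hg⟩ := hl
        -- A linear constraint function is affine only where `ν ≥ 0`, and this holds throughout the
        -- common domain.
        refine Or.inr ⟨(P.mem_primal_solutions.1 hS.mem_solutions).2.1 i,
          g.comp (primalProj i.succ).toAffineMap, fun X hX => hg _ fun k ℓ => ?_⟩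
        rw [hdom] at hX
        exact nonneg_of_perspective_lt_top (((P.primalFun_lt_top_iff k _).1 (hX k)).2 ℓ)
      · exact Or.inl (hS.strict_of_nonlinear i hl))
    (P.primalEq_embed hS.mem_solutions) (v := v) (fun X hX hXe => by
      rcases eq_top_or_lt_top (P.primalLiftObj X) with htop | hlt
      · rw [htop]; exact le_top
      · obtain ⟨p', hp', rfl⟩ := P.exists_of_mem_primalLift hlt hX hXe
        exact hv.trans (iInf₂_le p' hp'.1))
  exact P.exists_dual_of_isMultiplier hm

theorem le_dualSup {q : DualVar dx dz I} (hq : q ∈ P.dualConstraints.solutions) :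
    P.dualObj q ≤ P.dualSup :=
  le_iSup₂ (f := fun q (_ : q ∈ P.dualConstraints.solutions) => P.dualObj q) q hq

theorem primalInf_le {p : PrimalVar dx dz I L} (hp : p ∈ P.primalConstraints.solutions) :
    P.primalInf ≤ P.primalObj p :=
  iInf₂_le (f := fun p (_ : p ∈ P.primalConstraints.solutions) => P.primalObj p) p hp

/-- If the infimum is `-∞`, weak duality leaves the dual problem without feasible points. Otherwise
it is finite, since the Slater point has finite cost, and multipliers for exactly this value give a
dual optimizer. -/
theorem of_primal_slater {p : PrimalVar dx dz I L}
    (hp : P.primalConstraints.IsMinSlaterPoint P.primalObj p) :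
    P.primalInf = P.dualSup ∧ P.DualSolvable := by
  have hweak := P.dualSup_le_primalInf
  have hdom : p ∈ effDomain P.primalObj := intrinsicInterior_subset hp.2
  have hlt : P.primalInf < ⊤ := (P.primalInf_le hp.1.mem_solutions).trans_lt hdom
  rcases eq_bot_or_bot_lt P.primalInf with hbot | hbot
  · rw [hbot] at hweak ⊢
    refine ⟨(le_bot_iff.1 hweak).symm, fun ⟨q, hq⟩ => absurd ?_ hq.2⟩
    exact le_bot_iff.1 ((P.le_dualSup hq.1).trans hweak)
  · obtain ⟨q, hq, hvq⟩ := P.exists_dual_of_primal_slater hp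
      (v := P.primalInf.toReal) (EReal.coe_toReal hlt.ne hbot.ne').le
    rw [EReal.coe_toReal hlt.ne hbot.ne'] at hvq
    have heq : P.primalInf = P.dualSup := le_antisymm (hvq.trans (P.le_dualSup hq)) hweak
    refine ⟨heq, fun _ => ⟨q, ⟨hq, (hbot.trans_le hvq).ne'⟩, le_antisymm (P.le_dualSup hq) ?_⟩⟩
    exact heq.symm.le.trans hvq

theorem isBounded_image_linearMap {V W : Type} [NormedAddCommGroup V] [NormedSpace ℝ V]
    [FiniteDimensional ℝ V] [NormedAddCommGroup W] [NormedSpace ℝ W] (A : V →ₗ[ℝ] W) {S : Set V}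
    (hS : Bornology.IsBounded S) : Bornology.IsBounded (A '' S) :=
  (LinearMap.toContinuousLinearMap A).lipschitz.isBounded_image hS

/-- Compactness yields a primal optimizer. Multipliers are available for every real `v` strictly
below the infimum, which equates the values without attainment in the dual. -/
theorem of_primal_bounded (hne : P.primalRegion.Nonempty)
    (hbd : Bornology.IsBounded P.primalRegion) :
    P.primalInf = P.dualSup ∧ P.PrimalSolvable := by
  have hsub : programRegion P.primalLiftObj P.primalLiftIneq primalEq ⊆
      primalEmbed '' P.primalRegion := fun X hX => by
    obtain ⟨p, hp, rfl⟩ := P.exists_of_mem_primalLift hX.1 hX.2.1 hX.2.2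
    exact ⟨p, hp, rfl⟩
  have hmem : ∀ p ∈ P.primalRegion,
      primalEmbed p ∈ programRegion P.primalLiftObj P.primalLiftIneq primalEq := fun p hp =>
    ⟨lt_top_iff_ne_top.2 hp.2, (P.mem_primal_solutions.1 hp.1).2.1, P.primalEq_embed hp.1⟩
  have hne' : (programRegion P.primalLiftObj P.primalLiftIneq primalEq).Nonempty := by
    obtain ⟨p, hp⟩ := hne
    exact ⟨_, hmem p hp⟩
  have hbd' := (isBounded_image_linearMap primalEmbed hbd).subset hsub
  have l₀ : LowerSemicontinuous P.primalLiftObj :=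
    (P.primalFun_lsc 0).comp (primalProj 0).continuous_of_finiteDimensional
  have l : ∀ i, LowerSemicontinuous (P.primalLiftIneq i) := fun i =>
    (P.primalFun_lsc i.succ).comp (primalProj i.succ).continuous_of_finiteDimensional
  obtain ⟨X, hX, hmin⟩ := exists_min_of_bounded l₀ l hne' hbd'
  obtain ⟨p, hp, rfl⟩ := hsub hX
  have hmin' : ∀ Y ∈ programRegion P.primalLiftObj P.primalLiftIneq primalEq,
      P.primalObj p ≤ P.primalLiftObj Y := hmin
  have hinf : P.primalInf = P.primalObj p := by
    refine le_antisymm (P.primalInf_le hp.1) (le_iInf₂ fun p' hp' => ?_)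
    rcases eq_top_or_lt_top (P.primalObj p') with htop | hlt
    · rw [htop]; exact le_top
    · have e : P.primalLiftObj (primalEmbed p') = P.primalObj p' := rfl
      exact (hmin' (primalEmbed p') (hmem p' ⟨hp', hlt.ne⟩)).trans_eq e
  refine ⟨le_antisymm (le_of_forall_lt fun a ha => ?_) P.dualSup_le_primalInf,
    fun _ => ⟨p, hp, hinf.symm⟩⟩
  obtain ⟨v, hav, hv⟩ := EReal.lt_iff_exists_real_btwn.1 ha
  obtain ⟨μ, η, hm⟩ := exists_isMultiplier_bounded P.primalLiftObj_convex
    P.primalLiftIneq_convex l₀ l (fun X => P.primalFun_bot_lt _ _)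
    (fun i X => P.primalFun_bot_lt _ _) hne' hbd' (v := v)
    (fun X hX => (hv.trans_eq hinf).trans_le (hmin' X hX))
  obtain ⟨q, hq, hvq⟩ := P.exists_dual_of_isMultiplier hm
  exact hav.trans_le (hvq.trans (P.le_dualSup hq))

/-! ### The dual problem -/

/-- A dual decision vector with equal copies. -/
def dualEmbed : DualVar dx dz I →ₗ[ℝ] DualLift dx dz I L :=
  LinearMap.prodMap LinearMap.id (LinearMap.pi fun _ => LinearMap.id)

theorem dualEq_embed {q : DualVar dx dz I} (hq : q ∈ P.dualConstraints.solutions) (s) :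
    dualEq s (dualEmbed q : DualLift dx dz I L) = 0 := by
  rcases s with s | s | s | s
  · exact (P.mem_dual_solutions.1 hq).2.2 s
  · exact sub_self _
  · exact sub_self _
  · exact sub_self _

theorem nonneg_of_dualCost_lt_top {q : DualVar dx dz I} (h : P.dualCost q < ⊤) (i : Fin I) :
    0 ≤ q.2.2.1 i :=
  nonneg_of_perspective_lt_top (((P.dualCost_lt_top_iff q).1 h).2 i)

theorem mem_dualRegion {q : DualVar dx dz I} : q ∈ P.dualRegion ↔
    q ∈ P.dualConstraints.solutions ∧ P.dualCost q < ⊤ := by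
  refine and_congr_right fun _ => ?_
  rw [dualObj_eq, Ne, EReal.neg_eq_bot_iff, lt_top_iff_ne_top]

theorem exists_of_mem_dualLift {X : DualLift dx dz I L} (h₀ : P.dualLiftObj X < ⊤)
    (h : ∀ j, P.dualLiftIneq j X ≤ 0) (he : ∀ s, dualEq s X = 0) :
    ∃ q ∈ P.dualRegion, X = dualEmbed q := by
  have hX : X = dualEmbed (dualProj 0 X) := by
    refine Prod.ext rfl (funext fun ℓ => ?_)
    refine Fin.cases rfl (fun ℓ => ?_) ℓ
    refine Prod.ext (funext fun k => ?_) (Prod.ext (funext fun i => ?_)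
      (funext fun i => funext fun k => ?_))
    · exact sub_eq_zero.1 (he (Sum.inr (Sum.inl (k, ℓ))))
    · exact sub_eq_zero.1 (he (Sum.inr (Sum.inr (Sum.inl (i, ℓ)))))
    · exact sub_eq_zero.1 (he (Sum.inr (Sum.inr (Sum.inr ((i, k), ℓ)))))
  obtain ⟨q, hq⟩ : ∃ q, X = dualEmbed q := ⟨_, hX⟩
  subst hq
  have h₀' : P.dualCost q < ⊤ := h₀
  exact ⟨q, P.mem_dualRegion.2 ⟨⟨P.nonneg_of_dualCost_lt_top h₀', h,
    fun k => EReal.coe_eq_zero.2 (he (Sum.inl k))⟩, h₀'⟩, rfl⟩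

theorem dualLiftObj_convex : IsConvexFun P.dualLiftObj :=
  P.dualCost_convex.comp_linearMap (dualProj 0)

theorem dualLiftIneq_convex (j) : IsConvexFun (P.dualLiftIneq j) :=
  (P.dualIneq_convex j).comp_linearMap (dualProj (dualCopy j))

theorem exists_primal_of_dual_slater {q : DualVar dx dz I}
    (hq : P.dualConstraints.IsMaxSlaterPoint P.dualObj q) {v : ℝ}
    (hv : P.dualSup ≤ ((-v : ℝ) : EReal)) :
    ∃ p ∈ P.primalConstraints.solutions, P.primalObj p ≤ ((-v : ℝ) : EReal) := by
  obtain ⟨hS, h₀⟩ := hq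
  have hneg : (fun q => -P.dualObj q) = P.dualCost := by
    funext q
    rw [dualObj_eq, neg_neg]
  rw [hneg] at h₀
  set F : Option (Fin L ⊕ Fin I × Fin L) → DualVar dx dz I → EReal :=
    fun b => b.elim P.dualCost P.dualConstraints.ineq with hF
  set π : Option (Fin L ⊕ Fin I × Fin L) → DualLift dx dz I L →ₗ[ℝ] DualVar dx dz I :=
    fun b => b.elim (dualProj 0) fun j => dualProj (dualCopy j) with hπ
  have hdom : programDomain P.dualLiftObj P.dualLiftIneq = {X | ∀ b, π b X ∈ effDomain (F b)} := by
    ext X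
    exact ⟨fun hX b => match b with
      | none => hX.1
      | some j => hX.2 j, fun hX => ⟨hX none, fun j => hX (some j)⟩⟩
  have hcore : IsCorePoint (programDomain P.dualLiftObj P.dualLiftIneq) (dualEmbed q) := by
    rw [hdom]
    refine IsCorePoint.iInter_preimage (fun b => ?_) _ fun b => ?_
    · match b with
      | none => exact P.dualCost_convex.convex_effDomain
      | some j => exact (P.dualIneq_convex j).convex_effDomain
    · match b with
      | none => exact IsCorePoint.of_mem_intrinsicInterior h₀
      | some j => exact IsCorePoint.of_mem_intrinsicInterior (hS.mem_ri_ineq j)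
  -- Off the diagonal the copies of `lam` may differ. Each copy with `ℓ ≥ 1` enters the perspectives
  -- of its own `c_ℓ`, whose finiteness makes that copy nonnegative.
  have hground : ∀ X ∈ programDomain P.dualLiftObj P.dualLiftIneq,
      ∀ j : Fin L ⊕ Fin I × Fin L,
      dualProj (dualCopy j) X ∈ P.dualConstraints.ground := fun X hX j i => by
    obtain ⟨ℓ, hℓ⟩ : ∃ ℓ : Fin L, dualCopy j = ℓ.succ := by
      rcases j with ℓ | s
      exacts [⟨ℓ, rfl⟩, ⟨s.2, rfl⟩]
    rw [hℓ]
    exact nonneg_of_perspective_lt_top (hX.2 (Sum.inr (i, ℓ)))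
  obtain ⟨μ, η, hm⟩ := exists_isMultiplier_slater (a := dualEq) P.dualLiftObj_convex
    P.dualLiftIneq_convex (fun X => P.dualCost_bot_lt _) (fun j X => P.dualIneq_bot_lt _ _)
    hcore (fun j => by
      by_cases hl : P.dualConstraints.IsLinear (P.dualConstraints.ineq j)
      · obtain ⟨g, hg⟩ := hl
        exact Or.inr ⟨hS.mem_solutions.2.1 j, g.comp (dualProj (dualCopy j)).toAffineMap,
          fun X hX => hg _ (hground X hX j)⟩
      · exact Or.inl (hS.strict_of_nonlinear j hl))
    (P.dualEq_embed hS.mem_solutions) (v := v) (fun X hX hXe => by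
      rcases eq_top_or_lt_top (P.dualLiftObj X) with htop | hlt
      · rw [htop]; exact le_top
      · obtain ⟨q', hq', rfl⟩ := P.exists_of_mem_dualLift hlt hX hXe
        have h1 := (P.le_dualSup hq'.1).trans hv
        rw [dualObj_eq, EReal.coe_neg, EReal.neg_le_neg_iff] at h1
        exact h1)
  exact P.exists_primal_of_isMultiplier hm

theorem of_dual_slater {q : DualVar dx dz I}
    (hq : P.dualConstraints.IsMaxSlaterPoint P.dualObj q) :
    P.primalInf = P.dualSup ∧ P.PrimalSolvable := by
  have hweak := P.dualSup_le_primalInf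
  have hlt : ⊥ < P.dualSup := by
    have hdom : q ∈ effDomain fun q => -P.dualObj q := intrinsicInterior_subset hq.2
    have h1 : -P.dualObj q < ⊤ := hdom
    refine lt_of_lt_of_le ?_ (P.le_dualSup hq.1.mem_solutions)
    rw [bot_lt_iff_ne_bot]
    intro hb
    rw [hb, EReal.neg_bot] at h1
    exact lt_irrefl _ h1
  rcases eq_top_or_lt_top P.dualSup with htop | htop
  · rw [htop] at hweak ⊢
    refine ⟨top_le_iff.1 hweak, fun ⟨p, hp⟩ => absurd ?_ hp.2⟩
    exact top_le_iff.1 (hweak.trans (P.primalInf_le hp.1))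
  · have hco := EReal.coe_toReal htop.ne hlt.ne'
    -- The dual is handled as minimization of `dualCost`, so its optimal value enters with the
    -- opposite sign.
    obtain ⟨p, hp, hvp⟩ := P.exists_primal_of_dual_slater hq (v := -P.dualSup.toReal)
      (by rw [neg_neg, hco])
    rw [neg_neg, hco] at hvp
    have heq : P.primalInf = P.dualSup := le_antisymm ((P.primalInf_le hp).trans hvp) hweak
    exact ⟨heq, fun _ => ⟨p, ⟨hp, (hvp.trans_lt htop).ne⟩,
      le_antisymm (hvp.trans heq.symm.le) (P.primalInf_le hp)⟩⟩

theorem of_dual_bounded (hne : P.dualRegion.Nonempty) (hbd : Bornology.IsBounded P.dualRegion) :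
    P.primalInf = P.dualSup ∧ P.DualSolvable := by
  have hsub : programRegion P.dualLiftObj P.dualLiftIneq dualEq ⊆
      dualEmbed '' P.dualRegion := fun X hX => by
    obtain ⟨p, hp, rfl⟩ := P.exists_of_mem_dualLift hX.1 hX.2.1 hX.2.2
    exact ⟨p, hp, rfl⟩
  have hmem : ∀ q ∈ P.dualRegion,
      dualEmbed q ∈ programRegion P.dualLiftObj P.dualLiftIneq dualEq := fun q hq =>
    ⟨(P.mem_dualRegion.1 hq).2, hq.1.2.1, P.dualEq_embed hq.1⟩
  have hne' : (programRegion P.dualLiftObj P.dualLiftIneq dualEq).Nonempty := by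
    obtain ⟨q, hq⟩ := hne
    exact ⟨_, hmem q hq⟩
  have hbd' := (isBounded_image_linearMap dualEmbed hbd).subset hsub
  have l₀ : LowerSemicontinuous P.dualLiftObj :=
    P.dualCost_lsc.comp (dualProj 0).continuous_of_finiteDimensional
  have l : ∀ j, LowerSemicontinuous (P.dualLiftIneq j) := fun j =>
    (P.dualIneq_lsc j).comp (dualProj (dualCopy j)).continuous_of_finiteDimensional
  obtain ⟨X, hX, hmin⟩ := exists_min_of_bounded l₀ l hne' hbd'
  obtain ⟨q, hq, rfl⟩ := hsub hX
  have hmin' : ∀ Y ∈ programRegion P.dualLiftObj P.dualLiftIneq dualEq,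
      P.dualCost q ≤ P.dualLiftObj Y := hmin
  have hsup : P.dualSup = P.dualObj q := by
    refine le_antisymm (iSup₂_le fun q' hq' => ?_) (P.le_dualSup hq.1)
    rw [dualObj_eq, dualObj_eq, EReal.neg_le_neg_iff]
    rcases eq_top_or_lt_top (P.dualCost q') with htop | hlt
    · rw [htop]; exact le_top
    · have e : P.dualLiftObj (dualEmbed q') = P.dualCost q' := rfl
      exact (hmin' (dualEmbed q') (hmem q' (P.mem_dualRegion.2 ⟨hq', hlt⟩))).trans_eq e
  refine ⟨le_antisymm ?_ P.dualSup_le_primalInf, fun _ => ⟨q, hq, hsup.symm⟩⟩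
  refine le_of_forall_gt fun a ha => ?_
  obtain ⟨v, hv, hva⟩ := EReal.lt_iff_exists_real_btwn.1 ha
  rw [hsup, dualObj_eq, EReal.neg_lt_comm] at hv
  obtain ⟨μ, η, hm⟩ := exists_isMultiplier_bounded P.dualLiftObj_convex
    P.dualLiftIneq_convex l₀ l (fun X => P.dualCost_bot_lt _)
    (fun j X => P.dualIneq_bot_lt _ _) hne' hbd' (v := -v)
    (fun X hX => by
      rw [EReal.coe_neg]
      exact hv.trans_le (hmin' X hX))
  obtain ⟨p, hp, hvp⟩ := P.exists_primal_of_isMultiplier hm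
  rw [neg_neg] at hvp
  exact ((P.primalInf_le hp).trans hvp).trans_lt hva

end RobustProgram

theorem mainTheorem5 {dx dz I L : ℕ} (P : RobustProgram dx dz I L) :
    P.dualSup ≤ P.primalInf ∧
    ((∃ p, P.primalConstraints.IsMinSlaterPoint P.primalObj p) →
      P.primalInf = P.dualSup ∧ P.DualSolvable) ∧
    ((∃ q, P.dualConstraints.IsMaxSlaterPoint P.dualObj q) →
      P.primalInf = P.dualSup ∧ P.PrimalSolvable) ∧
    (P.primalRegion.Nonempty ∧ Bornology.IsBounded P.primalRegion →
      P.primalInf = P.dualSup ∧ P.PrimalSolvable) ∧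
    (P.dualRegion.Nonempty ∧ Bornology.IsBounded P.dualRegion →
      P.primalInf = P.dualSup ∧ P.DualSolvable) :=
  ⟨P.dualSup_le_primalInf, fun ⟨_, hp⟩ => P.of_primal_slater hp,
    fun ⟨_, hq⟩ => P.of_dual_slater hq, fun h => P.of_primal_bounded h.1 h.2,
    fun h => P.of_dual_bounded h.1 h.2⟩
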